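/- **Proposition 1.2.** Let $K$ be a henselian discrete valuation field with valuation ring $\mathcal O_K$ and residue field $F$ of characteristic $p>0$ (not assumed perfect). Let $L$ be a totally ramified finite Galois extension of $K$ of degree $n=e$ (so the ramification index is $e=n$ and the residue field is $E=F$), with valuation ring $\mathcal O_L$, maximal ideal $\mathfrak m_L$ and $G=\mathrm{Gal}(L/K)$. Let $\alpha\in L$ be a uniformizer and $f\in\mathcal O_K[X]$ its minimal polynomial. Write $f=\prod_{j=1}^n(X-\alpha_j)$ with $\alpha_n=\alpha$ and $\mathrm{ord}_L(\alpha_j-\alpha_n)$ (weakly) increasing in $j$. *Conventions.* For integers $j\ge 0$, $G_{j,\mathrm{cl}}=\mathrm{Ker}(G\to\mathrm{Aut}(\mathcal O_L/\mathfrak m_L^{j+1}))$, and $G^v_{\mathrm{cl}}$ is the classical upper numbering, $G^v_{\mathrm{cl}}=G_{\lceil u\rceil,\mathrm{cl}}$ for $v=\varphi(u)$, $u\ge0$, where $\varphi(u)=\int_0^u dt/[G_{0,\mathrm{cl}}:G_{\lceil t\rceil,\mathrm{cl}}]$ is the Herbrand function. For rational $r>1$ put $G^r=G^{r-1}_{\mathrm{cl}}$.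 For a subgroup $H\subset G$ on which the following makes sense put $\beta(\sigma)=\frac{\sigma(\alpha)-\alpha}{\alpha_{n-1}-\alpha_n}\bmod\mathfrak m_L\in E$ for $\sigma\in H$, and $$b_1=\prod_{\sigma\in H}(X-\beta(\sigma))\Big/\prod_{\sigma\in H,\,\sigma\ne1}(-\beta(\sigma))\in E[X].$$ A line $V$ over $E$ is regarded as the group scheme $\mathrm{Spec}\,\mathrm{Sym}(V^\vee)$, a finite group as a constant group scheme, and exactness means exactness as group schemes over $E$. For $r>1$ with $er\in\mathbf Z$, let $Q^{[r]}_T=\mathrm{Spec}\,\mathcal O_L[X][f/\alpha^{er}]$, let $Q^{(r)}_T$ be its normalization, let $Q^{[r]}_E$ and $Q^{(r)}_E$ be the reduced closed fibers over $T=\mathrm{Spec}\,\mathcal O_L$, and let $Q^{(r)\circ}_E\subset Q^{(r)}_E$ be the connected component containing the image of the closed point of $T$ under the section of $Q^{(r)}_T$ lifting $X\mapsto\alpha$. The scheme $Q^{[r]}_E=\mathrm{Spec}\,E[S]$, with $S$ the class of $f/\alpha^{er}$, is identified with the line $\mathfrak m_L^{e(r-1)}/\mathfrak m_L^{e(r-1)+1}$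 by sending the point $S=s$ to $s\cdot\alpha^{er}/f(0)$ (this is an isomorphism). **1.** Let $r>1$ be the largest rational number such that $G^r\ne1$ (assuming it exists). Then $$er=\mathrm{ord}_L f'(\alpha)+\mathrm{ord}_L(\alpha_{n-1}-\alpha_n).$$ The map $\beta$ is well defined and injective on $H=G^r$. For $\sigma\in G$, the section of $Q^{(r)}_T$ lifting $X\mapsto\sigma(\alpha)$ sends the closed point into $Q^{(r)\circ}_E$ if and only if $\sigma\in G^r$; this defines $G^r\to Q^{(r)\circ}_E$. There is a unique group scheme structure on $Q^{(r)\circ}_E$ whose unit is the point given by $\sigma=1$ and for which $Q^{(r)\circ}_E\to Q^{[r]}_E$ is a homomorphism. With it, both rows of the following diagram are exact and there is an isomorphism of exact sequences $$\begin{array}{ccccccccc}0&\to&G^r&\to&Q^{(r)\circ}_E&\to&Q^{[r]}_E&\to&0\\&&\|&&\uparrow&&\uparrow&&\\0&\to&G^r&\xrightarrow{\ \beta\ }&\mathbf G_a&\xrightarrow{\ b_1\ }&\mathbf G_a&\to&0\end{array}$$ in which the right vertical arrow is the isomorphism $\mathbf G_a\to\mathfrak m_L^{e(r-1)}/\mathfrak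 m_L^{e(r-1)+1}=Q^{[r]}_E$ sending $1$ to the class of $f'(\alpha)(\alpha_{n-1}-\alpha_n)/f(0)$. **2.** Let $i>0$ be the largest integer such that $G_{i,\mathrm{cl}}\ne1$ (assuming it exists). Then $$i=\mathrm{ord}_L(\alpha_{n-1}-\alpha_n)-1,$$ and $\beta$ is well defined and injective on $H=G_{i,\mathrm{cl}}$. Let $M\subset L$ be the fixed field of $G_{i,\mathrm{cl}}$, and put $U^j_L=1+\mathfrak m_L^j$, $U^j_M=1+\mathfrak m_M^j$. The norm $N_{L/M}$ induces $N^i\colon U^i_L/U^{i+1}_L\to U^i_M/U^{i+1}_M$ and the trace induces an isomorphism $T^i\colon U^i_L/U^{i+1}_L=\mathfrak m_L^i/\mathfrak m_L^{i+1}\to\mathfrak m_M^i/\mathfrak m_M^{i+1}=U^i_M/U^{i+1}_M$. These are regarded as morphisms of lines over $E$: for $y\in\mathfrak m_L^i$, the polynomial $N_{L[X]/M[X]}(1+Xy)-1$ has coefficients $c_j\in\mathfrak m_M^i$, and $N^i$ maps the point $X\cdot\bar y$ to $\sum_j\bar c_jX^j$. Then both rows of the following diagram are exact sequences of group schemes over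 $E$ and the diagram is an isomorphism of exact sequences: $$\begin{array}{ccccccccc}0&\to&G_{i,\mathrm{cl}}&\xrightarrow{\sigma\mapsto\sigma(\alpha)/\alpha}&U^i_L/U^{i+1}_L&\xrightarrow{(T^i)^{-1}\circ N^i}&U^i_L/U^{i+1}_L&\to&0\\&&\|&&\uparrow&&\uparrow&&\\0&\to&G_{i,\mathrm{cl}}&\xrightarrow{\ \beta\ }&\mathbf G_a&\xrightarrow{\ b_1\ }&\mathbf G_a&\to&0\end{array}$$ where both vertical arrows $\mathbf G_a\to U^i_L/U^{i+1}_L$ are the isomorphism sending $1$ to the class of $\alpha_{n-1}/\alpha_n\in U^i_L$. Moreover, for $r$ as in 1 and $i$ as in 2, $G^r=G_{i,\mathrm{cl}}$, so that $\beta$ and $b_1$ are the same in both parts. -/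

import Mathlib

open IsLocalRing Polynomial TensorProduct

set_option linter.unusedSectionVars false

noncomputable section

namespace TotRam

universe u v

/-! ### Affine group schemes over a field and exact sequences -/

/-- A structure of affine group scheme over `k` on `Spec A`, given by comultiplication, counit
and antipode. -/
structure GroupLaw (k : Type u) (A : Type v) [Field k] [CommRing A] [Algebra k A] where
  comul : A →ₐ[k] A ⊗[k] A
  counit : A →ₐ[k] k
  antipode : A →ₐ[k] A
  coassoc : (Algebra.TensorProduct.assoc k k k A A A).toAlgHom.comp
      ((Algebra.TensorProduct.map comul (AlgHom.id k A)).comp comul) =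
    (Algebra.TensorProduct.map (AlgHom.id k A) comul).comp comul
  counit_left : (Algebra.TensorProduct.productMap
    ((Algebra.ofId k A).comp counit) (AlgHom.id k A)).comp comul = AlgHom.id k A
  counit_right : (Algebra.TensorProduct.productMap
    (AlgHom.id k A) ((Algebra.ofId k A).comp counit)).comp comul = AlgHom.id k A
  antipode_left : (Algebra.TensorProduct.productMap antipode (AlgHom.id k A)).comp comul =
    (Algebra.ofId k A).comp counit
  antipode_right : (Algebra.TensorProduct.productMap (AlgHom.id k A) antipode).comp comul =
    (Algebra.ofId k A).comp counit

section Groups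

variable {k : Type*} [Field k] {A B : Type*} [CommRing A] [Algebra k A] [CommRing B] [Algebra k B]

/-- The morphism `Spec A → Spec B` given by `φ : B → A` is a homomorphism of group schemes. -/
def GroupLaw.IsHom (GA : GroupLaw k A) (GB : GroupLaw k B) (φ : B →ₐ[k] A) : Prop :=
  (Algebra.TensorProduct.map φ φ).comp GB.comul = GA.comul.comp φ

/-- The product of two `k`-rational points. -/
def GroupLaw.mulPt (GA : GroupLaw k A) (P Q : A →ₐ[k] k) : A →ₐ[k] k :=
  (Algebra.TensorProduct.productMap P Q).comp GA.comul

/-- `0 → Γ → Spec A → Spec B → 0` is an exact sequence of group schemes over `k`, where `Γ` is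
regarded as a constant group scheme, `Γ → Spec A` is given by the rational points `ι γ` and
`Spec A → Spec B` is given by `φ : B → A`: both maps are homomorphisms,
`Γ → Spec A` is a closed immersion whose image is the scheme-theoretic kernel of
`Spec A → Spec B`, and `Spec A → Spec B` is faithfully flat. -/
structure IsExactSequence {Γ : Type*} [Group Γ] (GA : GroupLaw k A) (GB : GroupLaw k B)
    (ι : Γ → (A →ₐ[k] k)) (φ : B →ₐ[k] A) : Prop where
  map_mul : ∀ γ γ' : Γ, ι (γ * γ') = GA.mulPt (ι γ) (ι γ')
  isHom : GA.IsHom GB φ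
  closedImmersion : Function.Surjective (fun (a : A) (γ : Γ) => ι γ a)
  kernel : ∀ a : A, (∀ γ, ι γ a = 0) ↔ a ∈ (RingHom.ker GB.counit).map φ
  faithfullyFlat : φ.toRingHom.FaithfullyFlat

/-- The additive group `𝐆ₐ = Spec k[X]`. -/
def additiveGroup (k : Type*) [Field k] : GroupLaw k k[X] where
  comul := aeval (X ⊗ₜ[k] 1 + 1 ⊗ₜ[k] X)
  counit := aeval 0
  antipode := aeval (-X)
  coassoc := by
    ext
    simp [Algebra.TensorProduct.one_def, tmul_add, add_tmul, add_assoc]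
  counit_left := by ext; simp
  counit_right := by ext; simp
  antipode_left := by ext; simp
  antipode_right := by ext; simp

/-- The coordinate ring `Sym (V^∨)` of a finite dimensional vector space `V` over `k`, regarded
as a vector group over `k`. -/
abbrev Coord (k V : Type*) [Field k] [AddCommGroup V] [Module k V] :=
  SymmetricAlgebra k (Module.Dual k V)

/-- The coordinate function on the vector group `V` given by a linear form. -/
abbrev coord {V : Type*} [AddCommGroup V] [Module k V] (ℓ : Module.Dual k V) : Coord k V :=
  SymmetricAlgebra.ι k (Module.Dual k V) ℓ

/-- The group scheme structure of a vector group, given by addition. -/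
def vectorGroup (k V : Type*) [Field k] [AddCommGroup V] [Module k V] :
    GroupLaw k (Coord k V) where
  comul := SymmetricAlgebra.lift
    ((Algebra.TensorProduct.includeLeft (R := k) (S := k) (A := Coord k V)
        (B := Coord k V)).toLinearMap ∘ₗ SymmetricAlgebra.ι k (Module.Dual k V) +
      (Algebra.TensorProduct.includeRight (R := k) (A := Coord k V)
        (B := Coord k V)).toLinearMap ∘ₗ SymmetricAlgebra.ι k (Module.Dual k V))
  counit := SymmetricAlgebra.lift 0
  antipode := SymmetricAlgebra.lift (-(SymmetricAlgebra.ι k (Module.Dual k V)))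
  coassoc := by
    ext
    simp [Algebra.TensorProduct.one_def, tmul_add, add_tmul, add_assoc]
  counit_left := by ext; simp
  counit_right := by ext; simp
  antipode_left := by ext; simp
  antipode_right := by ext; simp

/-- The point `v ⊗ s ∈ V ⊗ R` of the vector group `V` with values in a `k`-algebra `R`.
With `R = k` and `s = 1` it is the rational point `v`; with `R = k[X]` and `s = X` it is
the homomorphism `𝐆ₐ → V` that sends `1` to `v`. -/
def vectorPoint {V : Type*} [AddCommGroup V] [Module k V] (v : V) (s : A) : Coord k V →ₐ[k] A :=
  SymmetricAlgebra.lift ((LinearMap.toSpanSingleton k A s) ∘ₗ Module.Dual.eval k V v)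

lemma vectorPoint_isHom {V : Type*} [AddCommGroup V] [Module k V] (v : V) :
    (additiveGroup k).IsHom (vectorGroup k V) (vectorPoint v (X : k[X])) := by
  rw [GroupLaw.IsHom]
  ext ℓ
  simp [vectorPoint, vectorGroup, additiveGroup, smul_tmul']

end Groups

/-! ### Graded pieces -/

/-- `I ^ i / I ^ (i + 1)`. -/
abbrev Gr {O : Type*} [CommRing O] (I : Ideal O) (i : ℕ) :=
  ↥(I ^ i) ⧸ (I • ⊤ : Submodule O ↥(I ^ i))

/-- The class in `I ^ i / I ^ (i + 1)` of an element of `I ^ i`. -/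
def Gr.mk {O : Type*} [CommRing O] {I : Ideal O} {i : ℕ} (x : ↥(I ^ i)) : Gr I i :=
  Submodule.Quotient.mk x

instance {O : Type*} [CommRing O] [IsLocalRing O] (i : ℕ) :
    Module (ResidueField O) (Gr (maximalIdeal O) i) :=
  inferInstanceAs (Module (O ⧸ maximalIdeal O) (Gr (maximalIdeal O) i))

/-- The line `𝔪 ^ i / 𝔪 ^ (i + 1)` as a vector group over the residue field. -/
abbrev lineGroup (O : Type*) [CommRing O] [IsLocalRing O] (i : ℕ) :
    GroupLaw (ResidueField O) (Coord (ResidueField O) (Gr (maximalIdeal O) i)) :=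
  vectorGroup (ResidueField O) (Gr (maximalIdeal O) i)

/-- The group `U ^ i` of units congruent to `1` modulo `I ^ i`. -/
def higherUnits {O : Type*} [CommRing O] (I : Ideal O) (i : ℕ) : Subgroup Oˣ :=
  (Units.map (Ideal.Quotient.mk (I ^ i)).toMonoidHom).ker

/-- `U ^ i / U ^ (i + 1)`. -/
abbrev GrUnits {O : Type*} [CommRing O] (I : Ideal O) (i : ℕ) :=
  ↥(higherUnits I i) ⧸ (higherUnits I (i + 1)).subgroupOf (higherUnits I i)

/-- The class in `U ^ i / U ^ (i + 1)` of an element of `U ^ i`. -/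
def GrUnits.mk {O : Type*} [CommRing O] {I : Ideal O} {i : ℕ} (x : ↥(higherUnits I i)) :
    GrUnits I i :=
  QuotientGroup.mk x

lemma sub_one_mem {O : Type*} [CommRing O] {I : Ideal O} {i : ℕ} {x : Oˣ}
    (hx : x ∈ higherUnits I i) : (x : O) - 1 ∈ I ^ i := by
  rw [higherUnits, MonoidHom.mem_ker, Units.ext_iff] at hx
  rw [← Ideal.Quotient.eq_zero_iff_mem, map_sub, sub_eq_zero]
  simpa using hx

lemma Gr.mk_eq_zero {O : Type*} [CommRing O] {I : Ideal O} {i : ℕ} {x : ↥(I ^ i)}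
    (hx : (x : O) ∈ I ^ (i + 1)) : Gr.mk x = 0 := by
  rw [Gr.mk, Submodule.Quotient.mk_eq_zero]
  rw [pow_succ'] at hx
  have : (I • ⊤ : Submodule O ↥(I ^ i)).map (I ^ i).subtype = I * I ^ i := by
    rw [Submodule.map_smul'']
    simp
  rw [← this] at hx
  obtain ⟨y, hy, hxy⟩ := hx
  have : y = x := Subtype.ext hxy
  exact this ▸ hy

/-- The identification `U ^ i / U ^ (i + 1) = I ^ i / I ^ (i + 1)` for `i > 0`, sending the class
of `1 + x` to the class of `x`. -/
def unitsToGr {O : Type*} [CommRing O] (I : Ideal O) {i : ℕ} (hi : 0 < i) :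
    GrUnits I i →* Multiplicative (Gr I i) :=
  QuotientGroup.lift _
    { toFun := fun x => Multiplicative.ofAdd (Gr.mk ⟨(x : Oˣ) - 1, sub_one_mem x.2⟩)
      map_one' := by
        rw [← ofAdd_zero]
        congr 1
        exact Gr.mk_eq_zero (by simp)
      map_mul' := fun x y => by
        rw [← ofAdd_add]
        congr 1
        rw [← sub_eq_zero, Gr.mk, Gr.mk, Gr.mk, ← Submodule.Quotient.mk_add,
          ← Submodule.Quotient.mk_sub]
        refine Gr.mk_eq_zero ?_
        have h : ((x : Oˣ) - 1 : O) * ((y : Oˣ) - 1 : O) ∈ I ^ (i + 1) := by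
          refine Ideal.pow_le_pow_right (by omega : i + 1 ≤ i + i) ?_
          rw [pow_add]
          exact Ideal.mul_mem_mul (sub_one_mem x.2) (sub_one_mem y.2)
        convert h using 1
        simp
        ring }
    (fun x hx => by
      change Multiplicative.ofAdd _ = Multiplicative.ofAdd 0
      congr 1
      exact Gr.mk_eq_zero (sub_one_mem (Subgroup.mem_subgroupOf.1 hx)))

/-! ### Dilatations and their normalizations -/

section Dilatation

variable {O : Type*} [CommRing O] [IsDomain O] {L : Type*} [Field L]
  [Algebra O L] [IsFractionRing O L]

variable (L) in
/-- The coordinate ring `O[X][f / α ^ m] ⊆ L[X]` of the dilatation. -/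
def dilatation (f : O[X]) (α : O) (m : ℕ) : Subalgebra O L[X] :=
  Algebra.adjoin O {X, C ((algebraMap O L α ^ m)⁻¹) * f.map (algebraMap O L)}

variable (L) in
/-- The function `f / α ^ m` on the dilatation. -/
def dilatationCoord (f : O[X]) (α : O) (m : ℕ) : dilatation L f α m :=
  ⟨C ((algebraMap O L α ^ m)⁻¹) * f.map (algebraMap O L), Algebra.subset_adjoin (by simp)⟩

variable (L) in
/-- The coordinate ring of the normalization of the dilatation. As `L[X]` is integrally closed
and has the same field of fractions as the dilatation, the normalization is
the integral closure in `L[X]`. -/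
def normalization (f : O[X]) (α : O) (m : ℕ) : Subalgebra O L[X] :=
  (integralClosure (dilatation L f α m) L[X]).restrictScalars O

lemma dilatation_le_normalization (f : O[X]) (α : O) (m : ℕ) :
    dilatation L f α m ≤ normalization L f α m := fun x hx =>
  (integralClosure (dilatation L f α m) L[X]).algebraMap_mem ⟨x, hx⟩

lemma isIntegrallyClosed_normalization (f : O[X]) (α : O) (m : ℕ) :
    IsIntegrallyClosed (normalization L f α m) :=
  haveI : IsIntegrallyClosedIn (integralClosure (dilatation L f α m) L[X]) L[X] := inferInstance
  IsIntegrallyClosed.of_isIntegrallyClosed_of_isIntegrallyClosedIn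
    (integralClosure (dilatation L f α m) L[X]) L[X]

variable (L) in
/-- The projection from the normalization to the dilatation, on coordinate rings. -/
def toNormalization (f : O[X]) (α : O) (m : ℕ) :
    dilatation L f α m →ₐ[O] normalization L f α m :=
  Subalgebra.inclusion (dilatation_le_normalization f α m)

lemma aeval_mem_range [IsIntegrallyClosed O] {f : O[X]} {α : O} {m : ℕ} {x : O}
    (hx : f.eval x = 0) (g : normalization L f α m) :
    aeval (algebraMap O L x) (g : L[X]) ∈ (⊥ : Subalgebra O L) := by
  obtain ⟨g, hg⟩ := g
  have hg : IsIntegral (dilatation L f α m) g := hg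
  let ev : L[X] →ₐ[O] L := (aeval (R := L) (algebraMap O L x)).restrictScalars O
  have hA : (dilatation L f α m).map ev ≤ ⊥ := by
    rw [dilatation, AlgHom.map_adjoin, Algebra.adjoin_le_iff]
    rintro _ ⟨y, rfl | rfl, rfl⟩
    · exact ⟨x, by simp [ev]⟩
    · refine ⟨0, ?_⟩
      have : eval (algebraMap O L x) (f.map (algebraMap O L)) = 0 := by
        rw [eval_map_algebraMap, aeval_algebraMap_apply, aeval_def, eval₂_eq_eval_map]
        simp [hx]
      simp [ev, coe_aeval_eq_eval, this]
  have h1 : IsIntegral O (ev g) := by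
    obtain ⟨P, hP, hPg⟩ := hg
    have hc : ∀ a : dilatation L f α m, ∃ b : O, algebraMap O L b = ev a := fun a => by
      obtain ⟨b, hb⟩ := hA ⟨a, a.2, rfl⟩
      exact ⟨b, hb⟩
    have hlift : (P.map ((ev.toRingHom.comp (algebraMap (dilatation L f α m) L[X])))) ∈
        Polynomial.lifts (algebraMap O L) := by
      rw [Polynomial.lifts_iff_coeff_lifts]
      intro j
      obtain ⟨b, hb⟩ := hc (P.coeff j)
      exact ⟨b, by simpa using hb⟩
    obtain ⟨Q, hQ, -, hQm⟩ := Polynomial.lifts_and_degree_eq_and_monic hlift (hP.map _)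
    refine ⟨Q, hQm, ?_⟩
    rw [eval₂_eq_eval_map, hQ, eval_map]
    have := congrArg ev.toRingHom hPg
    rw [map_zero, Polynomial.hom_eval₂] at this
    exact this
  obtain ⟨b, hb⟩ := IsIntegrallyClosed.isIntegral_iff.1 h1
  exact ⟨b, hb⟩

/-- For a root `x` of `f` in `O`, the unique lifting to the normalization of the section
`X ↦ x` of the affine line over `O`. -/
def rootSection [IsIntegrallyClosed O] {f : O[X]} (α : O) (m : ℕ) {x : O} (hx : f.eval x = 0) :
    normalization L f α m →ₐ[O] O :=
  (Algebra.botEquivOfInjective (R := O) (A := L) (IsFractionRing.injective O L)).toAlgHom.comp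
    ((((aeval (R := L) (algebraMap O L x)).restrictScalars O).comp
      (normalization L f α m).val).codRestrict ⊥ (fun g => aeval_mem_range hx g))

lemma algebraMap_rootSection [IsIntegrallyClosed O] {f : O[X]} (α : O) (m : ℕ) {x : O}
    (hx : f.eval x = 0) (g : normalization L f α m) :
    algebraMap O L (rootSection α m hx g) = eval (algebraMap O L x) (g : L[X]) := by
  exact congrArg Subtype.val ((Algebra.botEquivOfInjective (R := O) (A := L)
    (IsFractionRing.injective O L)).symm_apply_apply _)

end Dilatation

/-! ### Closed fibers -/

section Fiber

variable (O : Type*) [CommRing O] [IsLocalRing O]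

/-- The coordinate ring of the reduced closed fiber of `Spec S` over `Spec O`. -/
def ReducedFiber (S : Type*) [CommRing S] [Algebra O S] :=
  (ResidueField O ⊗[O] S) ⧸ nilradical (ResidueField O ⊗[O] S)

instance (S : Type*) [CommRing S] [Algebra O S] : CommRing (ReducedFiber O S) :=
  inferInstanceAs (CommRing ((ResidueField O ⊗[O] S) ⧸ nilradical (ResidueField O ⊗[O] S)))

instance (S : Type*) [CommRing S] [Algebra O S] :
    Algebra (ResidueField O) (ReducedFiber O S) :=
  inferInstanceAs (Algebra (ResidueField O)
    ((ResidueField O ⊗[O] S) ⧸ nilradical (ResidueField O ⊗[O] S)))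

variable {O} {S S' : Type*} [CommRing S] [Algebra O S] [CommRing S'] [Algebra O S']

/-- The restriction to the reduced closed fiber of a function. -/
def ReducedFiber.mk (s : S) : ReducedFiber O S :=
  Ideal.Quotient.mk (nilradical (ResidueField O ⊗[O] S)) (1 ⊗ₜ s)

/-- The map induced on reduced closed fibers. -/
def ReducedFiber.map (φ : S →ₐ[O] S') : ReducedFiber O S →ₐ[ResidueField O] ReducedFiber O S' :=
  Ideal.quotientMapₐ _ (Algebra.TensorProduct.map (AlgHom.id (ResidueField O) (ResidueField O)) φ)
    (fun _ hx => IsNilpotent.map hx _)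

/-- The rational point of the reduced closed fiber which is the image of the closed point
by a section. -/
def ReducedFiber.point (φ : S →ₐ[O] O) : ReducedFiber O S →ₐ[ResidueField O] ResidueField O :=
  Ideal.Quotient.liftₐ _
    (Algebra.TensorProduct.lift (AlgHom.id (ResidueField O) (ResidueField O))
      ((Algebra.ofId O (ResidueField O)).comp φ) (fun _ _ => Commute.all _ _))
    (fun _ hx => (IsNilpotent.map hx _).eq_zero)

end Fiber

/-- The point of `Spec A` underlying a rational point. -/
def primeOfPoint {k A : Type*} [Field k] [CommRing A] [Algebra k A] (P : A →ₐ[k] k) :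
    PrimeSpectrum A := ⟨RingHom.ker P, RingHom.ker_isPrime P⟩

/-- The coordinate ring of the connected component, with the reduced structure, of `Spec A`
containing a rational point. -/
def ComponentRing {k A : Type*} [Field k] [CommRing A] [Algebra k A] (P : A →ₐ[k] k) :=
  A ⧸ PrimeSpectrum.vanishingIdeal (connectedComponent (primeOfPoint P))

section ComponentRing

variable {k A : Type*} [Field k] [CommRing A] [Algebra k A] (P : A →ₐ[k] k)

instance : CommRing (ComponentRing P) :=
  inferInstanceAs (CommRing
    (A ⧸ PrimeSpectrum.vanishingIdeal (connectedComponent (primeOfPoint P))))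

instance : Algebra k (ComponentRing P) :=
  inferInstanceAs (Algebra k
    (A ⧸ PrimeSpectrum.vanishingIdeal (connectedComponent (primeOfPoint P))))

/-- The closed immersion of the connected component, on coordinate rings. -/
def ComponentRing.mk : A →ₐ[k] ComponentRing P :=
  Ideal.Quotient.mkₐ k (PrimeSpectrum.vanishingIdeal (connectedComponent (primeOfPoint P)))

end ComponentRing

/-! ### Ramification groups -/

section Ramification

variable (OK K OL L : Type*) [CommRing OK] [Field K] [Algebra OK K] [IsFractionRing OK K]
  [IsDomain OK] [IsIntegrallyClosed OK]
  [Field L] [Algebra K L] [FiniteDimensional K L] [CommRing OL] [IsDomain OL] [IsLocalRing OL]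
  [Algebra OK OL] [Algebra OL L] [IsFractionRing OL L] [Algebra OK L] [IsScalarTower OK K L]
  [IsScalarTower OK OL L] [IsIntegralClosure OL OK L]

variable {K L} in
/-- The action of the Galois group on the ring of integers `O_L`. -/
def act (σ : Gal(L/K)) (x : OL) : OL := galRestrict OK K L OL σ x

/-- The lower numbering ramification group, the kernel of the action of `Gal(L/K)` on
`O_L / 𝔪_L ^ (i + 1)`. -/
def lowerGroup (i : ℕ) : Subgroup Gal(L/K) :=
  ((maximalIdeal OL ^ (i + 1)).toAddSubgroup.inertia (OL ≃ₐ[OK] OL)).comap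
    (galRestrict OK K L OL).toMonoidHom

lemma mem_lowerGroup (i : ℕ) (σ : Gal(L/K)) : σ ∈ lowerGroup OK K OL L i ↔
    ∀ x : OL, act OK OL σ x - x ∈ maximalIdeal OL ^ (i + 1) := Iff.rfl

/-- The Herbrand function `φ(u) = ∫_0^u dt / [G_0 : G_t]` for `u ≥ 0`, where `G_t = G_⌈t⌉`, written
out as the piecewise linear function
`(#G_1 + ⋯ + #G_m + (u - m) #G_{m + 1}) / #G_0` with `m = ⌊u⌋`. -/
def herbrand (u : ℚ) : ℚ :=
  (∑ j ∈ Finset.Icc 1 ⌊u⌋₊, (Nat.card (lowerGroup OK K OL L j) : ℚ) +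
    (u - ⌊u⌋₊) * Nat.card (lowerGroup OK K OL L (⌊u⌋₊ + 1))) / Nat.card (lowerGroup OK K OL L 0)

/-- The classical upper numbering ramification group for `v ≥ 0`: it is `G_u = G_⌈u⌉` for
the unique `u ≥ 0` with `φ(u) = v`. -/
def upperGroupCl (v : ℚ) : Subgroup Gal(L/K) :=
  ⨆ (u : ℚ) (_ : 0 ≤ u ∧ herbrand OK K OL L u = v), lowerGroup OK K OL L ⌈u⌉₊

/-- The upper numbering ramification group `G ^ r` for `r > 1`, with the shift by one
with respect to the classical numbering. -/
def upperGroup (r : ℚ) : Subgroup Gal(L/K) := upperGroupCl OK K OL L (r - 1)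

end Ramification

/-! ### The component of the normalized dilatation attached to a generator of `O_L` -/

section Component

variable (OK : Type*) {K OL L : Type*} [CommRing OK] [IsDomain OK] [IsIntegrallyClosed OK]
  [Field K] [Algebra OK K] [IsFractionRing OK K] [Field L] [Algebra K L] [FiniteDimensional K L]
  [CommRing OL] [IsDomain OL] [IsLocalRing OL] [IsIntegrallyClosed OL]
  [Algebra OK OL] [Algebra OL L] [IsFractionRing OL L] [Algebra OK L] [IsScalarTower OK K L]
  [IsScalarTower OK OL L] [IsIntegralClosure OL OK L]

/-- The minimal polynomial of `α` over `O_K`, with coefficients regarded as elements of `O_L`. -/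
abbrev minpolyOL (α : OL) : OL[X] := (minpoly OK α).map (algebraMap OK OL)

lemma eval_act (α : OL) (σ : Gal(L/K)) : (minpolyOL OK α).eval (act OK OL σ α) = 0 := by
  rw [eval_map_algebraMap]
  have : aeval (galRestrict OK K L OL σ α) (minpoly OK α) =
      galRestrict OK K L OL σ (aeval α (minpoly OK α)) :=
    aeval_algHom_apply (galRestrict OK K L OL σ).toAlgHom α (minpoly OK α)
  rw [act, this, minpoly.aeval, map_zero]

/-- The rational point of the reduced closed fiber of the normalized dilatation which is the
image of the closed point by the section lifting `X ↦ σ(α)`. -/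
def galoisPoint (α : OL) (m : ℕ) (σ : Gal(L/K)) :
    ReducedFiber OL (normalization L (minpolyOL OK α) α m) →ₐ[ResidueField OL]
      ResidueField OL :=
  ReducedFiber.point (rootSection α m (eval_act OK α σ))

variable (K L) in
/-- The coordinate ring of the connected component, containing the
image of the closed point by the section lifting `X ↦ α`, of the reduced closed
fiber of the normalized dilatation. -/
abbrev ComponentAt (α : OL) (m : ℕ) :=
  ComponentRing (galoisPoint OK α m (1 : Gal(L/K)))

variable (K L) in
/-- The inclusion of the connected component in the reduced closed fiber. -/
def toComponentAt (α : OL) (m : ℕ) :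
    ReducedFiber OL (normalization L (minpolyOL OK α) α m) →ₐ[ResidueField OL]
      ComponentAt OK K L α m :=
  ComponentRing.mk _

variable (K L) in
/-- The map from the connected component to the reduced closed fiber of the dilatation. -/
def componentProj (α : OL) (m : ℕ) :
    ReducedFiber OL (dilatation L (minpolyOL OK α) α m) →ₐ[ResidueField OL]
      ComponentAt OK K L α m :=
  (toComponentAt OK K L α m).comp (ReducedFiber.map (toNormalization L (minpolyOL OK α) α m))

variable (L) in
/-- For `z ∈ 𝔪_L ^ k`, the morphism from the reduced closed fiber of the dilatation, with
coordinate `S = f / α ^ m`, to the line `𝔪_L ^ k / 𝔪_L ^ (k + 1)` that sends the point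
`S = s` to `s z`. -/
def fiberToLine (α : OL) (m : ℕ) {k : ℕ} (z : ↥(maximalIdeal OL ^ k)) :
    Coord (ResidueField OL) (Gr (maximalIdeal OL) k) →ₐ[ResidueField OL]
      ReducedFiber OL (dilatation L (minpolyOL OK α) α m) :=
  vectorPoint (Gr.mk z) (ReducedFiber.mk (dilatationCoord L (minpolyOL OK α) α m))

end Component

/-! ### The additive polynomial -/

section AdditivePolynomial

variable {OL : Type*} [CommRing OL] [IsLocalRing OL]

open Classical in
/-- The residue class of the quotient `x / y` if `y` divides `x` (and `0` otherwise). -/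
def residueQuot (x y : OL) : ResidueField OL := if h : y ∣ x then residue OL h.choose else 0

open Classical in
/-- The polynomial `∏_{σ ∈ H} (X - β σ) / ∏_{σ ∈ H, σ ≠ 1} (-β σ)`. -/
def normalizedPoly {E G : Type*} [Field E] [Group G] [Fintype G] (H : Subgroup G) (β : G → E) :
    E[X] :=
  C (∏ σ : G with σ ∈ H ∧ σ ≠ 1, (-β σ))⁻¹ * ∏ σ : G with σ ∈ H, (X - C (β σ))

end AdditivePolynomial

/-! ### Intermediate extensions -/

section Intermediate

variable {OK K L : Type*} (OL : Type*) [CommRing OK] [Field K] [Algebra OK K]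
  [Field L] [Algebra K L] [CommRing OL] [IsLocalRing OL] [Algebra OK OL] [Algebra OL L]
  [Algebra OK L] [IsScalarTower OK K L] [IsScalarTower OK OL L]

variable (OK) in
/-- The valuation ring `O_M = O_L ∩ M` of an intermediate extension `M`. -/
def integers (M : IntermediateField K L) : Subalgebra OK OL :=
  (M.toSubalgebra.restrictScalars OK).comap (IsScalarTower.toAlgHom OK OL L)

variable (OK) in
/-- The maximal ideal `𝔪_M = 𝔪_L ∩ M` of `O_M`. -/
def integersIdeal (M : IntermediateField K L) : Ideal (integers OK OL M) :=
  (maximalIdeal OL).comap (algebraMap (integers OK OL M) OL)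

/-- `N` is the map `U_L ^ i / U_L ^ (i + 1) → U_M ^ i / U_M ^ (i + 1)` induced by the
norm of `L` over `M`. -/
def IsInducedByNorm (M : IntermediateField K L) (i : ℕ)
    (N : GrUnits (maximalIdeal OL) i →* GrUnits (integersIdeal OK OL M) i) : Prop :=
  ∀ x : ↥(higherUnits (maximalIdeal OL) i), ∃ y : ↥(higherUnits (integersIdeal OK OL M) i),
    algebraMap OL L ((y : (integers OK OL M)ˣ) : integers OK OL M) =
      algebraMap M L (Algebra.norm M (algebraMap OL L (x : OLˣ))) ∧
    N (GrUnits.mk x) = GrUnits.mk y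

/-- `T` is the map `𝔪_L ^ i / 𝔪_L ^ (i + 1) → 𝔪_M ^ i / 𝔪_M ^ (i + 1)` induced by the
trace of `L` over `M`. -/
def IsInducedByTrace (M : IntermediateField K L) (i : ℕ)
    (T : Gr (maximalIdeal OL) i ≃+ Gr (integersIdeal OK OL M) i) : Prop :=
  ∀ x : ↥(maximalIdeal OL ^ i), ∃ y : ↥(integersIdeal OK OL M ^ i),
    algebraMap OL L (y : integers OK OL M) =
      algebraMap M L (Algebra.trace M L (algebraMap OL L x)) ∧
    T (Gr.mk x) = Gr.mk y

/-- The morphism `ν` of schemes over the residue field `E` from the line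
`U_L ^ i / U_L ^ (i + 1) = 𝔪_L ^ i / 𝔪_L ^ (i + 1)` to itself is `T⁻¹ ∘ N`, where `N` is the
morphism of schemes to the line `U_M ^ i / U_M ^ (i + 1) = 𝔪_M ^ i / 𝔪_M ^ (i + 1)` given by
the norm after polynomial extensions of scalars: for every `y ∈ 𝔪_L ^ i`,
the norm of `1 + X y ∈ L[X]` to `M[X]` is of the form `1 + ∑ c_j X ^ j` with `c_j ∈ 𝔪_M ^ i`, and
`N` maps the point `X y` of the first line with values in `E[X]` to the
point `∑ c_j X ^ j` of the second. -/
def IsNormTraceMorphism (M : IntermediateField K L) (i : ℕ)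
    (T : Gr (maximalIdeal OL) i ≃+ Gr (integersIdeal OK OL M) i)
    (ν : Coord (ResidueField OL) (Gr (maximalIdeal OL) i) →ₐ[ResidueField OL]
      Coord (ResidueField OL) (Gr (maximalIdeal OL) i)) : Prop :=
  ∀ y : ↥(maximalIdeal OL ^ i), ∃ c : ℕ →₀ ↥(integersIdeal OK OL M ^ i),
    (∀ j, algebraMap OL L (c j : integers OK OL M) = algebraMap M L
      ((Algebra.norm M[X] (1 + X ⊗ₜ algebraMap OL L y : M[X] ⊗[M] L) - 1).coeff j)) ∧
    ∀ ℓ : Module.Dual (ResidueField OL) (Gr (maximalIdeal OL) i),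
      vectorPoint (Gr.mk y) X (ν (coord ℓ)) =
        c.sum fun j z => C (ℓ (T.symm (Gr.mk z))) * X ^ j

end Intermediate

end TotRam

end

/-!
Since the extension is totally ramified, `α` generates `O_L` over `O_K`. Hence `f = ∏ (X - σ α)`,
and `σ α - α` divides `σ x - x` for every `x` in `O_L`, so that the lower ramification groups are
read off from the orders of the elements `σ α - α` (`IsUniformizingGenerator`). Put
`δ = α_{n-1} - α_n`, an element of this form of the largest order, and let `H` be the group of those
`σ` for which `δ` divides `σ α - α` (`IsLastBreak`); it is the last nontrivial ramification group in
either numbering, because the Herbrand function is strictly increasing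
(`exists_lower_of_isGreatest_upper`). Counting the elements of the ramification groups gives
`e r = ord f'(α) + ord δ` (`associated_prod_sub_mul`). As the action is wild, `β(σ) = (σ α - α) / δ`
is additive on `H`. So `b₁` is the additive polynomial with simple zeros `β(H)` and linear term `X`,
which is the exactness of the bottom row (`additiveGroup_exact`). Everything else identifies the top
rows with it.

*The normalized dilatation.* For an element `x` of a valued field, `f(x) / α ^ (e r)` is integral
exactly when `x` is congruent modulo `δ` to some conjugate of `α`. Therefore a polynomial belongs to
the normalization of `O_L[X][f / α ^ (e r)]` exactly when, for all `τ`, it becomes integral after the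
substitution `X ↦ τ α + δ X` (`IsLastBreak.mem_normalization_iff`). The reductions of these
substitutions (`gaussRed`) are jointly injective on the reduced closed fiber, and those for `τ ∈ H`
agree up to a translation. The product of the factors `(X - σ α) / (α - σ α)` over `σ ∉ H` gives an
idempotent which separates the reductions for `τ ∈ H` from the others. So the
component of the point of `α` is a line, with coordinate `(X - α) / δ` (`exists_component_equiv`).
The congruence `f(α + δ X) ≡ f'(α) δ b₁(X)` (`IsLastBreak.exists_comp_eq`) shows that its map to the
closed fiber of the dilatation is `b₁`. Uniqueness of the group law holds because two morphisms from
a plane to the line which agree after composition with the étale homomorphism `b₁` differ by a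
constant element of its kernel (`comul_eq_transport`).

*Norms.* Over the fixed ring of `H` there is a single ramification jump `i`. Euler's formula for
`∑ P(x) / f'(x)` computes traces (`IsUniformizingGenerator.sum_smul_eq`), which gives the isomorphism
on graded pieces, and the divisibility of all coefficients of the norm of `1 + X y` by `𝔪_M ^ i`
(`HasSingleBreak.dvd_coeff_prod`). The polynomial that expresses `(T^i)⁻¹ ∘ N^i` in the coordinate
`δ / α` has degree at most `|H|` and linear term `X`. It vanishes on `β(H)` since
`1 + (σ α - α) / α = σ α / α` has norm `1`; hence it is `b₁` (`IsLastBreak.sum_coeff_eq`).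
-/

noncomputable section

namespace TotRam

/-! ### Additive polynomials attached to finite subgroups of a field -/

section AdditivePolynomials

variable {E G : Type*} [Field E] [Group G] [Fintype G] {H : Subgroup G} {β : G → E}

open Classical in
lemma normalizedPoly_eq (H : Subgroup G) (β : G → E) :
    normalizedPoly H β = C (∏ σ : G with σ ∈ H ∧ σ ≠ 1, (-β σ))⁻¹ *
      ∏ σ : G with σ ∈ H, (X - C (β σ)) := rfl

lemma map_one_of_additive (hadd : ∀ σ ∈ H, ∀ τ ∈ H, β (σ * τ) = β σ + β τ) : β 1 = 0 := by
  simpa using hadd 1 H.one_mem 1 H.one_mem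

open Classical in
lemma prod_neg_ne_zero (hinj : Set.InjOn β H)
    (hadd : ∀ σ ∈ H, ∀ τ ∈ H, β (σ * τ) = β σ + β τ) :
    ∏ σ : G with σ ∈ H ∧ σ ≠ 1, (-β σ) ≠ 0 := by
  refine Finset.prod_ne_zero_iff.2 fun σ hσ h => ?_
  simp only [Finset.mem_filter, Finset.mem_univ, true_and] at hσ
  refine hσ.2 (hinj hσ.1 H.one_mem ?_)
  rw [map_one_of_additive hadd, ← neg_eq_zero, h]

open Classical in
lemma natDegree_prod_X_sub (H : Subgroup G) (β : G → E) :
    (∏ σ : G with σ ∈ H, (X - C (β σ))).natDegree = Nat.card H := by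
  rw [natDegree_prod_of_monic _ _ fun _ _ => monic_X_sub_C _]
  simp only [natDegree_X_sub_C, Finset.sum_const, smul_eq_mul, mul_one]
  rw [Nat.card_eq_fintype_card, Fintype.card_subtype]

lemma natDegree_normalizedPoly (hinj : Set.InjOn β H)
    (hadd : ∀ σ ∈ H, ∀ τ ∈ H, β (σ * τ) = β σ + β τ) :
    (normalizedPoly H β).natDegree = Nat.card H := by
  classical
  rw [normalizedPoly_eq, natDegree_C_mul (inv_ne_zero (prod_neg_ne_zero hinj hadd)),
    natDegree_prod_X_sub]

lemma eval_normalizedPoly {σ : G} (hσ : σ ∈ H) : (normalizedPoly H β).eval (β σ) = 0 := by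
  classical
  have : ∏ τ : G with τ ∈ H, (X - C (β τ)).eval (β σ) = 0 :=
    Finset.prod_eq_zero (i := σ) (by simpa using hσ) (by simp)
  rw [normalizedPoly_eq, eval_mul, eval_prod, this, mul_zero]

lemma coeff_one_normalizedPoly (hinj : Set.InjOn β H)
    (hadd : ∀ σ ∈ H, ∀ τ ∈ H, β (σ * τ) = β σ + β τ) : (normalizedPoly H β).coeff 1 = 1 := by
  classical
  have hs : Finset.univ.filter (fun σ : G => σ ∈ H) =
      insert 1 (Finset.univ.filter fun σ : G => σ ∈ H ∧ σ ≠ 1) := by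
    ext σ
    by_cases h : σ = 1 <;> simp [h, H.one_mem]
  rw [normalizedPoly_eq, coeff_C_mul, hs, Finset.prod_insert (by simp), map_one_of_additive hadd,
    C_0, sub_zero, coeff_X_mul, coeff_zero_eq_eval_zero, eval_prod]
  simp only [eval_sub, eval_X, eval_C, zero_sub]
  exact inv_mul_cancel₀ (prod_neg_ne_zero hinj hadd)

open Classical in
/-- The product `∏ (X - β σ)` over a finite additive subgroup is invariant under translation by
that subgroup. -/
lemma prod_add_translate (hadd : ∀ σ ∈ H, ∀ τ ∈ H, β (σ * τ) = β σ + β τ) {A : Type*} [CommRing A]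
    [Algebra E A] (u : A) {τ : G} (hτ : τ ∈ H) :
    ∏ σ : G with σ ∈ H, (u + algebraMap E A (β τ) - algebraMap E A (β σ)) =
      ∏ σ : G with σ ∈ H, (u - algebraMap E A (β σ)) := by
  symm
  refine Finset.prod_bij (fun σ _ => τ * σ) ?_ ?_ ?_ ?_
  · intro σ hσ
    simp only [Finset.mem_filter, Finset.mem_univ, true_and] at hσ ⊢
    exact H.mul_mem hτ hσ
  · intro σ _ σ' _ h
    exact mul_left_cancel h
  · intro σ hσ
    simp only [Finset.mem_filter, Finset.mem_univ, true_and] at hσ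
    exact ⟨τ⁻¹ * σ, by simpa using H.mul_mem (H.inv_mem hτ) hσ, by simp⟩
  · intro σ hσ
    simp only [Finset.mem_filter, Finset.mem_univ, true_and] at hσ
    rw [hadd τ hτ σ hσ, map_add]
    ring

open Classical in
/-- As a polynomial in `Y` over the domain `E[X]`, the difference `P (X + Y) - P Y - P X` has degree
less than the order of `H` and vanishes at all `β σ`. -/
lemma prod_add (hinj : Set.InjOn β H)
    (hadd : ∀ σ ∈ H, ∀ τ ∈ H, β (σ * τ) = β σ + β τ) {A : Type*} [CommRing A] [Algebra E A]
    (u v : A) :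
    ∏ σ : G with σ ∈ H, (u + v - algebraMap E A (β σ)) =
      ∏ σ : G with σ ∈ H, (u - algebraMap E A (β σ)) +
        ∏ σ : G with σ ∈ H, (v - algebraMap E A (β σ)) := by
  set s := Finset.univ.filter (fun σ : G => σ ∈ H) with hs
  have hmem : ∀ σ ∈ s, σ ∈ H := fun σ hσ => by simpa [hs] using hσ
  have hcard : 0 < s.card := Finset.card_pos.2 ⟨1, by simp [hs, H.one_mem]⟩
  let P₁ : E[X][X] := ∏ σ ∈ s, (X - C (C (β σ) - X))
  let P₂ : E[X][X] := ∏ σ ∈ s, (X - C (C (β σ)))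
  let P₃ : E[X] := ∏ σ ∈ s, (X - C (β σ))
  have h₁ : P₁.Monic := monic_prod_of_monic _ _ fun _ _ => monic_X_sub_C _
  have h₂ : P₂.Monic := monic_prod_of_monic _ _ fun _ _ => monic_X_sub_C _
  have d₁ : P₁.natDegree = s.card := by
    rw [natDegree_prod_of_monic _ _ fun _ _ => monic_X_sub_C _]
    simp only [natDegree_X_sub_C, Finset.sum_const, smul_eq_mul, mul_one]
  have d₂ : P₂.natDegree = s.card := by
    rw [natDegree_prod_of_monic _ _ fun _ _ => monic_X_sub_C _]
    simp
  have hd : (P₁ - P₂ - C P₃).natDegree < s.card := by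
    suffices h : (P₁ - P₂ - C P₃).degree < s.card by
      rcases eq_or_ne (P₁ - P₂ - C P₃) 0 with h0 | h0
      · rwa [h0, natDegree_zero]
      · exact (natDegree_lt_iff_degree_lt h0).2 h
    refine (degree_sub_le _ _).trans_lt (max_lt ?_ ?_)
    · have := degree_sub_lt_left (p := P₁) (q := P₂)
        (by rw [degree_eq_natDegree h₁.ne_zero, degree_eq_natDegree h₂.ne_zero, d₁, d₂])
        h₁.ne_zero (by rw [h₁.leadingCoeff, h₂.leadingCoeff])
      rwa [degree_eq_natDegree h₁.ne_zero, d₁] at this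
    · exact degree_C_le.trans_lt (by exact_mod_cast hcard)
  have key : P₁ - P₂ - C P₃ = 0 := by
    refine eq_zero_of_natDegree_lt_card_of_eval_eq_zero' _
      (s.image fun σ => (C (β σ) : E[X])) ?_ ?_
    · intro x hx
      obtain ⟨τ, hτ, rfl⟩ := Finset.mem_image.1 hx
      have e₁ : P₁.eval (C (β τ)) = P₃ := by
        simp only [P₁, P₃, eval_prod, eval_sub, eval_X, eval_C]
        refine Eq.trans ?_ (prod_add_translate hadd (X : E[X]) (hmem τ hτ))
        exact Finset.prod_congr rfl fun σ _ => by simp only [algebraMap_eq]; ring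
      have e₂ : P₂.eval (C (β τ)) = 0 := by
        simp only [P₂, eval_prod, eval_sub, eval_X, eval_C]
        exact Finset.prod_eq_zero hτ (by simp)
      simp [e₁, e₂]
    · rwa [Finset.card_image_of_injOn]
      intro σ hσ τ hτ h
      exact hinj (hmem σ hσ) (hmem τ hτ) (C_injective h)
  have := congrArg (eval₂ (aeval u : E[X] →ₐ[E] A).toRingHom v) key
  simp only [P₁, P₂, P₃, eval₂_sub, eval₂_finsetProd, eval₂_X, eval₂_C, eval₂_zero,
    AlgHom.toRingHom_eq_coe, RingHom.coe_coe, map_sub, aeval_C, aeval_X, map_prod, sub_eq_zero]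
    at this
  rw [sub_eq_iff_eq_add] at this
  rw [← this]
  exact Finset.prod_congr rfl fun σ _ => by ring

lemma aeval_normalizedPoly_add (hinj : Set.InjOn β H)
    (hadd : ∀ σ ∈ H, ∀ τ ∈ H, β (σ * τ) = β σ + β τ) {A : Type*} [CommRing A] [Algebra E A]
    (u v : A) :
    aeval (u + v) (normalizedPoly H β) =
      aeval u (normalizedPoly H β) + aeval v (normalizedPoly H β) := by
  classical
  have := prod_add hinj hadd u v
  simp only [normalizedPoly_eq, map_mul, map_prod, map_sub, aeval_X, aeval_C, this, mul_add]

lemma exists_of_aeval_normalizedPoly_eq_zero (hinj : Set.InjOn β H)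
    (hadd : ∀ σ ∈ H, ∀ τ ∈ H, β (σ * τ) = β σ + β τ) {A : Type*} [CommRing A] [IsDomain A]
    [Algebra E A] {u : A} (hu : aeval u (normalizedPoly H β) = 0) :
    ∃ σ ∈ H, u = algebraMap E A (β σ) := by
  classical
  simp only [normalizedPoly_eq, map_mul, map_prod, map_sub, aeval_X, aeval_C, mul_eq_zero,
    map_eq_zero_iff _ (algebraMap E A).injective, Finset.prod_eq_zero_iff,
    inv_ne_zero (prod_neg_ne_zero hinj hadd), false_or] at hu
  obtain ⟨σ, hσ, h⟩ := hu
  exact ⟨σ, by simpa using hσ, sub_eq_zero.1 h⟩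

/-- A polynomial of degree at most the order of `H` that vanishes at all `β σ / c` and has linear
coefficient `c` is `b₁ (c X)`. -/
lemma eq_normalizedPoly_comp (hinj : Set.InjOn β H)
    (hadd : ∀ σ ∈ H, ∀ τ ∈ H, β (σ * τ) = β σ + β τ) {c : E} (hc : c ≠ 0) {P : E[X]}
    (hP : P.natDegree ≤ Nat.card H) (h1 : P.coeff 1 = c)
    (hroot : ∀ σ ∈ H, P.eval (c⁻¹ * β σ) = 0) :
    P = (normalizedPoly H β).comp (C c * X) := by
  classical
  set s := Finset.univ.filter (fun σ : G => σ ∈ H) with hs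
  have hmem : ∀ σ ∈ s, σ ∈ H := fun σ hσ => by simpa [hs] using hσ
  have hinj' : Set.InjOn (fun σ => c⁻¹ * β σ) s := fun σ hσ τ hτ h =>
    hinj (hmem σ hσ) (hmem τ hτ) (mul_left_cancel₀ (inv_ne_zero hc) h)
  have hscard : s.card = Nat.card H := by
    rw [Nat.card_eq_fintype_card, Fintype.card_subtype]
  have hDm : (∏ σ ∈ s, (X - C (c⁻¹ * β σ))).Monic :=
    monic_prod_of_monic _ _ fun _ _ => monic_X_sub_C _
  have hdvd : ∀ Q : E[X], (∀ σ ∈ H, Q.eval (c⁻¹ * β σ) = 0) → Q.natDegree ≤ Nat.card H →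
      ∃ κ : E, Q = C κ * ∏ σ ∈ s, (X - C (c⁻¹ * β σ)) := by
    intro Q hQ hQd
    have h : ∏ σ ∈ s, (X - C (c⁻¹ * β σ)) ∣ Q := by
      refine Finset.prod_dvd_of_coprime ?_ fun σ hσ => dvd_iff_isRoot.2 (hQ σ (hmem σ hσ))
      intro σ hσ τ hτ hne
      exact pairwise_coprime_X_sub_C (s := fun x : s => c⁻¹ * β x)
        (fun x y h => Subtype.ext (hinj' x.2 y.2 h)) (i := ⟨σ, hσ⟩) (j := ⟨τ, hτ⟩)
        (fun h => hne (congrArg Subtype.val h))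
    obtain ⟨R, hR⟩ := h
    rcases eq_or_ne R 0 with rfl | hR0
    · exact ⟨0, by simp [hR]⟩
    have : R.natDegree = 0 := by
      have hd := congrArg natDegree hR
      rw [hDm.natDegree_mul' hR0,
        natDegree_prod_of_monic _ _ fun _ _ => monic_X_sub_C _] at hd
      simp only [natDegree_X_sub_C, Finset.sum_const, smul_eq_mul, mul_one] at hd
      omega
    rw [natDegree_eq_zero] at this
    obtain ⟨κ, rfl⟩ := this
    exact ⟨κ, by rw [hR, mul_comm]⟩
  obtain ⟨κ, hκ⟩ := hdvd P hroot hP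
  obtain ⟨κ', hκ'⟩ := hdvd ((normalizedPoly H β).comp (C c * X)) (fun σ hσ => by
    rw [eval_comp, eval_mul, eval_C, eval_X, mul_inv_cancel_left₀ hc, eval_normalizedPoly hσ])
    (by rw [natDegree_comp, natDegree_C_mul_X _ hc, mul_one, natDegree_normalizedPoly hinj hadd])
  have h1' : ((normalizedPoly H β).comp (C c * X)).coeff 1 = c := by
    rw [comp_C_mul_X_coeff, coeff_one_normalizedPoly hinj hadd, one_mul, pow_one]
  rw [hκ, coeff_C_mul] at h1
  rw [hκ', coeff_C_mul] at h1'
  have hne : (∏ σ ∈ s, (X - C (c⁻¹ * β σ))).coeff 1 ≠ 0 := fun h => hc (by rw [← h1, h, mul_zero])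
  rw [hκ, hκ', mul_right_cancel₀ hne (h1.trans h1'.symm)]

end AdditivePolynomials

/-! ### Exact sequences of group schemes -/

section ExactSequences

variable {k : Type*} [Field k]

lemma faithfullyFlat_of_isIntegral {A B : Type*} [CommRing A] [IsDedekindDomain A]
    [CommRing B] [IsDomain B] {f : A →+* B} (hinj : Function.Injective f) (hint : f.IsIntegral) :
    f.FaithfullyFlat := by
  algebraize [f]
  have : FaithfulSMul A B := (faithfulSMul_iff_algebraMap_injective A B).2 hinj
  have : Module.IsTorsionFree A B := inferInstance
  change Module.FaithfullyFlat A B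
  infer_instance

lemma aeval_injective {b : k[X]} (hb : 0 < b.natDegree) :
    Function.Injective (aeval b : k[X] →ₐ[k] k[X]) :=
  transcendental_iff_injective.1 (Polynomial.transcendental b hb.ne'
    (mem_nonZeroDivisors_of_ne_zero (leadingCoeff_ne_zero.2 fun h => by simp [h] at hb)))

/-- A nonconstant polynomial map of the affine line is finite, since `X` is a root of `b(Y) - b(X)`,
and injective on functions, and a torsion free module over a Dedekind domain is flat. -/
lemma aeval_faithfullyFlat {b : k[X]} (hb : 0 < b.natDegree) :
    (aeval b : k[X] →ₐ[k] k[X]).toRingHom.FaithfullyFlat := by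
  refine faithfullyFlat_of_isIntegral (aeval_injective hb) ?_
  have hX : (aeval b : k[X] →ₐ[k] k[X]).toRingHom.IsIntegralElem X := by
    have hb0 : b.leadingCoeff ≠ 0 := leadingCoeff_ne_zero.2 fun h => by simp [h] at hb
    let Q : k[X][X] := C (C b.leadingCoeff⁻¹) * (b.map C - C X)
    refine ⟨Q, ?_, ?_⟩
    · have hd : (b.map (C : k →+* k[X])).degree = b.degree := degree_map_eq_of_injective C_injective _
      have hlt : (C X : k[X][X]).degree < (b.map (C : k →+* k[X])).degree := by
        rw [hd]
        exact degree_C_le.trans_lt (natDegree_pos_iff_degree_pos.1 hb)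
      rw [Monic, leadingCoeff_mul, leadingCoeff_C, leadingCoeff_sub_of_degree_lt hlt,
        leadingCoeff_map_of_injective C_injective, ← C_mul, inv_mul_cancel₀ hb0, C_1]
    · have : (aeval b : k[X] →ₐ[k] k[X]).toRingHom.comp C = C := by
        ext; simp
      simp only [Q, eval₂_mul, eval₂_sub, eval₂_C, eval₂_map, this, eval₂_C_X]
      simp
  intro P
  induction P using Polynomial.induction_on' with
  | add p q hp hq => exact hp.add _ hq
  | monomial n a =>
    rw [← C_mul_X_pow_eq_monomial]
    refine RingHom.IsIntegralElem.mul _ ?_ ?_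
    · have : (C a : k[X]) = (aeval b : k[X] →ₐ[k] k[X]).toRingHom (C a) := by simp
      rw [this]
      exact RingHom.isIntegralElem_map _
    · induction n with
      | zero =>
        rw [pow_zero]
        exact RingHom.isIntegralElem_one _
      | succ n ih =>
        rw [pow_succ]
        exact ih.mul _ hX

variable {G : Type*} [Group G] [Fintype G] {H : Subgroup G} {β : G → k}

lemma aeval_normalizedPoly_isHom (hinj : Set.InjOn β H)
    (hadd : ∀ σ ∈ H, ∀ τ ∈ H, β (σ * τ) = β σ + β τ) :
    (additiveGroup k).IsHom (additiveGroup k) (aeval (normalizedPoly H β)) := by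
  rw [GroupLaw.IsHom]
  ext
  simp only [additiveGroup, AlgHom.comp_apply, aeval_X, map_add,
    Algebra.TensorProduct.map_tmul, map_one, aeval_normalizedPoly_add hinj hadd]
  have h1 : (X ⊗ₜ[k] (1 : k[X])) = Algebra.TensorProduct.includeLeft (S := k) (X : k[X]) := rfl
  have h2 : ((1 : k[X]) ⊗ₜ[k] X) = Algebra.TensorProduct.includeRight (X : k[X]) := rfl
  rw [h1, h2, aeval_algHom_apply, aeval_algHom_apply]
  simp

/-- The additive polynomial with simple zeros `β(H)` is a faithfully flat homomorphism `𝐆ₐ → 𝐆ₐ`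
with kernel the constant group `H`; the closed immersion of `H` is Lagrange interpolation. -/
lemma additiveGroup_exact (hinj : Set.InjOn β H)
    (hadd : ∀ σ ∈ H, ∀ τ ∈ H, β (σ * τ) = β σ + β τ) :
    IsExactSequence (additiveGroup k) (additiveGroup k) (fun σ : H => aeval (β σ))
      (aeval (normalizedPoly H β)) where
  map_mul σ τ := by
    ext
    simp [GroupLaw.mulPt, additiveGroup, hadd σ σ.2 τ τ.2]
  isHom := aeval_normalizedPoly_isHom hinj hadd
  closedImmersion g := by
    classical
    have hinj' : Set.InjOn (fun σ : H => β σ) (Finset.univ : Finset H) := fun σ _ τ _ h =>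
      Subtype.ext (hinj σ.2 τ.2 h)
    refine ⟨Lagrange.interpolate Finset.univ (fun σ : H => β σ) g, funext fun σ => ?_⟩
    change aeval (β σ) _ = _
    rw [coe_aeval_eq_eval]
    exact Lagrange.eval_interpolate_at_node _ hinj' (Finset.mem_univ σ)
  kernel a := by
    classical
    have hker : RingHom.ker (additiveGroup k).counit = Ideal.span {X} := by
      ext p
      rw [Ideal.mem_span_singleton, X_dvd_iff, RingHom.mem_ker]
      change aeval 0 p = 0 ↔ _
      rw [coe_aeval_eq_eval, coeff_zero_eq_eval_zero]
    rw [hker, Ideal.map_span, Set.image_singleton, aeval_X, Ideal.mem_span_singleton]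
    constructor
    · intro h
      rw [normalizedPoly_eq, (associated_unit_mul_left _ _ (isUnit_C.2 (isUnit_iff_ne_zero.2
        (inv_ne_zero (prod_neg_ne_zero hinj hadd))))).dvd_iff_dvd_left]
      refine Finset.prod_dvd_of_coprime ?_ fun σ hσ => dvd_iff_isRoot.2 ?_
      · intro σ hσ τ hτ hne
        simp only [Finset.coe_filter, Finset.mem_univ, true_and, Set.mem_ofPred_eq] at hσ hτ
        exact pairwise_coprime_X_sub_C (s := fun x : H => β x)
          (fun x y h => Subtype.ext (hinj x.2 y.2 h)) (i := ⟨σ, hσ⟩) (j := ⟨τ, hτ⟩)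
          (fun h => hne (congrArg Subtype.val h))
      · have := h ⟨σ, by simpa using hσ⟩
        rwa [coe_aeval_eq_eval] at this
    · rintro ⟨c, rfl⟩ σ
      rw [coe_aeval_eq_eval, eval_mul, eval_normalizedPoly σ.2, zero_mul]
  faithfullyFlat := aeval_faithfullyFlat (by
    rw [natDegree_normalizedPoly hinj hadd]; exact Nat.card_pos)

variable {A A' B B' : Type*} [CommRing A] [Algebra k A] [CommRing A'] [Algebra k A'] [CommRing B]
  [Algebra k B] [CommRing B'] [Algebra k B']

/-- Transport of a group scheme structure along an isomorphism. -/
def GroupLaw.transport (GA : GroupLaw k A) (e : A' ≃ₐ[k] A) : GroupLaw k A' where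
  comul := (Algebra.TensorProduct.map e.symm.toAlgHom e.symm.toAlgHom).comp
    (GA.comul.comp e.toAlgHom)
  counit := GA.counit.comp e.toAlgHom
  antipode := e.symm.toAlgHom.comp (GA.antipode.comp e.toAlgHom)
  coassoc := by
    have h₁ : (Algebra.TensorProduct.map ((Algebra.TensorProduct.map e.symm.toAlgHom
        e.symm.toAlgHom).comp (GA.comul.comp e.toAlgHom)) (AlgHom.id k A')).comp
        (Algebra.TensorProduct.map e.symm.toAlgHom e.symm.toAlgHom) =
        (Algebra.TensorProduct.map (Algebra.TensorProduct.map e.symm.toAlgHom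
          e.symm.toAlgHom) e.symm.toAlgHom).comp
          (Algebra.TensorProduct.map GA.comul (AlgHom.id k A)) := by
      ext <;> simp
    have h₂ : (Algebra.TensorProduct.map (AlgHom.id k A') ((Algebra.TensorProduct.map
        e.symm.toAlgHom e.symm.toAlgHom).comp (GA.comul.comp e.toAlgHom))).comp
        (Algebra.TensorProduct.map e.symm.toAlgHom e.symm.toAlgHom) =
        (Algebra.TensorProduct.map e.symm.toAlgHom (Algebra.TensorProduct.map e.symm.toAlgHom
          e.symm.toAlgHom)).comp
          (Algebra.TensorProduct.map (AlgHom.id k A) GA.comul) := by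
      ext <;> simp
    have h₃ : (Algebra.TensorProduct.assoc k k k A' A' A').toAlgHom.comp
        (Algebra.TensorProduct.map (Algebra.TensorProduct.map e.symm.toAlgHom
          e.symm.toAlgHom) e.symm.toAlgHom) =
        (Algebra.TensorProduct.map e.symm.toAlgHom (Algebra.TensorProduct.map e.symm.toAlgHom
          e.symm.toAlgHom)).comp (Algebra.TensorProduct.assoc k k k A A A).toAlgHom := by
      ext <;> simp [Algebra.TensorProduct.one_def]
    rw [← AlgHom.comp_assoc (Algebra.TensorProduct.map _ (AlgHom.id k A')), h₁,
      ← AlgHom.comp_assoc (Algebra.TensorProduct.map (AlgHom.id k A') _), h₂, AlgHom.comp_assoc,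
      ← AlgHom.comp_assoc, h₃, AlgHom.comp_assoc, AlgHom.comp_assoc,
      ← AlgHom.comp_assoc _ GA.comul, ← AlgHom.comp_assoc _ GA.comul, ← GA.coassoc,
      AlgHom.comp_assoc, AlgHom.comp_assoc, AlgHom.comp_assoc]
  counit_left := by
    have h : (Algebra.TensorProduct.productMap
        ((Algebra.ofId k A').comp (GA.counit.comp e.toAlgHom)) (AlgHom.id k A')).comp
        (Algebra.TensorProduct.map e.symm.toAlgHom e.symm.toAlgHom) =
        e.symm.toAlgHom.comp (Algebra.TensorProduct.productMap
          ((Algebra.ofId k A).comp GA.counit) (AlgHom.id k A)) := by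
      ext <;> simp [Algebra.ofId_apply]
    rw [← AlgHom.comp_assoc, h, AlgHom.comp_assoc, ← AlgHom.comp_assoc _ GA.comul,
      GA.counit_left]
    ext; simp
  counit_right := by
    have h : (Algebra.TensorProduct.productMap (AlgHom.id k A')
        ((Algebra.ofId k A').comp (GA.counit.comp e.toAlgHom))).comp
        (Algebra.TensorProduct.map e.symm.toAlgHom e.symm.toAlgHom) =
        e.symm.toAlgHom.comp (Algebra.TensorProduct.productMap (AlgHom.id k A)
          ((Algebra.ofId k A).comp GA.counit)) := by
      ext <;> simp [Algebra.ofId_apply]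
    rw [← AlgHom.comp_assoc, h, AlgHom.comp_assoc, ← AlgHom.comp_assoc _ GA.comul,
      GA.counit_right]
    ext; simp
  antipode_left := by
    have h : (Algebra.TensorProduct.productMap
        (e.symm.toAlgHom.comp (GA.antipode.comp e.toAlgHom)) (AlgHom.id k A')).comp
        (Algebra.TensorProduct.map e.symm.toAlgHom e.symm.toAlgHom) =
        e.symm.toAlgHom.comp (Algebra.TensorProduct.productMap GA.antipode (AlgHom.id k A)) := by
      ext <;> simp
    rw [← AlgHom.comp_assoc, h, AlgHom.comp_assoc, ← AlgHom.comp_assoc _ GA.comul,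
      GA.antipode_left]
    ext; simp [Algebra.ofId_apply]
  antipode_right := by
    have h : (Algebra.TensorProduct.productMap (AlgHom.id k A')
        (e.symm.toAlgHom.comp (GA.antipode.comp e.toAlgHom))).comp
        (Algebra.TensorProduct.map e.symm.toAlgHom e.symm.toAlgHom) =
        e.symm.toAlgHom.comp (Algebra.TensorProduct.productMap (AlgHom.id k A) GA.antipode) := by
      ext <;> simp
    rw [← AlgHom.comp_assoc, h, AlgHom.comp_assoc, ← AlgHom.comp_assoc _ GA.comul,
      GA.antipode_right]
    ext; simp [Algebra.ofId_apply]

lemma GroupLaw.transport_isHom (GA : GroupLaw k A) (e : A' ≃ₐ[k] A) :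
    GA.IsHom (GA.transport e) e.toAlgHom := by
  rw [GroupLaw.IsHom, GroupLaw.transport, ← AlgHom.comp_assoc, ← Algebra.TensorProduct.map_comp]
  have : e.toAlgHom.comp e.symm.toAlgHom = AlgHom.id k A := by ext; simp
  rw [this, Algebra.TensorProduct.map_id, AlgHom.id_comp]

/-- An exact sequence stays exact when it is transported along isomorphisms. -/
lemma IsExactSequence.transport {Γ : Type*} [Group Γ] {GA : GroupLaw k A} {GB : GroupLaw k B}
    {ι : Γ → (A →ₐ[k] k)} {φ : B →ₐ[k] A} (h : IsExactSequence GA GB ι φ)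
    {GA' : GroupLaw k A'} {GB' : GroupLaw k B'} (e : A' ≃ₐ[k] A) (he : GA.IsHom GA' e.toAlgHom)
    (d : B' ≃ₐ[k] B) (hd : GB.IsHom GB' d.toAlgHom) (hdc : GB.counit.comp d.toAlgHom = GB'.counit)
    {ι' : Γ → (A' →ₐ[k] k)} {φ' : B' →ₐ[k] A'}
    (hι : ∀ γ, ι' γ = (ι γ).comp e.toAlgHom)
    (hφ : e.toAlgHom.comp φ' = φ.comp d.toAlgHom) : IsExactSequence GA' GB' ι' φ' where
  map_mul γ γ' := by
    have : (Algebra.TensorProduct.productMap (ι γ) (ι γ')).comp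
        (Algebra.TensorProduct.map e.toAlgHom e.toAlgHom) =
        Algebra.TensorProduct.productMap ((ι γ).comp e.toAlgHom) ((ι γ').comp e.toAlgHom) := by
      ext <;> simp
    rw [hι, hι, hι, h.map_mul, GroupLaw.mulPt, GroupLaw.mulPt, ← this, AlgHom.comp_assoc,
      AlgHom.comp_assoc, he]
  isHom := by
    have hinj : Function.Injective (Algebra.TensorProduct.map e.toAlgHom e.toAlgHom) :=
      (Algebra.TensorProduct.congr e e).injective
    rw [GroupLaw.IsHom, ← AlgHom.cancel_left hinj, ← AlgHom.comp_assoc,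
      ← Algebra.TensorProduct.map_comp, hφ, Algebra.TensorProduct.map_comp, AlgHom.comp_assoc, hd,
      ← AlgHom.comp_assoc, h.isHom, AlgHom.comp_assoc, ← hφ, ← AlgHom.comp_assoc,
      ← AlgHom.comp_assoc, he]
  closedImmersion g := by
    obtain ⟨a, rfl⟩ := h.closedImmersion g
    exact ⟨e.symm a, funext fun γ => by simp [hι]⟩
  kernel a := by
    have h₁ : (RingHom.ker GB'.counit).map d.toAlgHom = RingHom.ker GB.counit := by
      refine le_antisymm (Ideal.map_le_iff_le_comap.2 fun x hx => ?_) fun x hx => ?_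
      · rw [RingHom.mem_ker, ← hdc] at hx
        exact hx
      · have : x = d.toAlgHom (d.symm x) := by simp
        rw [this]
        refine Ideal.mem_map_of_mem _ ?_
        rw [RingHom.mem_ker, ← hdc]
        simpa using hx
    have h₂ : a ∈ (RingHom.ker GB'.counit).map φ' ↔
        e a ∈ ((RingHom.ker GB'.counit).map φ').map e.toAlgHom := by
      refine ⟨fun ha => Ideal.mem_map_of_mem e.toAlgHom ha, fun ha => ?_⟩
      have := (Ideal.mem_map_iff_of_surjective e.toAlgHom e.surjective).1 ha
      obtain ⟨x, hx, hxa⟩ := this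
      exact e.injective hxa ▸ hx
    have h₃ : ((RingHom.ker GB'.counit).map φ').map e.toAlgHom =
        (RingHom.ker GB.counit).map φ := by
      rw [← h₁]
      have := congrArg (fun ψ : B' →ₐ[k] A => (RingHom.ker GB'.counit).map ψ) hφ
      exact (Ideal.map_mapₐ _ _).trans (this.trans (Ideal.map_mapₐ _ _).symm)
    rw [h₂, h₃, ← h.kernel]
    simp [hι]
  faithfullyFlat := by
    have : φ'.toRingHom = (e.symm.toAlgHom.toRingHom.comp φ.toRingHom).comp d.toAlgHom.toRingHom := by
      ext x
      have := AlgHom.congr_fun hφ x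
      simp only [AlgHom.comp_apply] at this
      simp only [RingHom.comp_apply]
      exact e.injective (by simpa using this)
    rw [this]
    rw [RingHom.FaithfullyFlat.iff_flat_and_comap_surjective]
    have h₀ := RingHom.FaithfullyFlat.iff_flat_and_comap_surjective.1 h.faithfullyFlat
    have hd' := RingHom.FaithfullyFlat.iff_flat_and_comap_surjective.1
      (RingHom.FaithfullyFlat.of_bijective (f := d.toAlgHom.toRingHom) d.bijective)
    have he' := RingHom.FaithfullyFlat.iff_flat_and_comap_surjective.1
      (RingHom.FaithfullyFlat.of_bijective (f := e.symm.toAlgHom.toRingHom) e.symm.bijective)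
    refine ⟨hd'.1.comp (h₀.1.comp he'.1), ?_⟩
    rw [PrimeSpectrum.comap_comp, PrimeSpectrum.comap_comp]
    exact hd'.2.comp (h₀.2.comp he'.2)

/-- If `Spec A → 𝐆ₐ` corresponds to an additive polynomial under an isomorphism
of `Spec A` with `𝐆ₐ`, then two group scheme structures on `Spec A` with the same unit that make
it a homomorphism coincide: with `W` the image of the coordinate under the comultiplication, the
difference `W - X ⊗ 1 - 1 ⊗ X` is a root of the polynomial, hence one of the constants `β σ`, and
the counit shows that it is zero. -/
lemma comul_eq_transport (hinj : Set.InjOn β H)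
    (hadd : ∀ σ ∈ H, ∀ τ ∈ H, β (σ * τ) = β σ + β τ) (e : A ≃ₐ[k] k[X]) {GB : GroupLaw k B}
    (d : B ≃ₐ[k] k[X]) (hd : (additiveGroup k).IsHom GB d.toAlgHom) {φ : B →ₐ[k] A}
    (hφ : e.toAlgHom.comp φ = (aeval (normalizedPoly H β)).comp d.toAlgHom)
    (law : GroupLaw k A) (hc : law.counit = (aeval 0 : k[X] →ₐ[k] k).comp e.toAlgHom)
    (hlaw : law.IsHom GB φ) : law.comul = ((additiveGroup k).transport e).comul := by
  have : IsDomain (k[X] ⊗[k] k[X]) :=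
    (polyEquivTensor' k k[X]).symm.toMulEquiv.isDomain
  have hinj_e : Function.Injective (Algebra.TensorProduct.map e.toAlgHom e.toAlgHom) :=
    (Algebra.TensorProduct.congr e e).injective
  set W := Algebra.TensorProduct.map e.toAlgHom e.toAlgHom (law.comul (e.symm X)) with hW
  set W₀ : k[X] ⊗[k] k[X] := X ⊗ₜ[k] 1 + 1 ⊗ₜ[k] X with hW₀
  have hbW : aeval W (normalizedPoly H β) = aeval W₀ (normalizedPoly H β) := by
    have h₁ : e.symm (normalizedPoly H β) = φ (d.symm X) := by
      rw [AlgEquiv.symm_apply_eq]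
      simpa using (AlgHom.congr_fun hφ (d.symm X)).symm
    have h₂ : aeval W (normalizedPoly H β) =
        Algebra.TensorProduct.map e.toAlgHom e.toAlgHom
          (law.comul (e.symm (normalizedPoly H β))) := by
      rw [hW, aeval_algHom_apply, aeval_algHom_apply, ← AlgEquiv.coe_toAlgHom, aeval_algHom_apply,
        aeval_X_left_apply]
    have h₃ : aeval W₀ (normalizedPoly H β) = Algebra.TensorProduct.map
        (aeval (normalizedPoly H β)) (aeval (normalizedPoly H β)) W₀ := by
      have := AlgHom.congr_fun (aeval_normalizedPoly_isHom hinj hadd) X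
      simp only [additiveGroup, AlgHom.comp_apply, aeval_X] at this
      exact this.symm
    have h₄ := AlgHom.congr_fun hlaw (d.symm X)
    have h₅ := AlgHom.congr_fun hd (d.symm X)
    simp only [AlgHom.comp_apply] at h₄ h₅
    have h₆ : (additiveGroup k).comul (d.toAlgHom (d.symm X)) = W₀ := by
      simp [additiveGroup, hW₀]
    have h₇ : (Algebra.TensorProduct.map e.toAlgHom e.toAlgHom).comp
        (Algebra.TensorProduct.map φ φ) = (Algebra.TensorProduct.map
          (aeval (normalizedPoly H β)) (aeval (normalizedPoly H β))).comp
            (Algebra.TensorProduct.map d.toAlgHom d.toAlgHom) := by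
      rw [← Algebra.TensorProduct.map_comp, hφ, Algebra.TensorProduct.map_comp]
    rw [h₂, h₁, ← h₄, h₃, ← h₆, ← h₅]
    exact AlgHom.congr_fun h₇ _
  have hsub : aeval (W - W₀) (normalizedPoly H β) = 0 := by
    have h := aeval_normalizedPoly_add hinj hadd (W - W₀) W₀
    rw [sub_add_cancel, hbW] at h
    exact left_eq_add.1 (by rw [add_comm]; exact h)
  obtain ⟨σ, -, hσ⟩ := exists_of_aeval_normalizedPoly_eq_zero hinj hadd hsub
  let p : k[X] ⊗[k] k[X] →ₐ[k] k[X] := Algebra.TensorProduct.productMap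
    ((Algebra.ofId k k[X]).comp (aeval 0 : k[X] →ₐ[k] k)) (AlgHom.id k k[X])
  have hpW : p W = X := by
    have h₁ : p.comp (Algebra.TensorProduct.map e.toAlgHom e.toAlgHom) =
        e.toAlgHom.comp (Algebra.TensorProduct.productMap
          ((Algebra.ofId k A).comp law.counit) (AlgHom.id k A)) := by
      rw [hc]
      ext <;> simp [p, Algebra.ofId_apply]
    have h₂ := AlgHom.congr_fun h₁ (law.comul (e.symm X))
    have h₃ := AlgHom.congr_fun law.counit_left (e.symm X)
    simp only [AlgHom.comp_apply] at h₂ h₃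
    rw [hW, h₂, h₃]
    simp
  have hpW₀ : p W₀ = X := by simp [p, hW₀]
  have hβ : β σ = 0 := by
    have h := congrArg p hσ
    rw [map_sub, hpW, hpW₀, sub_self, AlgHom.commutes] at h
    exact (map_eq_zero_iff _ (algebraMap k k[X]).injective).1 h.symm
  rw [hβ, map_zero, sub_eq_zero] at hσ
  have key : ((Algebra.TensorProduct.map e.toAlgHom e.toAlgHom).comp law.comul).comp
      e.symm.toAlgHom = (additiveGroup k).comul := by
    ext
    simp only [additiveGroup, AlgHom.comp_apply, aeval_X]
    exact hσ
  rw [← AlgHom.cancel_left hinj_e]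
  change _ = (Algebra.TensorProduct.map e.toAlgHom e.toAlgHom).comp
    ((Algebra.TensorProduct.map e.symm.toAlgHom e.symm.toAlgHom).comp
      ((additiveGroup k).comul.comp e.toAlgHom))
  rw [← key]
  have h₁ : (Algebra.TensorProduct.map e.toAlgHom e.toAlgHom).comp
      (Algebra.TensorProduct.map e.symm.toAlgHom e.symm.toAlgHom) = AlgHom.id k _ := by
    ext <;> simp
  rw [← AlgHom.comp_assoc, h₁, AlgHom.id_comp, AlgHom.comp_assoc]
  ext
  simp

end ExactSequences

section Lines

variable {k V : Type*} [Field k] [AddCommGroup V] [Module k V]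

lemma additiveGroup_counit_comp_vectorPoint (v : V) :
    (additiveGroup k).counit.comp (vectorPoint v (X : k[X])) = (vectorGroup k V).counit := by
  ext ℓ
  simp [vectorPoint, vectorGroup, additiveGroup]

lemma vectorPoint_coord {A : Type*} [CommRing A] [Algebra k A] (v : V) (s : A)
    (ℓ : Module.Dual k V) : vectorPoint v s (coord ℓ) = ℓ v • s := by
  simp [vectorPoint]

lemma vectorPoint_bijective {v : V} (hv : v ≠ 0) (hspan : ∀ w : V, ∃ c : k, w = c • v) :
    Function.Bijective (vectorPoint (k := k) v (X : k[X])) := by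
  obtain ⟨ℓ, hℓ⟩ := Module.Projective.exists_dual_eq_one k hv
  let g : k[X] →ₐ[k] Coord k V := aeval (coord ℓ)
  refine Function.bijective_iff_has_inverse.2 ⟨g, fun x => ?_, fun x => ?_⟩
  · have : g.comp (vectorPoint v X) = AlgHom.id k _ := by
      ext m
      have hm : m = m v • ℓ := by
        ext w
        obtain ⟨c, rfl⟩ := hspan w
        simp [hℓ, mul_comm]
      conv_rhs => rw [hm]
      simp [g, vectorPoint]
    exact AlgHom.congr_fun this x
  · have : (vectorPoint v (X : k[X])).comp g = AlgHom.id k _ := by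
      ext
      simp [g, vectorPoint, hℓ]
    exact AlgHom.congr_fun this x

end Lines

/-! ### Discrete valuation rings generated by a uniformizer over a fixed ring -/

section Action

variable {D G : Type*} [CommRing D] [IsDomain D] [IsDiscreteValuationRing D] [Group G]
  [MulSemiringAction G D] {α : D}

/-- The uniformizer `α` generates the discrete valuation ring `D` over the subring fixed by `G`,
and `G` acts faithfully. -/
structure IsUniformizingGenerator (G : Type*) {D : Type*} [CommRing D] [Group G]
    [MulSemiringAction G D] (α : D) : Prop where
  irreducible : Irreducible α
  exists_eval : ∀ x : D, ∃ P : D[X], (∀ (σ : G) (j : ℕ), σ • P.coeff j = P.coeff j) ∧ P.eval α = x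
  eq_one : ∀ σ : G, σ • α = α → σ = 1

lemma IsUniformizingGenerator.subgroup (hα : IsUniformizingGenerator G α) (H : Subgroup G) :
    IsUniformizingGenerator H α where
  irreducible := hα.irreducible
  exists_eval x := by
    obtain ⟨P, hP, hx⟩ := hα.exists_eval x
    exact ⟨P, fun σ j => hP σ j, hx⟩
  eq_one σ h := Subtype.ext (hα.eq_one σ h)

lemma smul_eval_of_fixed {P : D[X]} {σ : G} (hP : ∀ j : ℕ, σ • P.coeff j = P.coeff j) (x : D) :
    σ • P.eval x = P.eval (σ • x) := by
  have h := Polynomial.hom_eval₂ P (RingHom.id D) (MulSemiringAction.toRingHom G D σ) x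
  have hmap : P.map (MulSemiringAction.toRingHom G D σ) = P := by
    ext j
    rw [coeff_map]
    exact hP j
  rw [RingHom.comp_id, ← eval_map (MulSemiringAction.toRingHom G D σ), hmap] at h
  exact h

lemma irreducible_smul (hα : Irreducible α) (σ : G) : Irreducible (σ • α) :=
  (MulEquiv.irreducible_iff (MulSemiringAction.toRingEquiv G D σ)).2 hα

lemma associated_smul (hα : Irreducible α) (σ : G) (x : D) : Associated (σ • x) x := by
  rcases eq_or_ne x 0 with rfl | hx
  · simp
  obtain ⟨n, u, rfl⟩ := IsDiscreteValuationRing.eq_unit_mul_pow_irreducible hx hα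
  have h₁ : Associated (σ • α) α :=
    IsDiscreteValuationRing.associated_of_irreducible D (irreducible_smul hα σ) hα
  have h₂ : IsUnit (σ • (u : D)) := u.isUnit.map (MulSemiringAction.toRingHom G D σ)
  rw [smul_mul', smul_pow']
  exact ((associated_one_iff_isUnit.2 h₂).trans (associated_one_iff_isUnit.2 u.isUnit).symm).mul_mul (h₁.pow_pow)

lemma dvd_smul_iff (hα : Irreducible α) (σ : G) {x y : D} : y ∣ σ • x ↔ y ∣ x :=
  (associated_smul hα σ x).dvd_iff_dvd_right

lemma IsUniformizingGenerator.sub_dvd (hα : IsUniformizingGenerator G α) (σ τ : G) (x : D) :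
    σ • α - τ • α ∣ σ • x - τ • x := by
  obtain ⟨P, hP, rfl⟩ := hα.exists_eval x
  rw [smul_eval_of_fixed (hP σ), smul_eval_of_fixed (hP τ)]
  exact sub_dvd_eval_sub _ _ _

lemma IsUniformizingGenerator.sub_dvd' (hα : IsUniformizingGenerator G α) (σ : G) (x : D) :
    σ • α - α ∣ σ • x - x := by
  simpa using hα.sub_dvd σ 1 x

lemma IsUniformizingGenerator.smul_injective (hα : IsUniformizingGenerator G α) :
    Function.Injective fun σ : G => σ • α := fun σ τ h => by
  have := hα.eq_one (τ⁻¹ * σ) (by rw [mul_smul, inv_smul_eq_iff]; exact h)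
  exact (inv_mul_eq_one.1 this).symm

/-- The residue field of the fixed ring is the whole residue field. -/
lemma IsUniformizingGenerator.exists_fixed (hα : IsUniformizingGenerator G α) (x : D) :
    ∃ c : D, (∀ σ : G, σ • c = c) ∧ α ∣ x - c := by
  obtain ⟨P, hP, rfl⟩ := hα.exists_eval x
  refine ⟨P.coeff 0, fun σ => hP σ 0, ?_⟩
  have := sub_dvd_eval_sub α 0 P
  rwa [sub_zero, ← coeff_zero_eq_eval_zero] at this

lemma IsUniformizingGenerator.dvd_iff (hα : IsUniformizingGenerator G α) {x : D} :
    α ∣ x ↔ x ∈ maximalIdeal D := by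
  rw [hα.irreducible.maximalIdeal_eq, Ideal.mem_span_singleton]

lemma IsUniformizingGenerator.mem_pow_iff (hα : IsUniformizingGenerator G α) {x : D} {j : ℕ} :
    x ∈ maximalIdeal D ^ j ↔ α ^ j ∣ x := by
  rw [hα.irreducible.maximalIdeal_eq, Ideal.span_singleton_pow, Ideal.mem_span_singleton]

/-! ### Traces -/

section Trace

variable [Fintype G]

/-- Euler's formula `∑ P(x) / f'(x) = coefficient of X ^ (n - 1) in P`, with the sum over the roots
`x = σ α` of `f = ∏ (X - σ α)`, cleared of denominators. -/
lemma IsUniformizingGenerator.sum_smul_eq [DecidableEq G] (hα : IsUniformizingGenerator G α)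
    {P : D[X]} (hP : P.degree < Fintype.card G) {x w z : D} (hz : ∀ σ : G, σ • z = P.eval (σ • α))
    (hw : ∀ σ : G, σ • w = w)
    (hx : x * ∏ τ ∈ Finset.univ.erase (1 : G), (α - τ • α) = w * z) :
    ∑ σ : G, σ • x = w * P.coeff (Fintype.card G - 1) := by
  let L := FractionRing D
  have hinjL : Function.Injective (algebraMap D L) := IsFractionRing.injective D L
  have hinj : Set.InjOn (fun σ : G => algebraMap D L (σ • α)) (Finset.univ : Finset G) :=
    fun σ _ τ _ h => hα.smul_injective (hinjL h)
  have hP' : (P.map (algebraMap D L)).degree < (Finset.univ : Finset G).card := by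
    rw [degree_map_eq_of_injective hinjL]
    exact hP
  have key := Lagrange.coeff_eq_sum hinj hP'
  rw [coeff_map, Finset.card_univ] at key
  apply hinjL
  rw [map_mul, key, map_sum, Finset.mul_sum]
  refine Finset.sum_congr rfl fun σ _ => ?_
  have hd : ∏ τ ∈ Finset.univ.erase σ, (algebraMap D L (σ • α) - algebraMap D L (τ • α)) =
      algebraMap D L (σ • ∏ τ ∈ Finset.univ.erase (1 : G), (α - τ • α)) := by
    rw [Finset.smul_prod', map_prod]
    symm
    refine Finset.prod_bij (fun τ _ => σ * τ) (fun τ hτ => ?_) (fun τ _ τ' _ h => mul_left_cancel h)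
      (fun τ hτ => ⟨σ⁻¹ * τ, ?_, by simp⟩) (fun τ _ => by rw [smul_sub, map_sub, mul_smul])
    · simpa using hτ
    · simpa [inv_mul_eq_one, eq_comm] using hτ
  have hd0 : algebraMap D L (σ • ∏ τ ∈ Finset.univ.erase (1 : G), (α - τ • α)) ≠ 0 := by
    rw [← hd, Finset.prod_ne_zero_iff]
    intro τ hτ h
    exact (Finset.ne_of_mem_erase hτ) (hα.smul_injective (hinjL (sub_eq_zero.1 h))).symm
  rw [hd, eval_map_algebraMap, aeval_algebraMap_apply, coe_aeval_eq_eval, ← hz,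
    mul_div_assoc', eq_div_iff hd0, ← map_mul, ← map_mul, ← smul_mul', hx, smul_mul', hw]

/-- The trace of `w z / f'(α)` is a multiple of the fixed element `w`. -/
lemma IsUniformizingGenerator.dvd_sum_smul [DecidableEq G] (hα : IsUniformizingGenerator G α)
    {x w z : D} (hw : ∀ σ : G, σ • w = w)
    (hx : x * ∏ τ ∈ Finset.univ.erase (1 : G), (α - τ • α) = w * z) :
    w ∣ ∑ σ : G, σ • x := by
  obtain ⟨P, hP, hPz⟩ := hα.exists_eval z
  let g : D[X] := ∏ σ : G, (X - C (σ • α))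
  have hg : g.Monic := monic_prod_of_monic _ _ fun _ _ => monic_X_sub_C _
  have hgd : g.degree = Fintype.card G := by
    rw [degree_eq_natDegree hg.ne_zero, natDegree_prod_of_monic _ _ fun _ _ => monic_X_sub_C _]
    simp
  refine ⟨_, hα.sum_smul_eq (P := P %ₘ g) ?_ ?_ hw hx⟩
  · rw [← hgd]
    exact degree_modByMonic_lt _ hg
  · intro σ
    have h0 : g.eval (σ • α) = 0 := by
      simp only [g, eval_prod]
      exact Finset.prod_eq_zero (Finset.mem_univ σ) (by simp)
    rw [← hPz, smul_eval_of_fixed (hP σ)]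
    conv_lhs => rw [← modByMonic_add_div P g]
    rw [eval_add, eval_mul, h0, zero_mul, add_zero]

/-- The trace of `α ^ (n - 1) / f'(α)` is `1`. -/
lemma IsUniformizingGenerator.sum_smul_of_mul_eq [DecidableEq G]
    (hα : IsUniformizingGenerator G α) {x w : D} (hw : ∀ σ : G, σ • w = w)
    (hx : x * ∏ τ ∈ Finset.univ.erase (1 : G), (α - τ • α) = w * α ^ (Fintype.card G - 1)) :
    ∑ σ : G, σ • x = w := by
  rw [hα.sum_smul_eq (P := X ^ (Fintype.card G - 1)) ?_ ?_ hw hx, coeff_X_pow_self, mul_one]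
  · rw [degree_X_pow]
    exact_mod_cast Nat.sub_lt Fintype.card_pos one_pos
  · intro σ
    rw [smul_pow', eval_pow, eval_X]

variable (G) in
lemma smul_prod_smul (x : D) (σ : G) : σ • ∏ τ : G, τ • x = ∏ τ : G, τ • x := by
  rw [Finset.smul_prod']
  simp only [← mul_smul]
  exact Fintype.prod_equiv (Equiv.mulLeft σ) _ _ fun _ => rfl

variable (G) in
lemma associated_prod_smul (hα : Irreducible α) :
    Associated (∏ τ : G, τ • α) (α ^ Fintype.card G) := by
  rw [← Finset.card_univ, ← Finset.prod_const]
  exact Associated.prod _ _ _ fun τ _ => associated_smul hα τ α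

/-- The action of `G` has a single ramification jump, at `i`. -/
def HasSingleBreak (G : Type*) {D : Type*} [CommRing D] [Group G] [MulSemiringAction G D] (α : D)
    (i : ℕ) : Prop :=
  ∀ σ : G, σ ≠ 1 → Associated (σ • α - α) (α ^ (i + 1))

lemma HasSingleBreak.subgroup {i : ℕ} (h : HasSingleBreak G α i) (H : Subgroup G) :
    HasSingleBreak H α i := fun σ hσ => h σ fun h' => hσ (Subtype.ext h')

lemma HasSingleBreak.associated_prod [DecidableEq G] {i : ℕ} (h : HasSingleBreak G α i) :
    Associated (∏ τ ∈ Finset.univ.erase (1 : G), (α - τ • α))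
      (α ^ ((Fintype.card G - 1) * (i + 1))) := by
  rw [mul_comm, pow_mul, ← Finset.card_univ, ← Finset.card_erase_of_mem (Finset.mem_univ (1 : G)),
    ← Finset.prod_const]
  refine Associated.prod _ _ _ fun τ hτ => ?_
  rw [← neg_sub]
  exact (h τ (Finset.ne_of_mem_erase hτ)).neg_left

/-- The elements of order at least `s ≤ i + 1` have a trace of order at least `s` in
the fixed field. -/
lemma HasSingleBreak.dvd_sum_smul {i : ℕ} (h : HasSingleBreak G α i)
    (hα : IsUniformizingGenerator G α) {s : ℕ} (hs : s ≤ i + 1) {x : D} (hx : α ^ s ∣ x) :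
    α ^ (Fintype.card G * s) ∣ ∑ σ : G, σ • x := by
  classical
  have hN := associated_prod_smul G hα.irreducible
  have hd : (∏ τ : G, τ • α) ^ s ∣ x * ∏ τ ∈ Finset.univ.erase (1 : G), (α - τ • α) := by
    rw [(hN.pow_pow).dvd_iff_dvd_left, (h.associated_prod.mul_left x).dvd_iff_dvd_right, ← pow_mul]
    refine dvd_trans (pow_dvd_pow α ?_) (pow_add α s _ ▸ mul_dvd_mul_right hx _)
    obtain ⟨c, hc⟩ : ∃ c, Fintype.card G = c + 1 :=
      ⟨_, (Nat.succ_pred_eq_of_pos Fintype.card_pos).symm⟩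
    rw [hc, Nat.add_sub_cancel]
    nlinarith [Nat.mul_le_mul_left c hs]
  obtain ⟨z, hz⟩ := hd
  have := hα.dvd_sum_smul (fun σ => by rw [smul_pow', smul_prod_smul]) hz
  rwa [(hN.pow_pow).dvd_iff_dvd_left, ← pow_mul] at this

/-- For `s ≥ i`, every element of order at least `s` of the fixed field is the trace of an element
of order at least `s`. -/
lemma HasSingleBreak.exists_sum_smul_eq {i : ℕ} (h : HasSingleBreak G α i)
    (hα : IsUniformizingGenerator G α) {s : ℕ} (hs : i ≤ s) {w : D} (hw : ∀ σ : G, σ • w = w)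
    (hdvd : α ^ (Fintype.card G * s) ∣ w) : ∃ x, α ^ s ∣ x ∧ ∑ σ : G, σ • x = w := by
  classical
  have hd : α ^ s * ∏ τ ∈ Finset.univ.erase (1 : G), (α - τ • α) ∣
      w * α ^ (Fintype.card G - 1) := by
    rw [(h.associated_prod.mul_left _).dvd_iff_dvd_left, ← pow_add]
    refine dvd_trans (pow_dvd_pow α ?_) (pow_add α _ _ ▸ mul_dvd_mul_right hdvd _)
    obtain ⟨c, hc⟩ : ∃ c, Fintype.card G = c + 1 :=
      ⟨_, (Nat.succ_pred_eq_of_pos Fintype.card_pos).symm⟩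
    rw [hc, Nat.add_sub_cancel]
    nlinarith [Nat.mul_le_mul_left c hs]
  obtain ⟨z, hz⟩ := hd
  refine ⟨α ^ s * z, dvd_mul_right _ _, hα.sum_smul_of_mul_eq hw ?_⟩
  rw [hz]
  ring

/-- The order of a fixed element is a multiple of the order of the group: the extension is totally
ramified over the fixed field. -/
lemma HasSingleBreak.fixed_dvd {i : ℕ} (h : HasSingleBreak G α i)
    (hα : IsUniformizingGenerator G α) {k : ℕ} {w : D} (hw : ∀ σ : G, σ • w = w)
    (hdvd : α ^ (Fintype.card G * k + 1) ∣ w) : α ^ (Fintype.card G * (k + 1)) ∣ w := by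
  classical
  have hN := associated_prod_smul G hα.irreducible
  set N := ∏ τ : G, τ • α with hNdef
  have hNf : ∀ (t : ℕ) (σ : G), σ • N ^ t = N ^ t := fun t σ => by rw [smul_pow', smul_prod_smul]
  have hN0 : N ≠ 0 := hN.ne_zero_iff.2 (pow_ne_zero _ hα.irreducible.ne_zero)
  obtain ⟨c, hc⟩ : ∃ c, Fintype.card G = c + 1 :=
    ⟨_, (Nat.succ_pred_eq_of_pos Fintype.card_pos).symm⟩
  have h₁ : ∏ τ ∈ Finset.univ.erase (1 : G), (α - τ • α) ∣ N ^ (i + 1) := by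
    rw [h.associated_prod.dvd_iff_dvd_left, (hN.pow_pow).dvd_iff_dvd_right, ← pow_mul]
    exact pow_dvd_pow _ (Nat.mul_le_mul_right _ (Nat.sub_le _ _))
  obtain ⟨y, hy⟩ := h₁
  have h₂ : N ^ (k + 1) ∣ w * α ^ (Fintype.card G - 1) := by
    rw [(hN.pow_pow).dvd_iff_dvd_left, ← pow_mul]
    have h₃ := mul_dvd_mul_right hdvd (α ^ (Fintype.card G - 1))
    rw [← pow_add] at h₃
    refine dvd_trans (pow_dvd_pow α ?_) h₃
    rw [hc, Nat.add_sub_cancel]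
    nlinarith
  obtain ⟨z, hz⟩ := h₂
  have e₁ := hα.sum_smul_of_mul_eq (x := y * w * α ^ (Fintype.card G - 1))
    (w := N ^ (i + 1) * w) (fun σ => by rw [smul_mul', hNf, hw]) (by rw [hy]; ring)
  have e₂ := hα.dvd_sum_smul (x := y * w * α ^ (Fintype.card G - 1))
    (w := N ^ (i + 1) * N ^ (k + 1)) (z := z) (fun σ => by rw [smul_mul', hNf, hNf]) (by
      rw [mul_assoc y, hz, hy]; ring)
  -- The trace of `w α ^ (n - 1) N ^ (i + 1) / f'(α)`, computed in two ways.
  rw [e₁] at e₂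
  have := (mul_dvd_mul_iff_left (pow_ne_zero _ hN0)).1 e₂
  rwa [(hN.pow_pow).dvd_iff_dvd_left, ← pow_mul] at this

end Trace

end Action

/-! ### Norms of one-units -/

section Norm

variable {D G : Type*} [CommRing D] [IsDomain D] [IsDiscreteValuationRing D] [Group G]
  [MulSemiringAction G D] {α : D} [Fintype G]

/-- The sum of an equivariant function over a finite `G`-set is a trace from the top
if the value at every point is a trace for the stabilizer of that point. -/
lemma exists_sum_smul_eq_sum {Ω : Type*} [Fintype Ω] [MulAction G Ω]
    [∀ ω : Ω, Fintype (MulAction.stabilizer G ω)] {φ : Ω → D}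
    (hφ : ∀ (σ : G) ω, φ (σ • ω) = σ • φ ω) {c : D}
    (h : ∀ ω : Ω, ∃ x, c ∣ x ∧ ∑ σ : MulAction.stabilizer G ω, σ • x = φ ω) :
    ∃ x, c ∣ x ∧ ∑ σ : G, σ • x = ∑ ω, φ ω := by
  classical
  choose x hcx hx using h
  let r : MulAction.orbitRel.Quotient G Ω → Ω := Quotient.out
  refine ⟨∑ q, x (r q), Finset.dvd_sum fun q _ => hcx _, ?_⟩
  have key : ∀ q, ∑ σ : G, σ • x (r q) = ∑ ω with (⟦ω⟧ : MulAction.orbitRel.Quotient G Ω) = q, φ ω := by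
    intro q
    rw [← Finset.sum_fiberwise_of_maps_to (s := Finset.univ) (t := {ω | ⟦ω⟧ = q})
      (g := fun σ : G => σ • r q)]
    · refine Finset.sum_congr rfl fun ω hω => ?_
      have hω' : (⟦ω⟧ : MulAction.orbitRel.Quotient G Ω) = ⟦r q⟧ := by
        rw [Quotient.out_eq]
        simpa using hω
      obtain ⟨τ, hτ⟩ := Quotient.exact hω'
      simp only at hτ
      rw [← hτ, hφ, ← hx, Finset.smul_sum]
      symm
      refine Finset.sum_bij (fun ρ _ => τ * (ρ : G)) (fun ρ _ => ?_)
        (fun ρ _ ρ' _ hρ => Subtype.ext (mul_left_cancel hρ)) (fun σ hσ => ?_) fun ρ _ => ?_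
      · have : (ρ : G) • r q = r q := ρ.2
        simp [mul_smul, this]
      · have hσ' : σ • r q = τ • r q := by simpa using hσ
        exact ⟨⟨τ⁻¹ * σ, by rw [MulAction.mem_stabilizer_iff, mul_smul, hσ', inv_smul_smul]⟩,
          Finset.mem_univ _, by simp⟩
      · rw [mul_smul]; rfl
    · intro σ _
      have : (⟦σ • r q⟧ : MulAction.orbitRel.Quotient G Ω) = ⟦r q⟧ :=
        Quotient.sound ⟨σ, rfl⟩
      simp only [Finset.mem_filter, Finset.mem_univ, true_and, this]
      exact Quotient.out_eq q
  simp only [Finset.smul_sum]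
  rw [Finset.sum_comm]
  simp only [key]
  exact Finset.sum_fiberwise _ _ _

lemma coeff_prod_one_add (y : D) (j : ℕ) [DecidableEq G] :
    (∏ σ : G, (1 + X * C (σ • y))).coeff j =
      ∑ S : Finset G, if S.card = j then ∏ σ ∈ S, σ • y else 0 := by
  rw [Finset.prod_one_add, finsetSum_coeff, Finset.powerset_univ]
  refine Finset.sum_congr rfl fun S _ => ?_
  rw [Finset.prod_mul_distrib, Finset.prod_const, ← map_prod, coeff_X_pow_mul', coeff_C]
  split_ifs with h₁ h₂ h₃ h₃
  all_goals first | rfl | omega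

open Pointwise in
/-- The positive degree coefficients of the norm of `1 + X y` are divisible by `𝔪 ^ s` in the fixed
field if `y` has order at least `s`, for `s = i` and `s = i + 1`. The coefficient is the sum of the
products `∏ σ y` over subsets `S` of `G`; such a product is a norm for the stabilizer of `S`,
hence a trace for it. -/
lemma HasSingleBreak.dvd_coeff_prod {i : ℕ} (h : HasSingleBreak G α i)
    (hα : IsUniformizingGenerator G α) {s : ℕ} (hi : i ≤ s) (hs : s ≤ i + 1) {y : D}
    (hy : α ^ s ∣ y) {j : ℕ} (hj : j ≠ 0) :
    α ^ (Fintype.card G * s) ∣ (∏ σ : G, (1 + X * C (σ • y))).coeff j := by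
  classical
  rw [coeff_prod_one_add]
  suffices ∃ x, α ^ s ∣ x ∧ ∑ σ : G, σ • x =
      ∑ S : Finset G, if S.card = j then ∏ σ ∈ S, σ • y else 0 by
    obtain ⟨x, hx, hxS⟩ := this
    rw [← hxS]
    exact h.dvd_sum_smul hα hs hx
  have hsm : ∀ (σ : G) (S : Finset G), ∏ τ ∈ σ • S, τ • y = σ • ∏ τ ∈ S, τ • y := by
    intro σ S
    rw [Finset.smul_prod', Finset.smul_finset_def, Finset.prod_image fun _ _ _ _ h => by simpa using h]
    exact Finset.prod_congr rfl fun τ _ => mul_smul σ τ y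
  refine exists_sum_smul_eq_sum (φ := fun S : Finset G => if S.card = j then ∏ σ ∈ S, σ • y else 0)
    (fun σ S => ?_) fun S => ?_
  · simp only [Finset.card_smul_finset, hsm]
    split_ifs <;> simp
  · by_cases hS : S.card = j
    · rw [if_pos hS]
      refine (h.subgroup _).exists_sum_smul_eq (hα.subgroup _) hi (fun σ => ?_) ?_
      · have hσ : (σ : G) • S = S := σ.2
        rw [Subgroup.smul_def, ← hsm, hσ]
      · obtain ⟨τ, hτ⟩ : S.Nonempty := Finset.card_ne_zero.1 (hS ▸ hj)
        have hle : Fintype.card (MulAction.stabilizer G S) ≤ S.card := by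
          rw [← Finset.card_univ]
          refine Finset.card_le_card_of_injOn (fun σ => (σ : G) * τ) (fun σ _ => ?_)
            fun σ _ σ' _ hσ => Subtype.ext (mul_right_cancel hσ)
          have hσ : (σ : G) • S = S := σ.2
          have := Finset.smul_mem_smul_finset (a := (σ : G)) hτ
          rwa [hσ] at this
        have h₁ : (α ^ s) ^ S.card ∣ ∏ σ ∈ S, σ • y := by
          rw [← Finset.prod_const]
          exact Finset.prod_dvd_prod_of_dvd _ _ fun σ _ =>
            ((dvd_smul_iff hα.irreducible σ).2 hy)
        refine dvd_trans ?_ h₁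
        rw [← pow_mul, mul_comm s]
        exact pow_dvd_pow _ (Nat.mul_le_mul_right _ hle)
    · rw [if_neg hS]
      exact ⟨0, dvd_zero _, by simp⟩

lemma natDegree_prod_one_add_le (y : D) :
    (∏ σ : G, (1 + X * C (σ • y))).natDegree ≤ Fintype.card G := by
  refine (natDegree_prod_le _ _).trans ((Finset.sum_le_card_nsmul _ _ 1 fun σ _ => ?_).trans ?_)
  · refine (natDegree_add_le _ _).trans (max_le (by simp) ?_)
    exact (natDegree_mul_C_le _ _).trans natDegree_X_le
  · simp

lemma coeff_zero_prod_one_add (y : D) : (∏ σ : G, (1 + X * C (σ • y))).coeff 0 = 1 := by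
  simp [coeff_zero_eq_eval_zero, eval_prod]

lemma coeff_one_prod_one_add (y : D) :
    (∏ σ : G, (1 + X * C (σ • y))).coeff 1 = ∑ σ : G, σ • y := by
  classical
  rw [coeff_prod_one_add, ← Finset.sum_filter]
  symm
  refine Finset.sum_bij (fun σ _ => {σ}) (by simp) (by simp) (fun S hS => ?_) (by simp)
  obtain ⟨σ, rfl⟩ := Finset.card_eq_one.1 (by simpa using hS)
  exact ⟨σ, by simp⟩

lemma smul_coeff_prod_one_add (y : D) (j : ℕ) (σ : G) :
    σ • (∏ τ : G, (1 + X * C (τ • y))).coeff j = (∏ τ : G, (1 + X * C (τ • y))).coeff j := by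
  have h : (∏ τ : G, (1 + X * C (τ • y))).map (MulSemiringAction.toRingHom G D σ) =
      ∏ τ : G, (1 + X * C (τ • y)) := by
    rw [Polynomial.map_prod]
    refine Fintype.prod_equiv (Equiv.mulLeft σ) _ _ fun τ => ?_
    simp [mul_smul]
  conv_rhs => rw [← h, coeff_map]
  rfl

end Norm

/-! ### The last ramification group -/

section Break

variable {D G : Type*} [CommRing D] [IsDomain D] [IsDiscreteValuationRing D] [Group G]
  [MulSemiringAction G D] {α δ : D} {H : Subgroup G}

/-- The subgroup `H` is the last nontrivial ramification subgroup: it consists of those `σ` for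
which `σ α - α` has the largest possible order, the order of `δ`, which is at least two. -/
structure IsLastBreak (G : Type*) {D : Type*} [CommRing D] [Group G] [MulSemiringAction G D]
    (α δ : D) (H : Subgroup G) : Prop where
  ne_zero : δ ≠ 0
  sq_dvd : α ^ 2 ∣ δ
  mem_iff : ∀ σ : G, σ ∈ H ↔ δ ∣ σ • α - α
  sub_dvd : ∀ σ : G, σ ≠ 1 → σ • α - α ∣ δ

lemma IsLastBreak.associated (h : IsLastBreak G α δ H) {σ : G} (hσ : σ ∈ H) (hne : σ ≠ 1) :
    Associated (σ • α - α) δ :=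
  associated_of_dvd_dvd (h.sub_dvd σ hne) ((h.mem_iff σ).1 hσ)

lemma IsLastBreak.hasSingleBreak (h : IsLastBreak G α δ H) {i : ℕ}
    (hi : Associated δ (α ^ (i + 1))) : HasSingleBreak H α i := fun σ hσ =>
  (h.associated σ.2 fun h' => hσ (Subtype.ext h')).trans hi

lemma residueQuot_mul_eq {x y : D} (hy : y ≠ 0) {c : D} (hx : x = y * c) :
    residueQuot x y = residue D c := by
  have h : y ∣ x := ⟨c, hx⟩
  rw [residueQuot, dif_pos h]
  congr 1
  exact mul_left_cancel₀ hy (h.choose_spec.symm.trans hx)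

lemma IsLastBreak.smul_sub_mem (h : IsLastBreak G α δ H) (hα : IsUniformizingGenerator G α) {σ : G}
    (hσ : σ ∈ H) : δ * α ∣ σ • δ - δ := by
  obtain ⟨δ', hδ'⟩ : α ∣ δ := (dvd_pow_self α two_ne_zero).trans h.sq_dvd
  have h₁ : δ ∣ σ • δ' - δ' := ((h.mem_iff σ).1 hσ).trans (hα.sub_dvd' σ δ')
  have h₂ : α ∣ δ' := by
    have := h.sq_dvd
    rwa [hδ', sq, mul_dvd_mul_iff_left hα.irreducible.ne_zero] at this
  have h₃ : σ • δ - δ = (σ • δ' - δ') * σ • α + (σ • α - α) * δ' := by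
    conv_lhs => rw [hδ', smul_mul']
    ring
  rw [h₃]
  exact dvd_add (mul_dvd_mul h₁ ((dvd_smul_iff hα.irreducible σ).2 dvd_rfl))
    (mul_dvd_mul ((h.mem_iff σ).1 hσ) h₂)

/-- The function `β` is additive on `H`, because `σ δ` is congruent to `δ` modulo `δ α` for `σ ∈ H`;
this uses that `α ^ 2` divides `δ`. -/
lemma IsLastBreak.residueQuot_mul (h : IsLastBreak G α δ H) (hα : IsUniformizingGenerator G α)
    {σ τ : G} (hσ : σ ∈ H) (hτ : τ ∈ H) :
    residueQuot ((σ * τ) • α - α) δ = residueQuot (σ • α - α) δ + residueQuot (τ • α - α) δ := by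
  obtain ⟨c, hc⟩ := (h.mem_iff σ).1 hσ
  obtain ⟨d, hd⟩ := (h.mem_iff τ).1 hτ
  obtain ⟨e, he⟩ := h.smul_sub_mem hα hσ
  have hαδ : α ∣ δ := (dvd_pow_self α two_ne_zero).trans h.sq_dvd
  have hd' : α ∣ σ • d - d := (hαδ.trans ((h.mem_iff σ).1 hσ)).trans (hα.sub_dvd' σ d)
  have hmul : (σ * τ) • α - α = δ * ((σ • d) * (1 + α * e) + c) := by
    have : (σ * τ) • α - α = σ • (τ • α - α) + (σ • α - α) := by rw [smul_sub, mul_smul]; ring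
    rw [this, hd, hc, smul_mul', sub_eq_iff_eq_add.1 he]
    ring
  rw [residueQuot_mul_eq h.ne_zero hmul, residueQuot_mul_eq h.ne_zero hc,
    residueQuot_mul_eq h.ne_zero hd, ← map_add, ← sub_eq_zero, ← map_sub, residue_eq_zero_iff,
    ← hα.dvd_iff]
  have : (σ • d) * (1 + α * e) + c - (c + d) = (σ • d - d) + α * (e * σ • d) := by ring
  rw [this]
  exact dvd_add hd' (dvd_mul_right _ _)

lemma IsLastBreak.residueQuot_injOn (h : IsLastBreak G α δ H) (hα : IsUniformizingGenerator G α) :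
    Set.InjOn (fun σ : G => residueQuot (σ • α - α) δ) H := by
  intro σ hσ τ hτ heq
  obtain ⟨c, hc⟩ := (h.mem_iff σ).1 hσ
  obtain ⟨d, hd⟩ := (h.mem_iff τ).1 hτ
  simp only [residueQuot_mul_eq h.ne_zero hc, residueQuot_mul_eq h.ne_zero hd] at heq
  rw [← sub_eq_zero, ← map_sub, residue_eq_zero_iff, ← hα.dvd_iff] at heq
  by_contra hne
  have h₁ : (τ⁻¹ * σ) • α - α ∣ δ := h.sub_dvd _ fun h' => hne (inv_mul_eq_one.1 h').symm
  have h₂ : τ⁻¹ • (σ • α - τ • α) = (τ⁻¹ * σ) • α - α := by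
    rw [smul_sub, mul_smul, inv_smul_smul]
  have h₃ : σ • α - τ • α = δ * (c - d) := by
    rw [mul_sub, ← hc, ← hd]; ring
  rw [← h₂, (associated_smul hα.irreducible _ _).dvd_iff_dvd_left, h₃] at h₁
  have h₄ : IsUnit (c - d) := by
    obtain ⟨e, he⟩ := h₁
    refine IsUnit.of_mul_eq_one e (mul_left_cancel₀ h.ne_zero ?_)
    rw [← mul_assoc, ← he, mul_one]
  exact hα.irreducible.not_isUnit (isUnit_of_dvd_unit heq h₄)

end Break

/-! ### Dilatations and Gauss valuations centred at the conjugates of the uniformizer -/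

section Gap

variable {D G : Type*} [CommRing D] [IsDomain D] [IsDiscreteValuationRing D] [Group G]
  [MulSemiringAction G D] {α δ : D} {H : Subgroup G}

open Classical in
/-- The one of `α - σ α` and `δ` which has the smaller order, up to a unit. -/
def gap (α δ : D) (H : Subgroup G) (σ : G) : D := if σ ∈ H then δ else α - σ • α

lemma gap_of_mem {σ : G} (hσ : σ ∈ H) : gap α δ H σ = δ := if_pos hσ

lemma gap_of_not_mem {σ : G} (hσ : σ ∉ H) : gap α δ H σ = α - σ • α := if_neg hσ

lemma IsLastBreak.gap_dvd (h : IsLastBreak G α δ H) (σ : G) : gap α δ H σ ∣ δ := by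
  by_cases hσ : σ ∈ H
  · rw [gap_of_mem hσ]
  · rw [gap_of_not_mem hσ, ← neg_sub, neg_dvd]
    exact h.sub_dvd σ fun h1 => hσ (h1 ▸ H.one_mem)

lemma IsLastBreak.gap_dvd_sub (h : IsLastBreak G α δ H) (σ : G) : gap α δ H σ ∣ α - σ • α := by
  by_cases hσ : σ ∈ H
  · rw [gap_of_mem hσ, ← neg_sub, dvd_neg]
    exact (h.mem_iff σ).1 hσ
  · rw [gap_of_not_mem hσ]

lemma IsLastBreak.gap_ne_zero (h : IsLastBreak G α δ H) (σ : G) : gap α δ H σ ≠ 0 :=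
  ne_zero_of_dvd_ne_zero h.ne_zero (h.gap_dvd σ)

lemma IsLastBreak.gap_mul_dvd (h : IsLastBreak G α δ H) (hα : IsUniformizingGenerator G α) {σ : G}
    (hσ : σ ∉ H) : gap α δ H σ * α ∣ δ := by
  obtain ⟨s, hs⟩ := h.gap_dvd σ
  suffices hs' : α ∣ s by
    exact (mul_dvd_mul_left _ hs').trans hs.symm.dvd
  rw [hα.dvd_iff, mem_maximalIdeal, mem_nonunits_iff]
  intro hu
  refine hσ ((h.mem_iff σ).2 ?_)
  rw [hs, hu.mul_right_dvd, gap_of_not_mem hσ, ← neg_sub, neg_dvd]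

lemma IsLastBreak.gap_dvd_smul_sub (h : IsLastBreak G α δ H) (hα : IsUniformizingGenerator G α)
    (σ τ : G) : gap α δ H (τ⁻¹ * σ) ∣ τ • α - σ • α := by
  have : τ • α - σ • α = τ • (α - (τ⁻¹ * σ) • α) := by
    rw [smul_sub, mul_smul, smul_inv_smul]
  rw [this, dvd_smul_iff hα.irreducible]
  exact h.gap_dvd_sub _

lemma prod_gap_inv_mul [Fintype G] (τ : G) :
    ∏ σ : G, gap α δ H (τ⁻¹ * σ) = ∏ σ : G, gap α δ H σ :=
  Fintype.prod_equiv (Equiv.mulLeft τ⁻¹) _ _ fun _ => rfl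

lemma IsLastBreak.associated_prod_gap [Fintype G] [DecidableEq G] (h : IsLastBreak G α δ H) :
    Associated (∏ σ : G, gap α δ H σ) ((∏ σ ∈ Finset.univ.erase (1 : G), (α - σ • α)) * δ) := by
  rw [← Finset.prod_erase_mul _ _ (Finset.mem_univ (1 : G)), gap_of_mem H.one_mem]
  refine Associated.mul_right (Associated.prod _ _ _ fun σ hσ => ?_) δ
  by_cases hσH : σ ∈ H
  · rw [gap_of_mem hσH, ← neg_sub]
    exact (h.associated hσH (Finset.ne_of_mem_erase hσ)).symm.neg_right
  · rw [gap_of_not_mem hσH]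
    exact Associated.refl _

open Classical in
/-- The products of the gaps over the complement of `H` and over its translate by `τ⁻¹`, for `τ`
not in `H`: the second one has larger order. -/
lemma IsLastBreak.mul_prod_gap_dvd [Fintype G] (h : IsLastBreak G α δ H)
    (hα : IsUniformizingGenerator G α) {τ : G} (hτ : τ ∉ H) :
    α * ∏ σ : G with σ ∉ H, gap α δ H σ ∣ ∏ σ : G with σ ∉ H, gap α δ H (τ⁻¹ * σ) := by
  set W := ∏ σ : G with σ ∈ H, gap α δ H (τ⁻¹ * σ) with hW
  have hW0 : W ≠ 0 := Finset.prod_ne_zero_iff.2 fun σ _ => h.gap_ne_zero _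
  have h₁ : W * α ∣ ∏ σ : G with σ ∈ H, gap α δ H σ := by
    refine dvd_trans (b := ∏ σ : G with σ ∈ H, (gap α δ H (τ⁻¹ * σ) * α)) ?_ ?_
    · rw [Finset.prod_mul_distrib, Finset.prod_const]
      refine mul_dvd_mul_left _ (dvd_pow_self α (Finset.card_ne_zero.2 ⟨1, ?_⟩))
      simp [H.one_mem]
    · refine Finset.prod_dvd_prod_of_dvd _ _ fun σ hσ => ?_
      have hσ' : σ ∈ H := by simpa using hσ
      rw [gap_of_mem hσ']
      exact h.gap_mul_dvd hα fun h' => hτ (by simpa using H.mul_mem hσ' (H.inv_mem h'))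
  refine (mul_dvd_mul_iff_left hW0).1 ?_
  have h₂ : W * ∏ σ : G with σ ∉ H, gap α δ H (τ⁻¹ * σ) =
      (∏ σ : G with σ ∈ H, gap α δ H σ) * ∏ σ : G with σ ∉ H, gap α δ H σ := by
    rw [hW, Finset.prod_filter_mul_prod_filter_not, prod_gap_inv_mul,
      Finset.prod_filter_mul_prod_filter_not]
  rw [h₂, ← mul_assoc]
  exact mul_dvd_mul_right h₁ _

end Gap

section Shift

variable {D G : Type*} [CommRing D] [IsDomain D] [IsDiscreteValuationRing D] [Group G]
  [MulSemiringAction G D] {α δ : D} {H : Subgroup G} {L : Type*} [Field L] [Algebra D L]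
  [IsFractionRing D L]

variable (L) in
/-- The substitution of `x + δ X` for `X`. -/
def shift (δ x : D) : L[X] →ₐ[L] L[X] :=
  aeval (C (algebraMap D L x) + C (algebraMap D L δ) * X)

lemma shift_eq_comp (δ x : D) (g : L[X]) :
    shift L δ x g = g.comp (C (algebraMap D L x) + C (algebraMap D L δ) * X) := rfl

lemma shift_C (δ x : D) (a : L) : shift L δ x (C a) = C a := C_comp

lemma shift_map (δ x : D) (P : D[X]) :
    shift L δ x (P.map (algebraMap D L)) = (P.comp (C x + C δ * X)).map (algebraMap D L) := by
  rw [shift_eq_comp, Polynomial.map_comp]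
  simp

lemma shift_add (δ x b : D) (g : L[X]) {P : D[X]} (hP : P.map (algebraMap D L) = shift L δ x g) :
    (P.comp (X + C b)).map (algebraMap D L) = shift L δ (x + δ * b) g := by
  rw [Polynomial.map_comp, hP, shift_eq_comp, shift_eq_comp, comp_assoc]
  congr 1
  simp only [Polynomial.map_add, map_X, Polynomial.map_C, add_comp, C_comp, mul_comp, X_comp,
    map_add, map_mul]
  ring

/-- A homomorphism to `L[X]` with values in `D[X]`, regarded as a homomorphism to `D[X]`. -/
def liftPoly {S : Type*} [CommRing S] [Algebra D S] (φ : S →ₐ[D] L[X])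
    (h : ∀ s, ∃ P : D[X], P.map (algebraMap D L) = φ s) : S →ₐ[D] D[X] :=
  (AlgEquiv.ofInjective (mapAlgHom (Algebra.ofId D L))
    (map_injective _ (IsFractionRing.injective D L))).symm.toAlgHom.comp (φ.codRestrict _ h)

lemma map_liftPoly {S : Type*} [CommRing S] [Algebra D S] (φ : S →ₐ[D] L[X])
    (h : ∀ s, ∃ P : D[X], P.map (algebraMap D L) = φ s) (s : S) :
    (liftPoly φ h s).map (algebraMap D L) = φ s :=
  congrArg Subtype.val ((AlgEquiv.ofInjective (mapAlgHom (Algebra.ofId D L))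
    (map_injective _ (IsFractionRing.injective D L))).apply_symm_apply (φ.codRestrict _ h s))

variable [Fintype G]

/-- All the factors of `f (τ α + δ X) = ∏ (τ α - σ α + δ X)` are divisible by the gaps. -/
lemma IsLastBreak.dvd_prod_shift (h : IsLastBreak G α δ H) (hα : IsUniformizingGenerator G α)
    (τ : G) (s : Finset G) :
    C (∏ σ ∈ s, gap α δ H (τ⁻¹ * σ)) ∣ ∏ σ ∈ s, (C (τ • α - σ • α) + C δ * X : D[X]) := by
  rw [map_prod]
  exact Finset.prod_dvd_prod_of_dvd _ _ fun σ _ =>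
    dvd_add (_root_.map_dvd C (h.gap_dvd_smul_sub hα σ τ))
      (dvd_mul_of_dvd_left (_root_.map_dvd C (h.gap_dvd _)) X)

lemma comp_prod_X_sub (x : D) (s : Finset G) :
    (∏ σ ∈ s, (X - C (σ • α))).comp (C x + C δ * X) =
      ∏ σ ∈ s, (C (x - σ • α) + C δ * X : D[X]) := by
  rw [prod_comp]
  refine Finset.prod_congr rfl fun σ _ => ?_
  simp only [sub_comp, X_comp, C_comp, C_sub]
  ring

variable {f : D[X]} {m : ℕ}

/-- The substitution of `τ α + δ X` in a function on the dilatation has coefficients in `D`. -/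
lemma IsLastBreak.exists_map_eq_shift_dilatation (h : IsLastBreak G α δ H)
    (hα : IsUniformizingGenerator G α) (hf : f = ∏ σ : G, (X - C (σ • α)))
    (hm : Associated (∏ σ : G, gap α δ H σ) (α ^ m)) (τ : G) (g : dilatation L f α m) :
    ∃ P : D[X], P.map (algebraMap D L) = shift L δ (τ • α) (g : L[X]) := by
  let ψ : L[X] →ₐ[D] L[X] := (shift L δ (τ • α)).restrictScalars D
  suffices hA : (dilatation L f α m).map ψ ≤ (mapAlgHom (Algebra.ofId D L)).range by
    obtain ⟨P, hP⟩ := hA ⟨g, g.2, rfl⟩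
    exact ⟨P, hP⟩
  rw [dilatation, AlgHom.map_adjoin, Algebra.adjoin_le_iff]
  have hαL : algebraMap D L α ≠ 0 := by
    simpa using hα.irreducible.ne_zero
  rintro _ ⟨x, rfl | rfl, rfl⟩
  · exact ⟨C (τ • α) + C δ * X, by simp [ψ, shift]⟩
  · have h₁ := h.dvd_prod_shift hα τ Finset.univ
    rw [prod_gap_inv_mul] at h₁
    obtain ⟨P, hP⟩ := (_root_.map_dvd C hm.symm.dvd).trans h₁
    refine ⟨P, ?_⟩
    change P.map (algebraMap D L) = shift L δ (τ • α) (C _ * _)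
    rw [map_mul, shift_map, hf, comp_prod_X_sub, hP, Polynomial.map_mul, ← mul_assoc]
    rw [shift_C, Polynomial.map_C, ← C_mul, map_pow, inv_mul_cancel₀ (pow_ne_zero _ hαL), C_1, one_mul]

/-- The substitution of `τ α + δ X` in a function on the normalization of the dilatation has
coefficients in `D`, as `D[X]` is integrally closed in `L[X]`. -/
lemma IsLastBreak.exists_map_eq_shift (h : IsLastBreak G α δ H)
    (hα : IsUniformizingGenerator G α) (hf : f = ∏ σ : G, (X - C (σ • α)))
    (hm : Associated (∏ σ : G, gap α δ H σ) (α ^ m)) (τ : G) (g : normalization L f α m) :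
    ∃ P : D[X], P.map (algebraMap D L) = shift L δ (τ • α) (g : L[X]) := by
  let φ := liftPoly (((shift L δ (τ • α)).restrictScalars D).comp (dilatation L f α m).val)
    (h.exists_map_eq_shift_dilatation hα hf hm τ)
  obtain ⟨g, hg⟩ := g
  obtain ⟨p, hp, hpg⟩ : IsIntegral (dilatation L f α m) g := hg
  let : Algebra D[X] L[X] := Polynomial.algebra D L
  have hint : IsIntegral D[X] (shift L δ (τ • α) g) := by
    refine ⟨p.map φ.toRingHom, hp.map _, ?_⟩
    have h₁ : (algebraMap D[X] L[X]).comp φ.toRingHom =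
        (shift L δ (τ • α)).toRingHom.comp (algebraMap (dilatation L f α m) L[X]) := by
      ext1 a
      exact map_liftPoly _ _ a
    rw [eval₂_map, h₁]
    have h₂ := Polynomial.hom_eval₂ p (algebraMap (dilatation L f α m) L[X])
      (shift L δ (τ • α)).toRingHom g
    rw [hpg, map_zero] at h₂
    exact h₂.symm
  rw [Polynomial.isIntegral_iff_isIntegral_coeff] at hint
  exact (lifts_iff_coeff_lifts _).2 fun n => IsIntegrallyClosed.isIntegral_iff.1 (hint n)

/-- An element `x` of a valued field at which `f / α ^ m` is integral is congruent
modulo `δ` to a conjugate of `α`. -/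
lemma IsLastBreak.exists_valuation_sub_le (h : IsLastBreak G α δ H)
    (hα : IsUniformizingGenerator G α) (hm : Associated (∏ σ : G, gap α δ H σ) (α ^ m))
    {F : Type*} [Field F] [Algebra D F] (hinj : Function.Injective (algebraMap D F))
    (V : ValuationSubring F) (hV : ∀ d : D, algebraMap D F d ∈ V) {x : F}
    (hx : V.valuation (∏ σ : G, (x - algebraMap D F (σ • α))) ≤
      V.valuation (algebraMap D F α ^ m)) :
    ∃ τ : G, V.valuation (x - algebraMap D F (τ • α)) ≤ V.valuation (algebraMap D F δ) := by
  classical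
  have hass : ∀ a b : D, Associated a b →
      V.valuation (algebraMap D F a) = V.valuation (algebraMap D F b) := by
    have hle : ∀ a b : D, a ∣ b → V.valuation (algebraMap D F b) ≤ V.valuation (algebraMap D F a) := by
      rintro a _ ⟨c, rfl⟩
      rw [map_mul, map_mul]
      exact mul_le_of_le_one_right' ((V.valuation_le_one_iff _).2 (hV c))
    exact fun a b hab => le_antisymm (hle b a hab.symm.dvd) (hle a b hab.dvd)
  have hpos : ∀ a : D, a ≠ 0 → 0 < V.valuation (algebraMap D F a) := fun a ha =>
    zero_lt_iff.2 ((V.valuation.ne_zero_iff).2 (by rwa [ne_eq, map_eq_zero_iff _ hinj]))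
  -- Take the conjugate `τ α` nearest to `x`. If it were farther than `δ`, every factor `x - σ α`
  -- would be at least as large as the corresponding gap, and the one for `σ = τ` larger.
  obtain ⟨τ, -, hτ⟩ := Finset.exists_min_image Finset.univ
    (fun σ : G => V.valuation (x - algebraMap D F (σ • α))) Finset.univ_nonempty
  refine ⟨τ, le_of_not_gt fun hlt => ?_⟩
  have hge : ∀ σ : G, V.valuation (algebraMap D F (gap α δ H (τ⁻¹ * σ))) ≤
      V.valuation (x - algebraMap D F (σ • α)) := by
    intro σ
    by_cases hσ : τ⁻¹ * σ ∈ H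
    · rw [gap_of_mem hσ]
      exact hlt.le.trans (hτ σ (Finset.mem_univ _))
    · have h₁ : V.valuation (algebraMap D F (gap α δ H (τ⁻¹ * σ))) =
          V.valuation (algebraMap D F (τ • α - σ • α)) := by
        refine hass _ _ ?_
        have : τ • α - σ • α = τ • (α - (τ⁻¹ * σ) • α) := by
          rw [smul_sub, mul_smul, smul_inv_smul]
        rw [gap_of_not_mem hσ, this]
        exact (associated_smul hα.irreducible _ _).symm
      have h₂ : algebraMap D F (τ • α - σ • α) =
          (x - algebraMap D F (σ • α)) - (x - algebraMap D F (τ • α)) := by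
        rw [map_sub]; ring
      rw [h₁, h₂]
      exact (V.valuation.map_sub _ _).trans (max_le le_rfl (hτ σ (Finset.mem_univ _)))
  have hlast : V.valuation (algebraMap D F α ^ m) <
      V.valuation (∏ σ : G, (x - algebraMap D F (σ • α))) := by
    have h₁ := hass _ _ hm
    rw [map_pow] at h₁
    rw [← h₁, ← prod_gap_inv_mul τ, map_prod, map_prod, map_prod,
      ← Finset.mul_prod_erase _ _ (Finset.mem_univ τ),
      ← Finset.mul_prod_erase _ (fun σ => V.valuation (x - algebraMap D F (σ • α)))
        (Finset.mem_univ τ), inv_mul_cancel, gap_of_mem H.one_mem]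
    have hle : ∏ σ ∈ Finset.univ.erase τ, V.valuation (algebraMap D F (gap α δ H (τ⁻¹ * σ))) ≤
        ∏ σ ∈ Finset.univ.erase τ, V.valuation (x - algebraMap D F (σ • α)) :=
      Finset.prod_le_prod (fun _ _ => zero_le) fun σ _ => hge σ
    have h0 : 0 < ∏ σ ∈ Finset.univ.erase τ,
        V.valuation (algebraMap D F (gap α δ H (τ⁻¹ * σ))) :=
      zero_lt_iff.2 (Finset.prod_ne_zero_iff.2 fun σ _ => (hpos _ (h.gap_ne_zero _)).ne')
    exact mul_lt_mul_of_lt_of_le_of_nonneg_of_pos hlt hle zero_le (h0.trans_le hle)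
  exact absurd hx (not_le.2 hlast)

/-- The normalization of the dilatation is the intersection of `L[X]` with the valuation rings of
the Gauss valuations centred at the conjugates of `α`, with radius given by `δ`. -/
lemma IsLastBreak.mem_normalization_iff (h : IsLastBreak G α δ H)
    (hα : IsUniformizingGenerator G α) (hf : f = ∏ σ : G, (X - C (σ • α)))
    (hm : Associated (∏ σ : G, gap α δ H σ) (α ^ m)) (g : L[X]) :
    g ∈ normalization L f α m ↔
      ∀ τ : G, ∃ P : D[X], P.map (algebraMap D L) = shift L δ (τ • α) g := by
  refine ⟨fun hg τ => h.exists_map_eq_shift hα hf hm τ ⟨g, hg⟩, fun hg => ?_⟩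
  change IsIntegral (dilatation L f α m) g
  let F := RatFunc L
  have hinjF : Function.Injective (algebraMap L[X] F) := IsFractionRing.injective L[X] F
  let A := dilatation L f α m
  rw [← isIntegral_algebraMap_iff hinjF]
  by_contra hgR
  have hR : algebraMap L[X] F g ∉ (integralClosure A F).toSubring := hgR
  have : IsIntegrallyClosedIn (integralClosure A F).toSubring F :=
    inferInstanceAs (IsIntegrallyClosedIn (integralClosure A F) F)
  obtain ⟨V, hRV, hgV⟩ := Subring.exists_le_valuationSubring_of_isIntegrallyClosedIn hR
  have hAV : ∀ a : A, algebraMap L[X] F a ∈ V := fun a =>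
    hRV ((integralClosure A F).algebraMap_mem a)
  have hDV : ∀ d : D, algebraMap D F d ∈ V := fun d => by
    have := hAV (algebraMap D A d)
    rwa [IsScalarTower.algebraMap_apply D L[X] F]
  have hinj : Function.Injective (algebraMap D F) := by
    rw [IsScalarTower.algebraMap_eq D L F]
    exact (algebraMap L F).injective.comp (IsFractionRing.injective D L)
  set x : F := algebraMap L[X] F X with hxdef
  have hprod : algebraMap L[X] F (f.map (algebraMap D L)) =
      ∏ σ : G, (x - algebraMap D F (σ • α)) := by
    rw [hf, Polynomial.map_prod, map_prod]
    refine Finset.prod_congr rfl fun σ _ => ?_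
    rw [IsScalarTower.algebraMap_apply D L[X] F]
    simp [hxdef]
  have hαL : algebraMap D L α ≠ 0 := by
    simpa using hα.irreducible.ne_zero
  have hSx : ∏ σ : G, (x - algebraMap D F (σ • α)) =
      algebraMap D F α ^ m * algebraMap L[X] F (dilatationCoord L f α m : L[X]) := by
    rw [← hprod, ← map_pow, IsScalarTower.algebraMap_apply D L[X] F, ← map_mul]
    congr 1
    rw [dilatationCoord, ← mul_assoc, Polynomial.algebraMap_apply, ← C_mul, map_pow,
      mul_inv_cancel₀ (pow_ne_zero _ hαL), C_1, one_mul]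
  obtain ⟨τ, hτ⟩ := h.exists_valuation_sub_le hα hm hinj V hDV (x := x) (by
    rw [hSx, map_mul]
    exact mul_le_of_le_one_right' ((V.valuation_le_one_iff _).2 (hAV _)))
  have hδF : algebraMap D F δ ≠ 0 := by
    rw [ne_eq, map_eq_zero_iff _ hinj]
    exact h.ne_zero
  set y : F := (x - algebraMap D F (τ • α)) / algebraMap D F δ with hy
  have hyV : y ∈ V := by
    rw [← V.valuation_le_one_iff, hy, map_div₀]
    exact div_le_one_of_le₀ hτ zero_le
  obtain ⟨P, hP⟩ := hg τ
  have key : algebraMap L[X] F g = aeval y P := by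
    have h₁ : aeval y (P.map (algebraMap D L)) = aeval y P := aeval_map_algebraMap L y P
    rw [← h₁, hP, shift_eq_comp, aeval_comp]
    have h₂ : aeval y (C (algebraMap D L (τ • α)) + C (algebraMap D L δ) * X) = x := by
      simp only [map_add, map_mul, aeval_C, aeval_X, hy]
      rw [← IsScalarTower.algebraMap_apply D L F, ← IsScalarTower.algebraMap_apply D L F]
      rw [mul_div_cancel₀ _ hδF, add_sub_cancel]
    rw [h₂, hxdef, aeval_algebraMap_apply, aeval_X_left_apply]
  refine hgV ?_
  rw [key, aeval_eq_sum_range]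
  refine sum_mem fun j _ => ?_
  rw [Algebra.smul_def]
  exact mul_mem (hDV _) (pow_mem hyV _)

end Shift

/-! ### Closed fibers and connected components -/

section ReducedFiber

variable {O S A : Type*} [CommRing O] [IsLocalRing O] [CommRing S] [Algebra O S] [CommRing A]
  [Algebra O A] [Algebra (ResidueField O) A] [IsScalarTower O (ResidueField O) A]

/-- `ReducedFiber.mk` as a ring homomorphism. -/
def ReducedFiber.mkHom (O S : Type*) [CommRing O] [IsLocalRing O] [CommRing S] [Algebra O S] :
    S →+* ReducedFiber O S :=
  (Ideal.Quotient.mk (nilradical (ResidueField O ⊗[O] S))).comp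
    (Algebra.TensorProduct.includeRight : S →ₐ[O] ResidueField O ⊗[O] S).toRingHom

lemma ReducedFiber.mkHom_apply (s : S) : mkHom O S s = mk s := rfl

lemma ReducedFiber.mkHom_algebraMap (c : O) :
    mkHom O S (algebraMap O S c) = algebraMap (ResidueField O) _ (residue O c) := by
  change Ideal.Quotient.mk _ ((1 : ResidueField O) ⊗ₜ[O] algebraMap O S c) =
    Ideal.Quotient.mk _ (residue O c ⊗ₜ[O] (1 : S))
  rw [Algebra.algebraMap_eq_smul_one, TensorProduct.tmul_smul, TensorProduct.smul_tmul',
    Algebra.smul_def, mul_one]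
  rfl

lemma ReducedFiber.mk_surjective : Function.Surjective (mkHom O S) := by
  intro x
  obtain ⟨x, rfl⟩ := Ideal.Quotient.mk_surjective x
  induction x using TensorProduct.induction_on with
  | zero => exact ⟨0, (map_zero _).trans (map_zero (Ideal.Quotient.mk _)).symm⟩
  | add x y hx hy =>
    obtain ⟨a, ha⟩ := hx
    obtain ⟨b, hb⟩ := hy
    exact ⟨a + b, by rw [map_add, ha, hb]; exact (map_add (Ideal.Quotient.mk _) x y).symm⟩
  | tmul x s =>
    obtain ⟨c, rfl⟩ := residue_surjective x
    refine ⟨c • s, ?_⟩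
    change Ideal.Quotient.mk _ ((1 : ResidueField O) ⊗ₜ[O] (c • s)) =
      Ideal.Quotient.mk _ (residue O c ⊗ₜ[O] s)
    rw [TensorProduct.tmul_smul, TensorProduct.smul_tmul', Algebra.smul_def, mul_one]
    rfl

lemma ReducedFiber.algHom_ext {B : Type*} [CommRing B] [Algebra (ResidueField O) B]
    {φ ψ : ReducedFiber O S →ₐ[ResidueField O] B}
    (h : ∀ s, φ (mkHom O S s) = ψ (mkHom O S s)) : φ = ψ := by
  ext x
  obtain ⟨s, rfl⟩ := mk_surjective x
  exact h s

/-- The homomorphism on the coordinate ring of the reduced closed fiber induced by a homomorphism to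
a reduced algebra over the residue field. -/
def ReducedFiber.lift [IsReduced A] (φ : S →ₐ[O] A) :
    ReducedFiber O S →ₐ[ResidueField O] A :=
  Ideal.Quotient.liftₐ _
    (Algebra.TensorProduct.lift (Algebra.ofId (ResidueField O) A) φ (fun _ _ => Commute.all _ _))
    (fun _ hx => (IsNilpotent.map hx _).eq_zero)

lemma ReducedFiber.lift_mk [IsReduced A] (φ : S →ₐ[O] A) (s : S) : lift φ (mkHom O S s) = φ s := by
  change Algebra.TensorProduct.lift (Algebra.ofId (ResidueField O) A) φ
    (fun _ _ => Commute.all _ _) (1 ⊗ₜ[O] s) = _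
  simp

lemma ReducedFiber.point_mk (φ : S →ₐ[O] O) (s : S) :
    point φ (mkHom O S s) = residue O (φ s) := by
  change Algebra.TensorProduct.lift (AlgHom.id (ResidueField O) (ResidueField O))
    ((Algebra.ofId O (ResidueField O)).comp φ) (fun _ _ => Commute.all _ _) (1 ⊗ₜ[O] s) = _
  simp [Algebra.ofId_apply]

lemma ReducedFiber.map_mk {S' : Type*} [CommRing S'] [Algebra O S'] (φ : S →ₐ[O] S') (s : S) :
    map φ (mkHom O S s) = mkHom O S' (φ s) := by
  change Ideal.Quotient.mk _ (Algebra.TensorProduct.map _ φ (1 ⊗ₜ s)) = _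
  rw [Algebra.TensorProduct.map_tmul, map_one]
  rfl

lemma ReducedFiber.eq_zero_of_isNilpotent {x : ReducedFiber O S} (hx : IsNilpotent x) : x = 0 := by
  have : IsReduced (ReducedFiber O S) :=
    (Ideal.isRadical_iff_quotient_reduced _).1 (Ideal.radical_isRadical _)
  exact hx.eq_zero

end ReducedFiber

/-- If a homomorphism to a domain cuts out the open and closed subscheme of an idempotent `e`,
then this subscheme is a connected component. -/
lemma connectedComponent_eq_zeroLocus_ker {R A : Type*} [CommRing R] [CommRing A] [IsDomain A]
    (ρ : R →+* A) {e : R} (he : IsIdempotentElem e) (hker : ∀ x, ρ x = 0 ↔ e * x = 0)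
    {p : PrimeSpectrum R} (hp : RingHom.ker ρ ≤ p.asIdeal) :
    connectedComponent p = PrimeSpectrum.zeroLocus (RingHom.ker ρ : Set R) := by
  have hprime : (RingHom.ker ρ).IsPrime := RingHom.ker_isPrime ρ
  have heq : PrimeSpectrum.zeroLocus (RingHom.ker ρ : Set R) = PrimeSpectrum.basicOpen e := by
    ext q
    rw [PrimeSpectrum.mem_zeroLocus, SetLike.mem_coe, PrimeSpectrum.mem_basicOpen]
    constructor
    · intro hq heq
      have h₁ : (1 - e) ∈ q.asIdeal := hq ((RingHom.mem_ker).2 ((hker _).2 (by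
        rw [mul_sub, mul_one, he.eq, sub_self])))
      have h₂ := q.asIdeal.add_mem h₁ heq
      rw [sub_add_cancel] at h₂
      exact q.isPrime.ne_top ((Ideal.eq_top_iff_one _).2 h₂)
    · intro hq x hx
      have := (hker x).1 hx
      exact (q.isPrime.mem_or_mem (this ▸ q.asIdeal.zero_mem : e * x ∈ q.asIdeal)).resolve_left hq
  refine Set.Subset.antisymm ?_ ?_
  · refine IsClopen.connectedComponent_subset ?_ hp
    rw [heq]
    exact PrimeSpectrum.isClopen_iff.2 ⟨e, he, rfl⟩
  · refine IsPreconnected.subset_connectedComponent ?_ hp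
    exact ((PrimeSpectrum.isIrreducible_zeroLocus_iff_of_radical _ hprime.isRadical).2
      hprime).isPreirreducible.isPreconnected

/-- The coordinate ring of a connected component cut out by a surjective homomorphism. -/
lemma exists_componentRing_equiv {k R A : Type*} [Field k] [CommRing R] [CommRing A] [IsDomain A]
    [Algebra k R] [Algebra k A] (ρ : R →ₐ[k] A) (hsurj : Function.Surjective ρ) {e : R}
    (he : IsIdempotentElem e) (hker : ∀ x, ρ x = 0 ↔ e * x = 0) {P : R →ₐ[k] k}
    (hP : ∀ x, ρ x = 0 → P x = 0) :
    ∃ Φ : ComponentRing P ≃ₐ[k] A, ∀ x, Φ (ComponentRing.mk P x) = ρ x := by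
  have hcomp := connectedComponent_eq_zeroLocus_ker ρ.toRingHom he hker
    (p := primeOfPoint P) fun x hx => hP x hx
  have hprime : (RingHom.ker ρ).IsPrime := RingHom.ker_isPrime ρ
  have hI : PrimeSpectrum.vanishingIdeal (connectedComponent (primeOfPoint P)) = RingHom.ker ρ := by
    rw [hcomp, PrimeSpectrum.vanishingIdeal_zeroLocus_eq_radical]
    exact hprime.isRadical.radical
  exact ⟨(Ideal.quotientEquivAlgOfEq k hI).trans
    (Ideal.quotientKerAlgEquivOfSurjective hsurj), fun x => rfl⟩

section GaussFiber

variable {D G : Type*} [CommRing D] [IsDomain D] [IsDiscreteValuationRing D] [Group G]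
  [MulSemiringAction G D] {α δ : D} {H : Subgroup G} {L : Type*} [Field L] [Algebra D L]
  [IsFractionRing D L] [Fintype G] {f : D[X]} {m : ℕ}

/-- The reduction, for the Gauss valuation centred at `τ α`, of a function on the normalization of the
dilatation. -/
def gaussRed (h : IsLastBreak G α δ H) (hα : IsUniformizingGenerator G α)
    (hf : f = ∏ σ : G, (X - C (σ • α))) (hm : Associated (∏ σ : G, gap α δ H σ) (α ^ m)) (τ : G) :
    normalization L f α m →ₐ[D] (ResidueField D)[X] :=
  (mapAlgHom (Algebra.ofId D (ResidueField D))).comp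
    (liftPoly (((shift L δ (τ • α)).restrictScalars D).comp (normalization L f α m).val)
      (h.exists_map_eq_shift hα hf hm τ))

variable (h : IsLastBreak G α δ H) (hα : IsUniformizingGenerator G α)
    (hf : f = ∏ σ : G, (X - C (σ • α))) (hm : Associated (∏ σ : G, gap α δ H σ) (α ^ m))

lemma gaussRed_eq {τ : G} {g : normalization L f α m} {P : D[X]}
    (hP : P.map (algebraMap D L) = shift L δ (τ • α) (g : L[X])) :
    gaussRed h hα hf hm τ g = P.map (residue D) := by
  have : liftPoly (((shift L δ (τ • α)).restrictScalars D).comp (normalization L f α m).val)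
      (h.exists_map_eq_shift hα hf hm τ) g = P := by
    apply map_injective _ (IsFractionRing.injective D L)
    exact (map_liftPoly _ _ g).trans hP.symm
  rw [← this]
  rfl

/-- A function all of whose reductions vanish is divisible by the uniformizer. -/
lemma mkHom_eq_zero_of_gaussRed {g : normalization L f α m}
    (hg : ∀ τ, gaussRed h hα hf hm τ g = 0) :
    ReducedFiber.mkHom D (normalization L f α m) g = 0 := by
  have hαL : algebraMap D L α ≠ 0 := by
    simpa using hα.irreducible.ne_zero
  have hg' : C (algebraMap D L α)⁻¹ * (g : L[X]) ∈ normalization L f α m := by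
    rw [h.mem_normalization_iff hα hf hm]
    intro τ
    obtain ⟨P, hP⟩ := h.exists_map_eq_shift hα hf hm τ g
    have h₁ := hg τ
    rw [gaussRed_eq h hα hf hm hP] at h₁
    have h₂ : C α ∣ P := by
      rw [C_dvd_iff_dvd_coeff]
      intro j
      have := congrArg (fun Q => Q.coeff j) h₁
      simp only [coeff_map, coeff_zero] at this
      rwa [residue_eq_zero_iff, ← hα.dvd_iff] at this
    obtain ⟨Q, rfl⟩ := h₂
    refine ⟨Q, ?_⟩
    rw [map_mul, shift_C, ← hP, Polynomial.map_mul, Polynomial.map_C, ← mul_assoc, ← C_mul,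
      inv_mul_cancel₀ hαL, C_1, one_mul]
  have h₃ : g = algebraMap D (normalization L f α m) α * ⟨_, hg'⟩ := by
    apply Subtype.ext
    change (g : L[X]) = algebraMap D L[X] α * (C (algebraMap D L α)⁻¹ * (g : L[X]))
    rw [Polynomial.algebraMap_apply, ← mul_assoc, ← C_mul, mul_inv_cancel₀ hαL, C_1, one_mul]
  rw [h₃, map_mul, ReducedFiber.mkHom_algebraMap,
    (residue_eq_zero_iff α).2 (hα.dvd_iff.1 dvd_rfl), map_zero, zero_mul]

lemma map_eq_shift_inv_mul {a x : D} (ha : a ≠ 0) {F Q : D[X]}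
    (hQ : F.comp (C x + C δ * X) = C a * Q) :
    Q.map (algebraMap D L) =
      shift L δ x (C (algebraMap D L a)⁻¹ * F.map (algebraMap D L)) := by
  rw [map_mul, shift_C, shift_map, hQ, Polynomial.map_mul, Polynomial.map_C, ← mul_assoc, ← C_mul,
    inv_mul_cancel₀ (by simpa using ha), C_1, one_mul]

variable (L) in
open Classical in
/-- The function `q = ∏ (X - σ α) / (α - σ α)`, with the product over `σ ∉ H`, reduces to `1` at
the component of `α` and to `0` at the components of the other conjugates. -/
lemma IsLastBreak.exists_separating (h : IsLastBreak G α δ H)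
    (hα : IsUniformizingGenerator G α) : ∃ q : L[X],
    (∃ Q : D[X], Q.map (algebraMap D L) = shift L δ α q ∧ Q.map (residue D) = 1) ∧
    ∀ τ ∉ H, ∃ Q : D[X], (C α * Q).map (algebraMap D L) = shift L δ (τ • α) q := by
  set a := ∏ σ : G with σ ∉ H, gap α δ H σ with ha
  have ha0 : a ≠ 0 := Finset.prod_ne_zero_iff.2 fun σ _ => h.gap_ne_zero _
  refine ⟨C (algebraMap D L a)⁻¹ *
    (∏ σ : G with σ ∉ H, (X - C (σ • α))).map (algebraMap D L), ?_, fun τ hτ => ?_⟩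
  · have ht : ∀ σ : G, ∃ t, σ ∉ H → δ = gap α δ H σ * α * t := fun σ => by
      by_cases hσ : σ ∈ H
      · exact ⟨0, fun h' => absurd hσ h'⟩
      · obtain ⟨t, ht⟩ := h.gap_mul_dvd hα hσ
        exact ⟨t, fun _ => ht⟩
    choose t ht using ht
    refine ⟨∏ σ : G with σ ∉ H, (1 + C (α * t σ) * X), map_eq_shift_inv_mul ha0 ?_, ?_⟩
    · rw [comp_prod_X_sub, ha, map_prod, ← Finset.prod_mul_distrib]
      refine Finset.prod_congr rfl fun σ hσ => ?_
      have hσ' : σ ∉ H := by simpa using hσ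
      rw [← gap_of_not_mem (δ := δ) hσ']
      conv_lhs => rw [ht σ hσ']
      simp only [gap_of_not_mem hσ', map_mul]
      ring
    · rw [Polynomial.map_prod]
      refine Finset.prod_eq_one fun σ _ => ?_
      have : residue D α = 0 := (residue_eq_zero_iff α).2 (hα.dvd_iff.1 dvd_rfl)
      simp [this]
  · obtain ⟨Q, hQ⟩ := (_root_.map_dvd C (h.mul_prod_gap_dvd hα hτ)).trans
      (h.dvd_prod_shift hα τ (Finset.univ.filter fun σ => σ ∉ H))
    refine ⟨Q, map_eq_shift_inv_mul ha0 ?_⟩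
    rw [comp_prod_X_sub, hQ, C_mul]
    ring

lemma IsLastBreak.mem_normalization (h : IsLastBreak G α δ H) (hα : IsUniformizingGenerator G α)
    (hf : f = ∏ σ : G, (X - C (σ • α))) (hm : Associated (∏ σ : G, gap α δ H σ) (α ^ m)) {g : L[X]}
    (h₁ : ∃ P : D[X], P.map (algebraMap D L) = shift L δ α g)
    (h₂ : ∀ τ ∉ H, ∃ P : D[X], P.map (algebraMap D L) = shift L δ (τ • α) g) :
    g ∈ normalization L f α m := by
  rw [h.mem_normalization_iff hα hf hm]
  intro τ
  by_cases hτ : τ ∈ H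
  · obtain ⟨b, hb⟩ := (h.mem_iff τ).1 hτ
    obtain ⟨P, hP⟩ := h₁
    refine ⟨_, (shift_add δ α b g hP).trans ?_⟩
    rw [← hb, add_sub_cancel]
  · exact h₂ τ hτ

lemma gaussRed_of_mem {τ : G} (hτ : τ ∈ H) (g : normalization L f α m) :
    gaussRed h hα hf hm τ g =
      (gaussRed h hα hf hm 1 g).comp (X + C (residueQuot (τ • α - α) δ)) := by
  obtain ⟨b, hb⟩ := (h.mem_iff τ).1 hτ
  obtain ⟨P, hP⟩ := h.exists_map_eq_shift hα hf hm 1 g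
  have hP' := hP
  rw [one_smul] at hP'
  rw [gaussRed_eq h hα hf hm hP, gaussRed_eq h hα hf hm (P := P.comp (X + C b)),
    residueQuot_mul_eq h.ne_zero hb, Polynomial.map_comp]
  · simp
  · rw [shift_add δ α b g hP', ← hb, add_sub_cancel]

/-- A function whose reduction is `1` for `τ ∈ H` and `0` for the other `τ`; the first is stated for
`τ = 1` only, since the reductions for `τ ∈ H` are translates of each other. -/
lemma exists_gaussRed_idempotent : ∃ g : normalization L f α m, gaussRed h hα hf hm 1 g = 1 ∧
    ∀ τ ∉ H, gaussRed h hα hf hm τ g = 0 := by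
  obtain ⟨q, ⟨Q, hQ, hQ1⟩, hq⟩ := h.exists_separating L hα
  refine ⟨⟨q, h.mem_normalization hα hf hm ⟨Q, hQ⟩ fun τ hτ => ?_⟩, ?_, fun τ hτ => ?_⟩
  · obtain ⟨Q', hQ'⟩ := hq τ hτ
    exact ⟨_, hQ'⟩
  · rw [gaussRed_eq h hα hf hm (P := Q) (by rw [hQ, one_smul]), hQ1]
  · obtain ⟨Q', hQ'⟩ := hq τ hτ
    have : residue D α = 0 := (residue_eq_zero_iff α).2 (hα.dvd_iff.1 dvd_rfl)
    rw [gaussRed_eq h hα hf hm hQ']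
    simp [this]

/-- The coordinate `(X - α) / δ` becomes integral at all conjugates after multiplication by a
power of the separating function, whose reduction at `α` is `1`. -/
lemma exists_gaussRed_eq_X : ∃ g : normalization L f α m, gaussRed h hα hf hm 1 g = X := by
  obtain ⟨q, ⟨Q, hQ, hQ1⟩, hq⟩ := h.exists_separating L hα
  obtain ⟨N, hN⟩ := IsDiscreteValuationRing.associated_pow_irreducible h.ne_zero hα.irreducible
  obtain ⟨t, ht⟩ := hN.dvd
  have hX : (X : D[X]).map (algebraMap D L) = shift L δ α
      (C (algebraMap D L δ)⁻¹ * (X - C α : D[X]).map (algebraMap D L)) :=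
    map_eq_shift_inv_mul h.ne_zero (by simp)
  have h₁ : (Q ^ N * X).map (algebraMap D L) = shift L δ α
      (q ^ N * (C (algebraMap D L δ)⁻¹ * (X - C α : D[X]).map (algebraMap D L))) := by
    rw [map_mul, map_pow, ← hQ, ← hX, Polynomial.map_mul, Polynomial.map_pow]
  refine ⟨⟨_, h.mem_normalization hα hf hm ⟨_, h₁⟩ fun τ hτ => ?_⟩, ?_⟩
  · obtain ⟨Q', hQ'⟩ := hq τ hτ
    have hδL : algebraMap D L δ ≠ 0 := by simpa using h.ne_zero
    refine ⟨C t * Q' ^ N * ((X - C α : D[X]).comp (C (τ • α) + C δ * X)), ?_⟩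
    rw [map_mul, map_mul, map_pow, ← hQ', shift_map, shift_C, Polynomial.map_mul,
      Polynomial.map_mul, Polynomial.map_mul, mul_pow, ← Polynomial.map_pow, ← C_pow, ht]
    simp only [Polynomial.map_C, map_mul, Polynomial.map_mul]
    have : C (algebraMap D L δ) * C (algebraMap D L δ)⁻¹ = (1 : L[X]) := by
      rw [← C_mul, mul_inv_cancel₀ hδL, C_1]
    rw [Polynomial.map_pow]
    linear_combination (-(C (algebraMap D L t) * (Q'.map (algebraMap D L)) ^ N *
      ((X - C α : D[X]).comp (C (τ • α) + C δ * X)).map (algebraMap D L))) * this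
  · rw [gaussRed_eq h hα hf hm (P := Q ^ N * X) (by rw [h₁, one_smul])]
    simp [hQ1]

end GaussFiber

/-! ### The component of the reduced closed fiber -/

section GaussFiber

variable {D G : Type*} [CommRing D] [IsDomain D] [IsDiscreteValuationRing D] [Group G]
  [MulSemiringAction G D] {α δ : D} {H : Subgroup G} {L : Type*} [Field L] [Algebra D L]
  [IsFractionRing D L] [Fintype G] {f : D[X]} {m : ℕ}

open Classical in
/-- The expansion `f (α + δ X) = f'(α) δ b₁(X)`, up to terms of larger order. -/
lemma IsLastBreak.exists_comp_eq (h : IsLastBreak G α δ H)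
    (hα : IsUniformizingGenerator G α) (hf : f = ∏ σ : G, (X - C (σ • α)))
    {c : D} (hc : (∏ σ ∈ Finset.univ.erase (1 : G), (α - σ • α)) * δ = c * α ^ m) :
    ∃ P : D[X], f.comp (C α + C δ * X) = C (α ^ m) * P ∧ P.map (residue D) =
      C (residue D c) * normalizedPoly H fun σ => residueQuot (σ • α - α) δ := by
  set β : G → ResidueField D := fun σ => residueQuot (σ • α - α) δ with hβ
  have hinj := h.residueQuot_injOn hα
  have hadd : ∀ σ ∈ H, ∀ τ ∈ H, β (σ * τ) = β σ + β τ := fun σ hσ τ hτ =>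
    h.residueQuot_mul hα hσ hτ
  have hb : ∀ σ : G, ∃ b, σ ∈ H → σ • α - α = δ * b := fun σ => by
    by_cases hσ : σ ∈ H
    · obtain ⟨b, hb⟩ := (h.mem_iff σ).1 hσ
      exact ⟨b, fun _ => hb⟩
    · exact ⟨0, fun h' => absurd h' hσ⟩
  have ht : ∀ σ : G, ∃ t, σ ∉ H → δ = gap α δ H σ * α * t := fun σ => by
    by_cases hσ : σ ∈ H
    · exact ⟨0, fun h' => absurd hσ h'⟩
    · obtain ⟨t, ht⟩ := h.gap_mul_dvd hα hσ
      exact ⟨t, fun _ => ht⟩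
  choose b hb using hb
  choose t ht using ht
  let Q : D[X] := ∏ σ : G, if σ ∈ H then X - C (b σ) else 1 + C (α * t σ) * X
  have hQ : f.comp (C α + C δ * X) = C (∏ σ : G, gap α δ H σ) * Q := by
    rw [hf, comp_prod_X_sub, map_prod, ← Finset.prod_mul_distrib]
    refine Finset.prod_congr rfl fun σ _ => ?_
    split_ifs with hσ
    · rw [gap_of_mem hσ, ← neg_sub, hb σ hσ]
      simp only [map_neg, map_mul]
      ring
    · rw [← gap_of_not_mem (δ := δ) hσ]
      conv_lhs => rw [ht σ hσ]
      simp only [gap_of_not_mem hσ, map_mul]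
      ring
  have hQr : Q.map (residue D) = ∏ σ : G with σ ∈ H, (X - C (β σ)) := by
    have hα0 : residue D α = 0 := (residue_eq_zero_iff α).2 (hα.dvd_iff.1 dvd_rfl)
    rw [Polynomial.map_prod, Finset.prod_filter]
    refine Finset.prod_congr rfl fun σ _ => ?_
    split_ifs with hσ
    · simp [hβ, residueQuot_mul_eq h.ne_zero (hb σ hσ)]
    · simp [hα0]
  let κ : D := ∏ σ : G with σ ∈ H ∧ σ ≠ 1, -b σ
  have hκ : residue D κ = ∏ σ : G with σ ∈ H ∧ σ ≠ 1, -β σ := by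
    rw [map_prod]
    refine Finset.prod_congr rfl fun σ hσ => ?_
    have hσ' : σ ∈ H := (by simpa using hσ : σ ∈ H ∧ _).1
    rw [map_neg]
    change -residue D (b σ) = -residueQuot (σ • α - α) δ
    rw [residueQuot_mul_eq h.ne_zero (hb σ hσ')]
  have hκ0 : residue D κ ≠ 0 := hκ ▸ prod_neg_ne_zero hinj hadd
  have hκu : IsUnit κ := (residue_ne_zero_iff_isUnit κ).1 hκ0
  have hgap : (∏ σ : G, gap α δ H σ) * κ = c * α ^ m := by
    rw [← hc, ← Finset.prod_erase_mul _ _ (Finset.mem_univ (1 : G)), gap_of_mem H.one_mem]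
    have : κ = ∏ σ ∈ Finset.univ.erase (1 : G), if σ ∈ H then -b σ else 1 := by
      rw [← Finset.prod_filter]
      refine Finset.prod_congr ?_ fun _ _ => rfl
      ext σ
      simp [and_comm]
    rw [mul_right_comm, this, ← Finset.prod_mul_distrib]
    congr 1
    refine Finset.prod_congr rfl fun σ _ => ?_
    split_ifs with hσ
    · rw [gap_of_mem hσ, ← neg_sub, hb σ hσ, mul_neg]
    · rw [gap_of_not_mem hσ, mul_one]
  obtain ⟨κ', hκ'⟩ := hκu.exists_left_inv
  refine ⟨C (κ' * c) * Q, ?_, ?_⟩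
  · have : (∏ σ : G, gap α δ H σ) = α ^ m * (κ' * c) := by
      rw [← mul_one (∏ σ : G, _), ← hκ']
      linear_combination κ' * hgap
    rw [hQ, this, C_mul, mul_assoc]
  · have hκ'' : residue D κ' = (residue D κ)⁻¹ :=
      eq_inv_of_mul_eq_one_left (by rw [← map_mul, hκ', map_one])
    rw [normalizedPoly_eq, ← hκ, Polynomial.map_mul, hQr, Polynomial.map_C, map_mul, hκ'', C_mul]
    ring

variable (h : IsLastBreak G α δ H) (hα : IsUniformizingGenerator G α)
    (hf : f = ∏ σ : G, (X - C (σ • α))) (hm : Associated (∏ σ : G, gap α δ H σ) (α ^ m))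

open Classical in
lemma gaussRed_dilatationCoord
    {c : D} (hc : (∏ σ ∈ Finset.univ.erase (1 : G), (α - σ • α)) * δ = c * α ^ m) :
    gaussRed h hα hf hm 1 (toNormalization L f α m (dilatationCoord L f α m)) =
      C (residue D c) * normalizedPoly H fun σ => residueQuot (σ • α - α) δ := by
  obtain ⟨P, hP, hPr⟩ := h.exists_comp_eq hα hf hc
  rw [← hPr]
  refine gaussRed_eq h hα hf hm ?_
  rw [one_smul, map_eq_shift_inv_mul (pow_ne_zero m hα.irreducible.ne_zero) hP, map_pow]
  rfl

/-- The reduction on the reduced closed fiber of the normalized dilatation for the Gauss valuation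
centred at `τ α`. -/
def gaussFiber (τ : G) :
    ReducedFiber D (normalization L f α m) →ₐ[ResidueField D] (ResidueField D)[X] :=
  ReducedFiber.lift (gaussRed h hα hf hm τ)

lemma gaussFiber_mkHom (τ : G) (g : normalization L f α m) :
    gaussFiber h hα hf hm τ (ReducedFiber.mkHom D _ g) = gaussRed h hα hf hm τ g :=
  ReducedFiber.lift_mk _ g

lemma eq_zero_of_gaussFiber {x : ReducedFiber D (normalization L f α m)}
    (hx : ∀ τ, gaussFiber h hα hf hm τ x = 0) : x = 0 := by
  obtain ⟨g, rfl⟩ := ReducedFiber.mk_surjective x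
  simp only [gaussFiber_mkHom] at hx
  exact mkHom_eq_zero_of_gaussRed h hα hf hm hx

lemma gaussFiber_of_mem {τ : G} (hτ : τ ∈ H) (x : ReducedFiber D (normalization L f α m)) :
    gaussFiber h hα hf hm τ x =
      (gaussFiber h hα hf hm 1 x).comp (X + C (residueQuot (τ • α - α) δ)) := by
  obtain ⟨g, rfl⟩ := ReducedFiber.mk_surjective x
  rw [gaussFiber_mkHom, gaussFiber_mkHom, gaussRed_of_mem h hα hf hm hτ]

lemma gaussFiber_one_surjective :
    Function.Surjective (gaussFiber (L := L) h hα hf hm 1) := by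
  obtain ⟨g, hg⟩ := exists_gaussRed_eq_X (L := L) h hα hf hm
  intro P
  refine ⟨aeval (ReducedFiber.mkHom D _ g) P, ?_⟩
  rw [← aeval_algHom_apply, gaussFiber_mkHom, hg, aeval_X_left_apply]

/-- If a jointly injective family of homomorphisms to a polynomial ring is constant up to
translations on a subgroup, an element with values `1` on the subgroup and `0` outside is an
idempotent, and it cuts out the kernel of the homomorphism at `1`. -/
lemma idempotent_of_family {A E Γ : Type*} [CommRing A] [CommRing E] [Group Γ]
    {Δ : Subgroup Γ} (ρ : Γ → A →+* E[X]) (hρ : ∀ x, (∀ τ, ρ τ x = 0) → x = 0) (s : Γ → E)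
    (hs : ∀ τ ∈ Δ, ∀ x, ρ τ x = (ρ 1 x).comp (X + C (s τ))) {e : A} (h1 : ρ 1 e = 1)
    (h0 : ∀ τ ∉ Δ, ρ τ e = 0) : e * e = e ∧ ∀ x, ρ 1 x = 0 ↔ e * x = 0 := by
  have hH : ∀ τ ∈ Δ, ρ τ e = 1 := fun τ hτ => by rw [hs τ hτ, h1, one_comp]
  refine ⟨?_, fun x => ⟨fun hx => ?_, fun hx => ?_⟩⟩
  · rw [← sub_eq_zero]
    refine hρ _ fun τ => ?_
    by_cases hτ : τ ∈ Δ
    · rw [map_sub, map_mul, hH τ hτ, mul_one, sub_self]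
    · rw [map_sub, map_mul, h0 τ hτ, mul_zero, sub_self]
  · refine hρ _ fun τ => ?_
    by_cases hτ : τ ∈ Δ
    · rw [map_mul, hs τ hτ x, hx, zero_comp, mul_zero]
    · rw [map_mul, h0 τ hτ, zero_mul]
  · have := congrArg (ρ 1) hx
    rwa [map_mul, h1, one_mul, map_zero] at this

/-- The idempotent of the component of `α`. -/
lemma exists_component_idempotent :
    ∃ e : ReducedFiber D (normalization L f α m), e * e = e ∧
      (∀ x, gaussFiber h hα hf hm 1 x = 0 ↔ e * x = 0) ∧ gaussFiber h hα hf hm 1 e = 1 ∧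
      ∀ τ ∉ H, gaussFiber h hα hf hm τ e = 0 := by
  obtain ⟨g, hg1, hg⟩ := exists_gaussRed_idempotent (L := L) h hα hf hm
  have h1 := (gaussFiber_mkHom h hα hf hm 1 g).trans hg1
  have h0 := fun τ hτ => (gaussFiber_mkHom h hα hf hm τ g).trans (hg τ hτ)
  obtain ⟨he, hker⟩ := idempotent_of_family (fun τ => (gaussFiber h hα hf hm τ).toRingHom)
    (fun x hx => eq_zero_of_gaussFiber h hα hf hm hx) _
    (fun τ hτ x => gaussFiber_of_mem h hα hf hm hτ x) h1 h0
  exact ⟨_, he, hker, h1, h0⟩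

/-- The point defined by the section `X ↦ τ α` is the origin for the reduction centred at `τ α`. -/
lemma point_rootSection {τ : G} (hτ : f.eval (τ • α) = 0) :
    ReducedFiber.point (rootSection (L := L) α m hτ) =
      (aeval (0 : ResidueField D)).comp (gaussFiber h hα hf hm τ) := by
  refine ReducedFiber.algHom_ext fun g => ?_
  obtain ⟨P, hP⟩ := h.exists_map_eq_shift hα hf hm τ g
  rw [AlgHom.comp_apply, gaussFiber_mkHom, gaussRed_eq h hα hf hm hP, ReducedFiber.point_mk]
  have h₁ : rootSection (L := L) α m hτ g = P.eval 0 := by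
    apply IsFractionRing.injective D L
    rw [algebraMap_rootSection, ← Polynomial.eval_map_apply, map_zero, hP, shift_eq_comp]
    simp
  rw [h₁, coe_aeval_eq_eval, ← Polynomial.eval_map_apply, map_zero]

lemma point_rootSection_of_mem {τ : G} (hτH : τ ∈ H) (hτ : f.eval (τ • α) = 0) :
    ReducedFiber.point (rootSection (L := L) α m hτ) =
      (aeval (residueQuot (τ • α - α) δ)).comp (gaussFiber h hα hf hm 1) := by
  rw [point_rootSection h hα hf hm hτ]
  ext x
  rw [AlgHom.comp_apply, AlgHom.comp_apply, gaussFiber_of_mem h hα hf hm hτH, coe_aeval_eq_eval,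
    coe_aeval_eq_eval, eval_comp]
  simp

/-- The component of the section `X ↦ α` meets exactly the sections `X ↦ σ α` for `σ ∈ H`. -/
lemma primeOfPoint_mem_connectedComponent_iff (h : IsLastBreak G α δ H)
    (hα : IsUniformizingGenerator G α) (hf : f = ∏ σ : G, (X - C (σ • α)))
    (hm : Associated (∏ σ : G, gap α δ H σ) (α ^ m)) {τ : G} (hτ : f.eval (τ • α) = 0)
    (h1 : f.eval ((1 : G) • α) = 0) :
    primeOfPoint (ReducedFiber.point (rootSection (L := L) α m hτ)) ∈ connectedComponent
      (primeOfPoint (ReducedFiber.point (rootSection (L := L) α m h1))) ↔ τ ∈ H := by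
  obtain ⟨e, he, hker, he1, he0⟩ := exists_component_idempotent (L := L) h hα hf hm
  rw [connectedComponent_eq_zeroLocus_ker (gaussFiber h hα hf hm 1).toRingHom he hker
    (p := primeOfPoint _) fun x hx => ?_, PrimeSpectrum.mem_zeroLocus]
  · constructor
    · intro hsub
      by_contra hτH
      have h₁ : (1 - e) ∈ RingHom.ker (ReducedFiber.point (rootSection (L := L) α m hτ)) :=
        hsub (by
          change gaussFiber h hα hf hm 1 (1 - e) = 0
          rw [map_sub, map_one, he1, sub_self])
      rw [RingHom.mem_ker, point_rootSection h hα hf hm hτ, AlgHom.comp_apply, map_sub, he0 τ hτH,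
        sub_zero, map_one, map_one] at h₁
      exact one_ne_zero h₁
    · intro hτH x hx
      change ReducedFiber.point (rootSection (L := L) α m hτ) x = 0
      have hx' : gaussFiber h hα hf hm 1 x = 0 := hx
      rw [point_rootSection_of_mem h hα hf hm hτH hτ, AlgHom.comp_apply, hx', map_zero]
  · change ReducedFiber.point (rootSection (L := L) α m h1) x = 0
    have hx' : gaussFiber h hα hf hm 1 x = 0 := hx
    rw [point_rootSection h hα hf hm h1, AlgHom.comp_apply, hx', map_zero]

lemma exists_component_equiv (h : IsLastBreak G α δ H)
    (hα : IsUniformizingGenerator G α) (hf : f = ∏ σ : G, (X - C (σ • α)))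
    (hm : Associated (∏ σ : G, gap α δ H σ) (α ^ m)) (h1 : f.eval ((1 : G) • α) = 0) :
    ∃ Φ : ComponentRing (ReducedFiber.point (rootSection (L := L) α m h1)) ≃ₐ[ResidueField D]
        (ResidueField D)[X],
      ∀ x, Φ (ComponentRing.mk _ x) = gaussFiber h hα hf hm 1 x := by
  obtain ⟨e, he, hker, -, -⟩ := exists_component_idempotent (L := L) h hα hf hm
  refine exists_componentRing_equiv _ (gaussFiber_one_surjective h hα hf hm) he hker fun x hx => ?_
  rw [point_rootSection h hα hf hm h1, AlgHom.comp_apply, hx, map_zero]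

/-- The reduced closed fiber of the dilatation is the affine line with coordinate `f / α ^ m`. -/
lemma aeval_dilatationCoord_bijective (h : IsLastBreak G α δ H)
    (hα : IsUniformizingGenerator G α) (hf : f = ∏ σ : G, (X - C (σ • α)))
    (hm : Associated (∏ σ : G, gap α δ H σ) (α ^ m)) (hm0 : m ≠ 0) :
    Function.Bijective (aeval (R := ResidueField D)
      (ReducedFiber.mk (O := D) (dilatationCoord L f α m))) := by
  classical
  constructor
  -- The composite with the component is a nonconstant polynomial map of the line.
  · have hass := h.associated_prod_gap.symm.trans hm
    obtain ⟨u, hu⟩ := hass.symm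
    have hc : (∏ σ ∈ Finset.univ.erase (1 : G), (α - σ • α)) * δ = u * α ^ m := by
      rw [← hu, mul_comm]
    have hu0 : residue D (u : D) ≠ 0 := (residue_ne_zero_iff_isUnit _).2 u.isUnit
    have hinj := h.residueQuot_injOn hα
    have hadd : ∀ σ ∈ H, ∀ τ ∈ H, residueQuot ((σ * τ) • α - α) δ =
        residueQuot (σ • α - α) δ + residueQuot (τ • α - α) δ := fun σ hσ τ hτ =>
      h.residueQuot_mul hα hσ hτ
    have hcomp : ((gaussFiber h hα hf hm 1).comp (ReducedFiber.map (toNormalization L f α m))).comp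
        (aeval (R := ResidueField D) (ReducedFiber.mk (O := D) (dilatationCoord L f α m))) =
        aeval (C (residue D u) * normalizedPoly H fun σ => residueQuot (σ • α - α) δ) := by
      ext
      rw [AlgHom.comp_apply, AlgHom.comp_apply, aeval_X, aeval_X, ← ReducedFiber.mkHom_apply,
        ReducedFiber.map_mk, gaussFiber_mkHom, gaussRed_dilatationCoord h hα hf hm hc]
    have hinj' := aeval_injective (b := C (residue D (u : D)) *
      normalizedPoly H fun σ => residueQuot (σ • α - α) δ) (by
        rw [natDegree_C_mul hu0, natDegree_normalizedPoly hinj hadd]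
        exact Nat.card_pos)
    rw [← hcomp, AlgHom.coe_comp] at hinj'
    exact Function.Injective.of_comp hinj'
  · set S := ReducedFiber.mk (O := D) (dilatationCoord L f α m) with hS
    let Xd : dilatation L f α m := ⟨X, Algebra.subset_adjoin (by simp)⟩
    have hαL : algebraMap D L α ≠ 0 := by
      simpa using hα.irreducible.ne_zero
    have hα0 : residue D α = 0 := (residue_eq_zero_iff α).2 (hα.dvd_iff.1 dvd_rfl)
    -- The function `X` is nilpotent on the closed fiber, because `∏ (X - σ α) = α ^ m S`.
    have hX0 : ReducedFiber.mkHom D _ Xd = 0 := by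
      apply ReducedFiber.eq_zero_of_isNilpotent
      refine ⟨Fintype.card G, ?_⟩
      have h₁ : ∏ σ : G, (Xd - algebraMap D _ (σ • α)) =
          algebraMap D _ (α ^ m) * dilatationCoord L f α m := by
        apply Subtype.ext
        rw [dilatationCoord]
        have : (((∏ σ : G, (Xd - algebraMap D _ (σ • α)) : dilatation L f α m)) : L[X]) =
            f.map (algebraMap D L) := by
          conv_rhs => rw [hf]
          rw [Polynomial.map_prod, ← Subalgebra.coe_val, map_prod]
          refine Finset.prod_congr rfl fun σ _ => ?_
          simp [Xd, Polynomial.algebraMap_apply]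
        rw [this]
        change _ = algebraMap D L[X] (α ^ m) * (C _ * _)
        rw [Polynomial.algebraMap_apply, ← mul_assoc, ← C_mul, map_pow,
          mul_inv_cancel₀ (pow_ne_zero _ hαL), C_1, one_mul]
      have h₂ := congrArg (ReducedFiber.mkHom D _) h₁
      rw [map_prod, map_mul, ReducedFiber.mkHom_algebraMap, map_pow, hα0, zero_pow hm0, map_zero,
        zero_mul] at h₂
      rw [← h₂, ← Finset.card_univ, ← Finset.prod_const]
      refine Finset.prod_congr rfl fun σ _ => ?_
      have : residue D (σ • α) = 0 := (residue_eq_zero_iff _).2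
        (hα.dvd_iff.1 ((dvd_smul_iff hα.irreducible σ).2 dvd_rfl))
      rw [map_sub, ReducedFiber.mkHom_algebraMap, this, map_zero, sub_zero]
    intro x
    obtain ⟨⟨g, hg⟩, rfl⟩ := ReducedFiber.mk_surjective x
    change _ ∈ (aeval (R := ResidueField D) S).range
    induction hg using Algebra.adjoin_induction with
    | mem y hy =>
      rcases hy with rfl | rfl
      · exact hX0 ▸ Subalgebra.zero_mem _
      · exact ⟨X, aeval_X S⟩
    | algebraMap c =>
      have := ReducedFiber.mkHom_algebraMap (S := dilatation L f α m) c
      exact this ▸ Subalgebra.algebraMap_mem _ _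
    | add y z hy hz h₁ h₂ =>
      have := map_add (ReducedFiber.mkHom D (dilatation L f α m)) ⟨y, hy⟩ ⟨z, hz⟩
      exact this ▸ Subalgebra.add_mem _ h₁ h₂
    | mul y z hy hz h₁ h₂ =>
      have := map_mul (ReducedFiber.mkHom D (dilatation L f α m)) ⟨y, hy⟩ ⟨z, hz⟩
      exact this ▸ Subalgebra.mul_mem _ h₁ h₂

end GaussFiber

/-! ### Graded pieces -/

section Graded

variable {O : Type*} [CommRing O] {I : Ideal O} {i : ℕ}

lemma Gr.mk_surjective : Function.Surjective (Gr.mk : ↥(I ^ i) → Gr I i) :=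
  Submodule.Quotient.mk_surjective _

lemma Gr.mk_eq_zero_iff {x : ↥(I ^ i)} : Gr.mk x = 0 ↔ (x : O) ∈ I ^ (i + 1) := by
  refine ⟨fun hx => ?_, Gr.mk_eq_zero⟩
  rw [Gr.mk, Submodule.Quotient.mk_eq_zero] at hx
  have : (x : O) ∈ (I • ⊤ : Submodule O ↥(I ^ i)).map (I ^ i).subtype := ⟨x, hx, rfl⟩
  rw [Submodule.map_smul''] at this
  rw [pow_succ']
  simpa using this

lemma Gr.mk_add (x y : ↥(I ^ i)) : Gr.mk (x + y) = Gr.mk x + Gr.mk y := rfl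

lemma Gr.mk_sub (x y : ↥(I ^ i)) : Gr.mk (x - y) = Gr.mk x - Gr.mk y := rfl

lemma Gr.mk_smul (c : O) (x : ↥(I ^ i)) : Gr.mk (c • x) = c • Gr.mk x := rfl

lemma Gr.mk_sum {κ : Type*} (s : Finset κ) (x : κ → ↥(I ^ i)) :
    Gr.mk (∑ j ∈ s, x j) = ∑ j ∈ s, Gr.mk (x j) :=
  map_sum (Submodule.mkQ (I • ⊤ : Submodule O ↥(I ^ i))) x s

lemma Gr.mk_eq_mk_iff {x y : ↥(I ^ i)} : Gr.mk x = Gr.mk y ↔ (x - y : O) ∈ I ^ (i + 1) := by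
  rw [← sub_eq_zero, ← Gr.mk_sub, Gr.mk_eq_zero_iff]
  rfl

lemma Gr.residue_smul [IsLocalRing O] (c : O) (x : ↥(maximalIdeal O ^ i)) :
    residue O c • Gr.mk x = Gr.mk (c • x) := rfl

lemma mem_higherUnits_iff {x : Oˣ} : x ∈ higherUnits I i ↔ (x : O) - 1 ∈ I ^ i := by
  refine ⟨sub_one_mem, fun hx => ?_⟩
  rw [higherUnits, MonoidHom.mem_ker, Units.ext_iff]
  rw [← Ideal.Quotient.eq_zero_iff_mem, map_sub, sub_eq_zero] at hx
  simpa using hx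

lemma unitsToGr_mk (hi : 0 < i) (x : ↥(higherUnits I i)) :
    unitsToGr I hi (GrUnits.mk x) = Multiplicative.ofAdd (Gr.mk ⟨((x : Oˣ) : O) - 1, sub_one_mem x.2⟩) :=
  rfl

lemma GrUnits.mk_surjective : Function.Surjective (GrUnits.mk : ↥(higherUnits I i) → _) :=
  QuotientGroup.mk_surjective

lemma unitsToGr_bijective (hi : 0 < i) (hI : ∀ x ∈ I, IsUnit (1 + x)) :
    Function.Bijective (unitsToGr I hi) := by
  constructor
  · rw [injective_iff_map_eq_one]
    intro ξ hξ
    obtain ⟨x, rfl⟩ := GrUnits.mk_surjective ξ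
    rw [unitsToGr_mk, ofAdd_eq_one, Gr.mk_eq_zero_iff] at hξ
    exact (QuotientGroup.eq_one_iff x).2 (Subgroup.mem_subgroupOf.2 (mem_higherUnits_iff.2 hξ))
  · intro w
    obtain ⟨⟨x, hx⟩, hw⟩ := Gr.mk_surjective w.toAdd
    obtain ⟨u, hu⟩ := hI x (Ideal.pow_le_self hi.ne' hx)
    have hu' : (u : O) - 1 = x := by rw [hu]; ring
    refine ⟨GrUnits.mk ⟨u, mem_higherUnits_iff.2 (hu' ▸ hx)⟩, ?_⟩
    rw [unitsToGr_mk]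
    apply Multiplicative.toAdd.injective
    rw [toAdd_ofAdd, ← hw]
    congr 1
    exact Subtype.ext hu'

end Graded

section Line

variable {D : Type*} [CommRing D] [IsDomain D] [IsDiscreteValuationRing D] {k : ℕ}

lemma isUnit_one_add_of_mem {O : Type*} [CommRing O] [IsLocalRing O] {x : O}
    (hx : x ∈ maximalIdeal O) : IsUnit (1 + x) := by
  by_contra hu
  have := (maximalIdeal O).sub_mem ((mem_maximalIdeal _).2 hu) hx
  rw [add_sub_cancel_right] at this
  exact (Ideal.ne_top_iff_one _).1 (maximalIdeal.isMaximal O).ne_top this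

/-- The graded piece `𝔪 ^ k / 𝔪 ^ (k + 1)` is a line spanned by any of its nonzero elements. -/
lemma Gr.exists_eq_smul {v : Gr (maximalIdeal D) k} (hv : v ≠ 0) (w : Gr (maximalIdeal D) k) :
    ∃ c : ResidueField D, w = c • v := by
  obtain ⟨π, hπ⟩ := IsDiscreteValuationRing.exists_irreducible D
  obtain ⟨⟨x, hx⟩, rfl⟩ := Gr.mk_surjective v
  obtain ⟨⟨y, hy⟩, rfl⟩ := Gr.mk_surjective w
  rw [ne_eq, Gr.mk_eq_zero_iff] at hv
  have hpow : ∀ j, maximalIdeal D ^ j = Ideal.span {π ^ j} := fun j => by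
    rw [hπ.maximalIdeal_eq, Ideal.span_singleton_pow]
  obtain ⟨u, rfl⟩ := Ideal.mem_span_singleton.1 (hpow k ▸ hx)
  obtain ⟨z, rfl⟩ := Ideal.mem_span_singleton.1 (hpow k ▸ hy)
  have hu : IsUnit u := by
    by_contra hu
    refine hv ?_
    rw [hpow, Ideal.mem_span_singleton, pow_succ]
    exact mul_dvd_mul_left _ (Ideal.mem_span_singleton.1
      (hπ.maximalIdeal_eq ▸ (mem_maximalIdeal u).2 hu))
  obtain ⟨u', hu'⟩ := hu.exists_left_inv
  refine ⟨residue D (z * u'), ?_⟩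
  rw [Gr.residue_smul]
  congr 1
  apply Subtype.ext
  change π ^ k * z = (z * u') * (π ^ k * u)
  linear_combination (-π ^ k * z) * hu'

end Line

/-! ### Norm and trace for a group with a single ramification jump -/

section FixedRing

variable {D G A : Type*} [CommRing D] [IsDomain D] [IsDiscreteValuationRing D] [Group G]
  [MulSemiringAction G D] [CommRing A] [Algebra A D] {α : D} {i : ℕ}

/-- `A` is the ring of `G`-invariant elements of `D`. -/
structure IsFixedRing (G A D : Type*) [CommRing D] [Group G] [MulSemiringAction G D] [CommRing A]
    [Algebra A D] : Prop where
  injective : Function.Injective (algebraMap A D)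
  smul_algebraMap : ∀ (σ : G) (a : A), σ • algebraMap A D a = algebraMap A D a
  exists_eq : ∀ x : D, (∀ σ : G, σ • x = x) → ∃ a : A, algebraMap A D a = x

/-- The contraction to `A` of the maximal ideal of `D`. -/
abbrev contractedIdeal (A D : Type*) [CommRing A] [CommRing D] [IsLocalRing D] [Algebra A D] :
    Ideal A :=
  (maximalIdeal D).comap (algebraMap A D)

lemma IsFixedRing.exists_mul_eq (hA : IsFixedRing G A D) {a b : A} (hb : algebraMap A D b ≠ 0)
    (h : algebraMap A D b ∣ algebraMap A D a) : b ∣ a := by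
  obtain ⟨c, hc⟩ := h
  have hcf : ∀ σ : G, σ • c = c := fun σ => by
    have := congrArg (σ • ·) hc
    simp only [smul_mul', hA.smul_algebraMap] at this
    exact mul_left_cancel₀ hb (this.symm.trans hc)
  obtain ⟨c', rfl⟩ := hA.exists_eq c hcf
  exact ⟨c', hA.injective (by rw [hc, map_mul])⟩

lemma IsFixedRing.isUnit_one_add (hA : IsFixedRing G A D) {a : A}
    (ha : a ∈ contractedIdeal A D) : IsUnit (1 + a) := by
  have hu : IsUnit (algebraMap A D (1 + a)) := by
    rw [map_add, map_one]
    exact isUnit_one_add_of_mem ha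
  refine isUnit_of_dvd_one (hA.exists_mul_eq hu.ne_zero ?_)
  rw [map_one]
  exact hu.dvd

variable [Fintype G]

/-- The ring of invariants is a discrete valuation ring over which `D` is totally ramified. -/
lemma IsFixedRing.mem_pow_iff (hA : IsFixedRing G A D) (h : HasSingleBreak G α i)
    (hα : IsUniformizingGenerator G α) {s : ℕ} {a : A} :
    a ∈ contractedIdeal A D ^ s ↔ α ^ (Fintype.card G * s) ∣ algebraMap A D a := by
  obtain ⟨π, hπ⟩ := hA.exists_eq _ (smul_prod_smul (G := G) α)
  have hass : Associated (algebraMap A D π) (α ^ Fintype.card G) :=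
    hπ ▸ associated_prod_smul G hα.irreducible
  have hne : ∀ t, algebraMap A D (π ^ t) ≠ 0 := fun t => by
    rw [map_pow]
    exact pow_ne_zero t (hass.ne_zero_iff.2 (pow_ne_zero _ hα.irreducible.ne_zero))
  have hspan : contractedIdeal A D = Ideal.span {π} := by
    ext a
    rw [Ideal.mem_span_singleton, Ideal.mem_comap, ← hα.dvd_iff]
    constructor
    · intro ha
      refine hA.exists_mul_eq (by simpa using hne 1) (hass.dvd_iff_dvd_left.2 ?_)
      have := h.fixed_dvd hα (k := 0) (fun σ => hA.smul_algebraMap σ a) (by simpa using ha)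
      simpa using this
    · rintro ⟨b, rfl⟩
      rw [map_mul]
      exact ((dvd_pow_self α Fintype.card_ne_zero).trans hass.symm.dvd).mul_right _
  rw [hspan, Ideal.span_singleton_pow, Ideal.mem_span_singleton]
  have h2 : Associated (algebraMap A D (π ^ s)) (α ^ (Fintype.card G * s)) := by
    rw [map_pow, pow_mul]
    exact hass.pow_pow
  rw [← h2.dvd_iff_dvd_left]
  exact ⟨fun hd => map_dvd _ hd, fun hd => hA.exists_mul_eq (hne s) hd⟩

lemma smul_sum_smul (x : D) (σ : G) : σ • ∑ τ : G, τ • x = ∑ τ : G, τ • x := by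
  rw [Finset.smul_sum]
  simp only [← mul_smul]
  exact Fintype.sum_equiv (Equiv.mulLeft σ) _ _ fun _ => rfl

/-- The trace induces an isomorphism between the graded pieces at the ramification jump. -/
lemma IsFixedRing.exists_trace (hA : IsFixedRing G A D) (h : HasSingleBreak G α i)
    (hα : IsUniformizingGenerator G α) :
    ∃ T : Gr (maximalIdeal D) i ≃+ Gr (contractedIdeal A D) i,
      ∀ (x : ↥(maximalIdeal D ^ i)) (y : ↥(contractedIdeal A D ^ i)),
        algebraMap A D y = ∑ σ : G, σ • (x : D) → T (Gr.mk x) = Gr.mk y := by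
  have htr : ∀ x : ↥(maximalIdeal D ^ i), ∃ y : ↥(contractedIdeal A D ^ i),
      algebraMap A D y = ∑ σ : G, σ • (x : D) := fun x => by
    obtain ⟨y, hy⟩ := hA.exists_eq _ (smul_sum_smul (G := G) (x : D))
    refine ⟨⟨y, (hA.mem_pow_iff h hα).2 ?_⟩, hy⟩
    rw [hy]
    exact h.dvd_sum_smul hα (Nat.le_succ i) (hα.mem_pow_iff.1 x.2)
  choose tr htr using htr
  have hwd : ∀ x x' : ↥(maximalIdeal D ^ i), ∀ y y' : ↥(contractedIdeal A D ^ i),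
      algebraMap A D y = ∑ σ : G, σ • (x : D) → algebraMap A D y' = ∑ σ : G, σ • (x' : D) →
      Gr.mk x = Gr.mk x' → Gr.mk y = Gr.mk y' := by
    intro x x' y y' hy hy' hxx'
    rw [Gr.mk_eq_mk_iff, hα.mem_pow_iff] at hxx'
    rw [Gr.mk_eq_mk_iff, hA.mem_pow_iff h hα, map_sub, hy, hy', ← Finset.sum_sub_distrib]
    simp only [← smul_sub]
    exact h.dvd_sum_smul hα le_rfl hxx'
  let F : Gr (maximalIdeal D) i → Gr (contractedIdeal A D) i := fun w =>
    Gr.mk (tr (Function.surjInv Gr.mk_surjective w))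
  have hF : ∀ (x : ↥(maximalIdeal D ^ i)) (y : ↥(contractedIdeal A D ^ i)), algebraMap A D y = ∑ σ : G, σ • (x : D) → F (Gr.mk x) = Gr.mk y :=
    fun x y hy => hwd _ _ _ _ (htr _) hy (Function.surjInv_eq Gr.mk_surjective _)
  have hadd : ∀ v w, F (v + w) = F v + F w := fun v w => by
    obtain ⟨x, rfl⟩ := Gr.mk_surjective v
    obtain ⟨x', rfl⟩ := Gr.mk_surjective w
    rw [← Gr.mk_add, hF x _ (htr x), hF x' _ (htr x'), ← Gr.mk_add]
    refine hF _ _ ?_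
    change algebraMap A D (tr x + tr x' : A) = ∑ σ : G, σ • ((x : D) + x')
    rw [map_add, htr, htr, ← Finset.sum_add_distrib]
    simp only [smul_add]
  have hsurj : Function.Surjective F := fun w => by
    obtain ⟨y, rfl⟩ := Gr.mk_surjective w
    obtain ⟨x, hx, hxy⟩ := h.exists_sum_smul_eq hα le_rfl
      (fun σ => hA.smul_algebraMap σ (y : A)) ((hA.mem_pow_iff h hα).1 y.2)
    exact ⟨Gr.mk ⟨x, hα.mem_pow_iff.2 hx⟩, hF _ _ hxy.symm⟩
  have hinj : Function.Injective F := by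
    -- An element of the kernel which is not zero spans the line over the residue field of the
    -- ring of invariants; then `F` vanishes.
    refine (injective_iff_map_eq_zero (AddMonoidHom.mk' F hadd)).2 fun v hv => ?_
    by_contra hv0
    obtain ⟨x, rfl⟩ := Gr.mk_surjective v
    have hzero : ∀ w, F w = 0 := fun w => by
      obtain ⟨c, rfl⟩ := Gr.exists_eq_smul hv0 w
      obtain ⟨c, rfl⟩ := residue_surjective c
      obtain ⟨b, hb, hcb⟩ := hα.exists_fixed c
      obtain ⟨b, rfl⟩ := hA.exists_eq b hb
      have hcb' : residue D c = residue D (algebraMap A D b) := by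
        rw [← sub_eq_zero, ← map_sub, residue_eq_zero_iff, ← hα.dvd_iff]
        exact hcb
      rw [hcb', Gr.residue_smul, hF _ (b • tr x)]
      · have : Gr.mk (tr x) = 0 := (hF x _ (htr x)).symm.trans hv
        rw [Gr.mk_smul, this, smul_zero]
      · change algebraMap A D (b * tr x : A) = ∑ σ : G, σ • (algebraMap A D b * (x : D))
        simp only [smul_mul', hA.smul_algebraMap, ← Finset.mul_sum, map_mul, htr]
    obtain ⟨π, hπ⟩ := hA.exists_eq _ (smul_prod_smul (G := G) α)
    have hass : Associated (algebraMap A D (π ^ i)) (α ^ (Fintype.card G * i)) := by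
      rw [map_pow, pow_mul, hπ]
      exact (associated_prod_smul G hα.irreducible).pow_pow
    obtain ⟨w, hw⟩ := hsurj (Gr.mk ⟨π ^ i, (hA.mem_pow_iff h hα).2 hass.symm.dvd⟩)
    rw [hzero, eq_comm, Gr.mk_eq_zero_iff, hA.mem_pow_iff h hα, hass.dvd_iff_dvd_right] at hw
    have := (pow_dvd_pow_iff hα.irreducible.ne_zero hα.irreducible.not_isUnit).1 hw
    have hc : 0 < Fintype.card G := Fintype.card_pos
    rw [mul_add, mul_one] at this
    omega
  exact ⟨AddEquiv.ofBijective (AddMonoidHom.mk' F hadd) ⟨hinj, hsurj⟩, hF⟩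

lemma HasSingleBreak.dvd_prod_one_add_sub_one (h : HasSingleBreak G α i)
    (hα : IsUniformizingGenerator G α) {s : ℕ} (hi : i ≤ s) (hs : s ≤ i + 1) {y : D}
    (hy : α ^ s ∣ y) : α ^ (Fintype.card G * s) ∣ ∏ σ : G, σ • (1 + y) - 1 := by
  have : ∏ σ : G, σ • (1 + y) = (∏ σ : G, (1 + X * C (σ • y))).eval 1 := by
    simp [eval_prod]
  rw [this, eval_eq_sum_range, Finset.sum_range_succ', coeff_zero_prod_one_add]
  simp only [one_pow, mul_one, add_sub_cancel_right]
  exact Finset.dvd_sum fun j _ => h.dvd_coeff_prod hα hi hs hy (Nat.succ_ne_zero j)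

/-- The norm induces a homomorphism between the graded pieces of the groups of units at the
ramification jump. -/
lemma IsFixedRing.exists_norm (hA : IsFixedRing G A D) (h : HasSingleBreak G α i)
    (hα : IsUniformizingGenerator G α) :
    ∃ N : GrUnits (maximalIdeal D) i →* GrUnits (contractedIdeal A D) i,
      ∀ x : ↥(higherUnits (maximalIdeal D) i), ∃ y : ↥(higherUnits (contractedIdeal A D) i),
        algebraMap A D ((y : Aˣ) : A) = ∏ σ : G, σ • ((x : Dˣ) : D) ∧
        N (GrUnits.mk x) = GrUnits.mk y := by
  have hnm : ∀ x : Dˣ, ∃ y : Aˣ, algebraMap A D (y : A) = ∏ σ : G, σ • (x : D) := fun x => by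
    obtain ⟨y, hy⟩ := hA.exists_eq _ (smul_prod_smul (G := G) (x : D))
    have hu : IsUnit (algebraMap A D y) := by
      rw [hy]
      exact Finset.prod_induction _ IsUnit (fun _ _ => IsUnit.mul) isUnit_one
        fun σ _ => x.isUnit.map (MulSemiringAction.toRingHom G D σ)
    have hy' : IsUnit y := isUnit_of_dvd_one (hA.exists_mul_eq hu.ne_zero (by
      rw [map_one]
      exact hu.dvd))
    exact ⟨hy'.unit, hy⟩
  choose nm hnm using hnm
  let Nm : Dˣ →* Aˣ := MonoidHom.mk' nm fun x x' => by
    apply Units.ext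
    apply hA.injective
    rw [hnm, Units.val_mul, Units.val_mul, map_mul, hnm, hnm, ← Finset.prod_mul_distrib]
    simp only [smul_mul']
  have hNm : ∀ s, i ≤ s → s ≤ i + 1 → ∀ x ∈ higherUnits (maximalIdeal D) s,
      Nm x ∈ higherUnits (contractedIdeal A D) s := fun s hs hs' x hx => by
    rw [mem_higherUnits_iff, hα.mem_pow_iff] at hx
    rw [mem_higherUnits_iff, hA.mem_pow_iff h hα, map_sub, map_one]
    have := h.dvd_prod_one_add_sub_one hα hs hs' hx
    rwa [add_sub_cancel, ← hnm] at this
  let N' : ↥(higherUnits (maximalIdeal D) i) →* ↥(higherUnits (contractedIdeal A D) i) :=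
    (Nm.comp (Subgroup.subtype _)).codRestrict _ fun x => hNm i le_rfl (Nat.le_succ i) _ x.2
  refine ⟨QuotientGroup.map _ _ N' fun x hx => hNm (i + 1) (Nat.le_succ i) le_rfl _ hx,
    fun x => ⟨N' x, hnm x, rfl⟩⟩

end FixedRing

/-! ### The norm as an additive polynomial -/

section NormPolynomial

variable {D G A : Type*} [CommRing D] [IsDomain D] [IsDiscreteValuationRing D] [Group G]
  [MulSemiringAction G D] [CommRing A] [Algebra A D] {α δ : D} {i : ℕ} {H : Subgroup G}
  [Fintype G] [Fintype H]

/-- The inverse of the trace is linear over the fixed ring. -/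
lemma symm_smul_of_trace (hA : IsFixedRing H A D)
    {T : Gr (maximalIdeal D) i ≃+ Gr (contractedIdeal A D) i}
    (hT : ∀ (x : ↥(maximalIdeal D ^ i)), ∃ (y : ↥(contractedIdeal A D ^ i)),
      algebraMap A D y = ∑ σ : H, σ • (x : D))
    (hT' : ∀ (x : ↥(maximalIdeal D ^ i)) (y : ↥(contractedIdeal A D ^ i)),
      algebraMap A D y = ∑ σ : H, σ • (x : D) → T (Gr.mk x) = Gr.mk y)
    (b : A) (w : Gr (contractedIdeal A D) i) :
    T.symm (b • w) = residue D (algebraMap A D b) • T.symm w := by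
  rw [AddEquiv.symm_apply_eq]
  obtain ⟨v, rfl⟩ := T.surjective w
  rw [AddEquiv.symm_apply_apply]
  obtain ⟨x, rfl⟩ := Gr.mk_surjective v
  obtain ⟨y, hy⟩ := hT x
  rw [hT' x y hy, Gr.residue_smul, ← Gr.mk_smul]
  refine (hT' _ _ ?_).symm
  change algebraMap A D (b * y : A) = ∑ σ : H, σ • (algebraMap A D b * (x : D))
  simp only [smul_mul', hA.smul_algebraMap, ← Finset.mul_sum, map_mul, hy]

/-- The norm of a unit congruent to `σ(α) / α` modulo `𝔪 ^ (i + 1)` is close to `1`, as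
the norm of `σ(α) / α` is `1`. -/
lemma HasSingleBreak.dvd_prod_sub_one_of_dvd (h : HasSingleBreak H α i)
    (hα : IsUniformizingGenerator H α) {x : D} (σ : H)
    (hx : α ^ (i + 2) ∣ x * α - σ • α) :
    α ^ (Fintype.card H * (i + 1)) ∣ ∏ τ : H, τ • x - 1 := by
  have hσα : Associated (σ • α) α := associated_smul hα.irreducible σ α
  obtain ⟨t, ht, hxt⟩ : ∃ t, α ^ (i + 1) ∣ t ∧ x * α = σ • α * (1 + t) := by
    obtain ⟨s, hs⟩ := hx
    obtain ⟨v, hv⟩ := hσα.dvd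
    refine ⟨v * (α ^ (i + 1) * s), (dvd_mul_right _ _).mul_left _, ?_⟩
    rw [pow_succ] at hs
    linear_combination hs + α ^ (i + 1) * s * hv
  have hne : ∏ τ : H, τ • α ≠ 0 :=
    (associated_prod_smul H hα.irreducible).ne_zero_iff.2 (pow_ne_zero _ hα.irreducible.ne_zero)
  have h₁ : ∏ τ : H, τ • σ • α = ∏ τ : H, τ • α := by
    simp only [← mul_smul]
    exact Fintype.prod_equiv (Equiv.mulRight σ) _ _ fun _ => rfl
  have h₂ : ∏ τ : H, τ • x = ∏ τ : H, τ • (1 + t) := by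
    refine mul_right_cancel₀ hne ?_
    rw [← Finset.prod_mul_distrib]
    simp only [← smul_mul', hxt]
    simp only [smul_mul', Finset.prod_mul_distrib, h₁]
    exact mul_comm _ _
  rw [h₂]
  exact h.dvd_prod_one_add_sub_one hα (Nat.le_succ i) le_rfl ht

/-- The coefficients of `∏ (1 + X σ(y)) - 1` as elements of the `i`-th power of the maximal ideal
of the ring of invariants. -/
lemma IsFixedRing.exists_coeff (hA : IsFixedRing G A D) (h : HasSingleBreak G α i)
    (hα : IsUniformizingGenerator G α) (y : ↥(maximalIdeal D ^ i)) :
    ∃ c : ℕ →₀ ↥(contractedIdeal A D ^ i), (∀ j, algebraMap A D (c j) =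
      (∏ σ : G, (1 + X * C (σ • (y : D))) - 1).coeff j) ∧
      c.support ⊆ Finset.range (Fintype.card G + 1) := by
  have hc : ∀ j, ∃ c : ↥(contractedIdeal A D ^ i), algebraMap A D c =
      (∏ σ : G, (1 + X * C (σ • (y : D))) - 1).coeff j := fun j => by
    rcases eq_or_ne j 0 with rfl | hj
    · refine ⟨0, ?_⟩
      rw [coeff_sub, coeff_zero_prod_one_add]
      simp
    · have h0 : (1 : D[X]).coeff j = 0 := by rw [coeff_one, if_neg hj]
      rw [coeff_sub, h0, sub_zero]
      obtain ⟨c, hc⟩ := hA.exists_eq _ (smul_coeff_prod_one_add (G := G) (y : D) j)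
      refine ⟨⟨c, (hA.mem_pow_iff h hα).2 ?_⟩, hc⟩
      rw [hc]
      exact h.dvd_coeff_prod hα le_rfl (Nat.le_succ i) (hα.mem_pow_iff.1 y.2) hj
  choose c hc using hc
  refine ⟨Finsupp.onFinset (Finset.range (Fintype.card G + 1)) c fun j hj => ?_, hc,
    Finsupp.support_onFinset_subset⟩
  by_contra hlt
  refine hj (Subtype.ext (hA.injective ?_))
  rw [hc, ZeroMemClass.coe_zero, map_zero]
  refine coeff_eq_zero_of_natDegree_lt ?_
  have := natDegree_sub_le (∏ σ : G, (1 + X * C (σ • (y : D)))) 1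
  rw [natDegree_one, Nat.max_zero] at this
  have := this.trans (natDegree_prod_one_add_le (G := G) (y : D))
  rw [Finset.mem_range] at hlt
  omega

/-- In terms of the coordinate given by `δ / α`, the norm `y ↦ N(1 + y) - 1`, followed by the
inverse of the trace, is the additive polynomial: it is a polynomial of degree at most the order
of `H`, tangent to the identity, and it vanishes at the points `σ(α) / α - 1`. -/
lemma IsLastBreak.sum_coeff_eq (h : IsLastBreak G α δ H) (hα : IsUniformizingGenerator G α)
    (hi : Associated δ (α ^ (i + 1))) (hA : IsFixedRing H A D)
    {T : Gr (maximalIdeal D) i ≃+ Gr (contractedIdeal A D) i}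
    (hT : ∀ (x : ↥(maximalIdeal D ^ i)), ∃ (y : ↥(contractedIdeal A D ^ i)),
      algebraMap A D y = ∑ σ : H, σ • (x : D))
    (hT' : ∀ (x : ↥(maximalIdeal D ^ i)) (y : ↥(contractedIdeal A D ^ i)),
      algebraMap A D y = ∑ σ : H, σ • (x : D) → T (Gr.mk x) = Gr.mk y)
    {d : ↥(maximalIdeal D ^ i)} (hd : (d : D) * α = δ)
    {y : ↥(maximalIdeal D ^ i)} {l : ResidueField D} (hl : Gr.mk y = l • Gr.mk d)
    {c : ℕ →₀ ↥(contractedIdeal A D ^ i)}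
    (hc : ∀ j, algebraMap A D (c j) = (∏ σ : H, (1 + X * C (σ • (y : D))) - 1).coeff j)
    (hcs : c.support ⊆ Finset.range (Fintype.card H + 1))
    (ℓ : Module.Dual (ResidueField D) (Gr (maximalIdeal D) i)) :
    (c.sum fun j z => C (ℓ (T.symm (Gr.mk z))) * X ^ j) = C (ℓ (Gr.mk d)) *
      (normalizedPoly H fun σ => residueQuot (σ • α - α) δ).comp (C l * X) := by
  have hαH := hα.subgroup H
  have hsb := h.hasSingleBreak hi
  have hinj := h.residueQuot_injOn hα
  have hadd : ∀ σ ∈ H, ∀ τ ∈ H, residueQuot ((σ * τ) • α - α) δ =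
      residueQuot (σ • α - α) δ + residueQuot (τ • α - α) δ := fun σ hσ τ hτ =>
    h.residueQuot_mul hα hσ hτ
  have hα0 := hα.irreducible.ne_zero
  have hdi : ¬ α ^ (i + 1) ∣ (d : D) := fun hdvd => by
    have := mul_dvd_mul_right hdvd α
    rw [hd, ← pow_succ, hi.dvd_iff_dvd_right, pow_dvd_pow_iff hα0 hα.irreducible.not_isUnit] at this
    omega
  have hd0 : Gr.mk d ≠ 0 := by
    rw [ne_eq, Gr.mk_eq_zero_iff, hα.mem_pow_iff]
    exact hdi
  have hsum : (c.sum fun j z => C (ℓ (T.symm (Gr.mk z))) * X ^ j) =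
      ∑ j ∈ Finset.range (Fintype.card H + 1), C (ℓ (T.symm (Gr.mk (c j)))) * X ^ j := by
    refine Finsupp.sum_of_support_subset _ hcs _ fun j _ => ?_
    have : (Gr.mk 0 : Gr (contractedIdeal A D) i) = 0 := rfl
    rw [this]
    simp
  have hc0 : ∀ j, j ≠ 0 → (1 : D[X]).coeff j = 0 := fun j hj => by rw [coeff_one, if_neg hj]
  rw [hsum]
  rcases eq_or_ne l 0 with rfl | hl0
  · have hy : α ^ (i + 1) ∣ (y : D) := by
      rwa [zero_smul, Gr.mk_eq_zero_iff, hα.mem_pow_iff] at hl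
    have hcz : ∀ j, Gr.mk (c j) = 0 := fun j => by
      rw [Gr.mk_eq_zero_iff, hA.mem_pow_iff hsb hαH, hc, coeff_sub]
      rcases eq_or_ne j 0 with rfl | hj
      · rw [coeff_zero_prod_one_add, coeff_one_zero, sub_self]
        exact dvd_zero _
      · rw [hc0 j hj, sub_zero]
        exact hsb.dvd_coeff_prod hαH (Nat.le_succ i) le_rfl hy hj
    have hb := eval_normalizedPoly (β := fun σ => residueQuot (σ • α - α) δ) H.one_mem
    rw [map_one_of_additive (β := fun σ => residueQuot (σ • α - α) δ) hadd] at hb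
    rw [map_zero, zero_mul, comp_zero, hb, map_zero, mul_zero]
    refine Finset.sum_eq_zero fun j _ => ?_
    rw [hcz, map_zero, map_zero, map_zero, zero_mul]
  · have hp : ∀ j, ∃ p : ResidueField D, T.symm (Gr.mk (c j)) = p • Gr.mk d := fun j =>
      Gr.exists_eq_smul hd0 _
    choose p hp using hp
    let P : (ResidueField D)[X] := ∑ j ∈ Finset.range (Fintype.card H + 1), C (p j) * X ^ j
    have hP : ∀ j ∈ Finset.range (Fintype.card H + 1), P.coeff j = p j := fun j hj => by
      simp only [P, finsetSum_coeff, coeff_C_mul_X_pow]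
      rw [Finset.sum_ite_eq, if_pos hj]
    have hPl : P = (normalizedPoly H fun σ => residueQuot (σ • α - α) δ).comp (C l * X) := by
      refine eq_normalizedPoly_comp hinj hadd hl0 ?_ ?_ fun σ hσ => ?_
      · rw [Nat.card_eq_fintype_card]
        refine natDegree_sum_le_of_forall_le _ _ fun j hj => ?_
        exact (natDegree_C_mul_X_pow_le _ _).trans (Nat.lt_succ_iff.1 (Finset.mem_range.1 hj))
      · have hcard : 0 < Fintype.card H := Fintype.card_pos
        rw [hP 1 (Finset.mem_range.2 (by omega))]
        have h₁ : T (Gr.mk y) = Gr.mk (c 1) := hT' _ _ (by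
          rw [hc, coeff_sub, coeff_one_prod_one_add, hc0 1 one_ne_zero, sub_zero])
        have h₂ := hp 1
        rw [← h₁, AddEquiv.symm_apply_apply, hl] at h₂
        exact (smul_left_injective _ hd0 h₂).symm
      · obtain ⟨b', hb'⟩ := residue_surjective (l⁻¹ * residueQuot (σ • α - α) δ)
        obtain ⟨b'', hbf, hbb⟩ := hαH.exists_fixed b'
        obtain ⟨b, rfl⟩ := hA.exists_eq b'' hbf
        have hb : residue D (algebraMap A D b) = l⁻¹ * residueQuot (σ • α - α) δ := by
          rw [← hb', eq_comm, ← sub_eq_zero, ← map_sub, residue_eq_zero_iff, ← hα.dvd_iff]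
          exact hbb
        rw [← hb]
        have h₁ : P.eval (residue D (algebraMap A D b)) • Gr.mk d =
            T.symm (Gr.mk (∑ j ∈ Finset.range (Fintype.card H + 1), b ^ j • c j)) := by
          rw [Gr.mk_sum, map_sum, eval_finsetSum, Finset.sum_smul]
          refine Finset.sum_congr rfl fun j _ => ?_
          rw [Gr.mk_smul, symm_smul_of_trace hA hT hT', hp, smul_smul, eval_mul, eval_C, eval_pow,
            eval_X, map_pow, map_pow, mul_comm]
        obtain ⟨s, hs⟩ := (h.mem_iff σ).1 hσ
        have hs' := residueQuot_mul_eq h.ne_zero hs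
        have h₂ : α ^ (i + 1) ∣ algebraMap A D b * y - s * d := by
          have : Gr.mk (algebraMap A D b • y) = Gr.mk (s • d) := by
            rw [← Gr.residue_smul, ← Gr.residue_smul, hl, smul_smul, hb, ← hs', mul_right_comm,
              inv_mul_cancel₀ hl0, one_mul]
          rwa [Gr.mk_eq_mk_iff, hα.mem_pow_iff] at this
        have h₃ := hsb.dvd_prod_sub_one_of_dvd hαH (x := 1 + algebraMap A D b * y) ⟨σ, hσ⟩ (by
          obtain ⟨t, ht⟩ := h₂
          refine ⟨t, ?_⟩
          change _ - σ • α = _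
          rw [← hd] at hs
          linear_combination α * ht - hs)
        have h₄ : Gr.mk (∑ j ∈ Finset.range (Fintype.card H + 1), b ^ j • c j) = 0 := by
          rw [Gr.mk_eq_zero_iff, hA.mem_pow_iff hsb hαH]
          convert h₃ using 1
          have hev : ∏ τ : H, τ • (1 + algebraMap A D b * (y : D)) - 1 =
              (∏ σ : H, (1 + X * C (σ • (y : D))) - 1).eval (algebraMap A D b) := by
            simp only [eval_sub, eval_prod, eval_add, eval_one, eval_mul, eval_X, eval_C, smul_add,
              smul_one, smul_mul', hA.smul_algebraMap]
          rw [hev, eval_eq_sum_range' (n := Fintype.card H + 1)]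
          · simp only [AddSubmonoidClass.coe_finsetSum, map_sum, SetLike.val_smul, smul_eq_mul,
              map_mul, hc, map_pow]
            exact Finset.sum_congr rfl fun j _ => mul_comm _ _
          · have := natDegree_sub_le (∏ σ : H, (1 + X * C (σ • (y : D)))) 1
            rw [natDegree_one, Nat.max_zero] at this
            have := this.trans (natDegree_prod_one_add_le (G := H) (y : D))
            omega
        rw [h₄, map_zero] at h₁
        exact (smul_eq_zero.1 h₁).resolve_right hd0
    rw [← hPl, Finset.mul_sum]
    refine Finset.sum_congr rfl fun j _ => ?_
    rw [hp, map_smul, smul_eq_mul, C_mul, ← mul_assoc, mul_comm (C (p j))]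

end NormPolynomial

/-! ### The Galois group acting on the ring of integers -/

section Galois

variable (OK K OL L : Type*) [CommRing OK] [IsDomain OK] [IsDiscreteValuationRing OK]
    [Field K] [Algebra OK K] [IsFractionRing OK K]
    [Field L] [Algebra K L] [FiniteDimensional K L] [IsGalois K L]
    [CommRing OL] [IsDomain OL] [IsDiscreteValuationRing OL]
    [Algebra OK OL] [Algebra OL L] [IsFractionRing OL L] [Algebra OK L] [IsScalarTower OK K L]
    [IsScalarTower OK OL L] [IsIntegralClosure OL OK L]

/-- The action of the Galois group on the ring of integers. -/
abbrev galoisAction : MulSemiringAction Gal(L/K) OL :=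
  MulSemiringAction.compHom OL (galRestrict OK K L OL).toMonoidHom

variable {K OL L}

lemma algebraMap_act (σ : Gal(L/K)) (x : OL) :
    algebraMap OL L (act OK OL σ x) = σ (algebraMap OL L x) :=
  algebraMap_galRestrict_apply OK σ x

/-- A uniformizer generates the ring of integers of a totally ramified extension. -/
lemma adjoin_uniformizer_eq_top [Module.Finite OK OL] {n : ℕ}
    (hram : (maximalIdeal OK).map (algebraMap OK OL) = maximalIdeal OL ^ n)
    (hres : Function.Surjective (algebraMap OK (ResidueField OL)))
    {α : OL} (hα : Irreducible α) : Algebra.adjoin OK {α} = ⊤ := by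
  have hstep : ∀ (j : ℕ) (x : OL), ∃ s ∈ Algebra.adjoin OK {α}, α ^ j ∣ x - s := by
    intro j x
    induction j with
    | zero => exact ⟨0, Subalgebra.zero_mem _, by simp⟩
    | succ j ih =>
      obtain ⟨s, hs, y, hy⟩ := ih
      obtain ⟨a, ha⟩ := hres (residue OL y)
      have hya : α ∣ y - algebraMap OK OL a := by
        rw [← Ideal.mem_span_singleton, ← hα.maximalIdeal_eq, ← residue_eq_zero_iff, map_sub, ← ha,
          sub_eq_zero]
        exact IsScalarTower.algebraMap_apply OK OL (ResidueField OL) a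
      obtain ⟨t, ht⟩ := hya
      refine ⟨s + α ^ j * algebraMap OK OL a, Subalgebra.add_mem _ hs (Subalgebra.mul_mem _
        (Subalgebra.pow_mem _ (Algebra.subset_adjoin (Set.mem_singleton α)) j)
        (Subalgebra.algebraMap_mem _ a)), t, ?_⟩
      linear_combination hy + α ^ j * ht
  have hle : (⊤ : Submodule OK OL) ≤ Subalgebra.toSubmodule (Algebra.adjoin OK {α}) := by
    refine Submodule.le_of_le_smul_of_le_jacobson_bot (I := maximalIdeal OK) Module.Finite.fg_top
      (maximalIdeal_le_jacobson _) fun x _ => ?_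
    obtain ⟨s, hs, hxs⟩ := hstep n x
    rw [← add_sub_cancel s x]
    refine Submodule.add_mem_sup hs ?_
    rw [Ideal.smul_top_eq_map, hram, hα.maximalIdeal_eq, Ideal.span_singleton_pow]
    exact Ideal.mem_span_singleton.2 hxs
  exact eq_top_iff.2 hle

lemma isUniformizingGenerator_galois {n : ℕ}
    (hram : (maximalIdeal OK).map (algebraMap OK OL) = maximalIdeal OL ^ n)
    (hres : Function.Surjective (algebraMap OK (ResidueField OL)))
    {α : OL} (hα : Irreducible α) :
    letI := galoisAction OK K OL L
    IsUniformizingGenerator Gal(L/K) α := by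
  let _ := galoisAction OK K OL L
  have hfin : Module.Finite OK OL := IsIntegralClosure.finite OK K L OL
  have htop := adjoin_uniformizer_eq_top OK hram hres hα
  refine ⟨hα, fun x => ?_, fun σ hσ => ?_⟩
  · have hx : x ∈ Algebra.adjoin OK {α} := htop ▸ Algebra.mem_top
    rw [Algebra.adjoin_singleton_eq_range_aeval] at hx
    obtain ⟨P, rfl⟩ := hx
    refine ⟨P.map (algebraMap OK OL), fun σ j => ?_, ?_⟩
    · rw [coeff_map]
      exact (galRestrict OK K L OL σ).commutes _
    · rw [eval_map_algebraMap]
      rfl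
  · have h₁ : ∀ x : OL, galRestrict OK K L OL σ x = x := fun x => by
      have hx : x ∈ Algebra.adjoin OK {α} := htop ▸ Algebra.mem_top
      induction hx using Algebra.adjoin_induction with
      | mem y hy => rw [Set.mem_singleton_iff.1 hy]; exact hσ
      | algebraMap a => exact AlgEquiv.commutes _ a
      | add y z _ _ h₁ h₂ => rw [map_add, h₁, h₂]
      | mul y z _ _ h₁ h₂ => rw [map_mul, h₁, h₂]
    exact (galRestrict OK K L OL).injective (by
      rw [map_one]
      exact AlgEquiv.ext h₁)

lemma minpolyOL_eq_prod {α : OL}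
    (hα : letI := galoisAction OK K OL L; IsUniformizingGenerator Gal(L/K) α) :
    minpolyOL OK α = ∏ σ : Gal(L/K), (X - C (act OK OL σ α)) := by
  let _ := galoisAction OK K OL L
  have hint : IsIntegral OK α := IsIntegralClosure.isIntegral OK L α
  have hinj : Function.Injective fun σ : Gal(L/K) => act OK OL σ α := hα.smul_injective
  have hmon : (minpolyOL OK α).Monic := (minpoly.monic hint).map _
  refine eq_of_monic_of_dvd_of_natDegree_le (monic_prod_of_monic _ _ fun _ _ => monic_X_sub_C _)
    hmon ?_ ?_
  · have h₁ : (Finset.univ.val.map fun σ : Gal(L/K) => act OK OL σ α) ≤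
        (minpolyOL OK α).roots := by
      rw [Multiset.le_iff_subset (Multiset.Nodup.map hinj Finset.univ.nodup)]
      intro x hx
      obtain ⟨σ, -, rfl⟩ := Multiset.mem_map.1 hx
      exact (mem_roots hmon.ne_zero).2 (eval_act OK α σ)
    have := (Multiset.prod_X_sub_C_dvd_iff_le_roots hmon.ne_zero _).2 h₁
    rwa [Multiset.map_map] at this
  · rw [natDegree_finsetProd_X_sub_C_eq_card, Finset.card_univ, ← Nat.card_eq_fintype_card,
      IsGalois.card_aut_eq_finrank, (minpoly.monic hint).natDegree_map]
    have h₁ := minpoly.isIntegrallyClosed_eq_field_fractions K L hint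
    rw [← (minpoly.monic hint).natDegree_map (algebraMap OK K), ← h₁]
    exact minpoly.natDegree_le _

lemma mem_lowerGroup_iff {α : OL}
    (hα : letI := galoisAction OK K OL L; IsUniformizingGenerator Gal(L/K) α) {j : ℕ}
    {σ : Gal(L/K)} : σ ∈ lowerGroup OK K OL L j ↔ α ^ (j + 1) ∣ act OK OL σ α - α := by
  let _ := galoisAction OK K OL L
  rw [mem_lowerGroup]
  constructor
  · intro h
    exact hα.mem_pow_iff.1 (h α)
  · intro h x
    exact hα.mem_pow_iff.2 (h.trans (hα.sub_dvd' σ x))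

lemma lowerGroup_zero {α : OL}
    (hα : letI := galoisAction OK K OL L; IsUniformizingGenerator Gal(L/K) α) :
    lowerGroup OK K OL L 0 = ⊤ := by
  let _ := galoisAction OK K OL L
  refine eq_top_iff.2 fun σ _ => (mem_lowerGroup_iff OK hα).2 ?_
  rw [zero_add, pow_one]
  exact dvd_sub ((associated_smul hα.irreducible σ α).symm.dvd) dvd_rfl

/-! ### Norm and trace to the ring of integers of the fixed field of a subgroup -/

variable (H : Subgroup Gal(L/K))

lemma isFixedRing_integers :
    letI := galoisAction OK K OL L
    IsFixedRing H (integers OK OL (IntermediateField.fixedField H)) OL := by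
  let _ := galoisAction OK K OL L
  refine ⟨Subtype.val_injective, fun σ a => ?_, fun x hx => ?_⟩
  · apply IsFractionRing.injective OL L
    exact (algebraMap_act OK (σ : Gal(L/K)) (a : OL)).trans (a.2 σ)
  · refine ⟨⟨x, fun σ => ?_⟩, rfl⟩
    change (σ : Gal(L/K)) (algebraMap OL L x) = algebraMap OL L x
    rw [← algebraMap_act OK]
    exact congrArg _ (hx σ)

lemma algebraMap_norm_fixedField [Fintype H] (x : L) :
    algebraMap (IntermediateField.fixedField H) L
      (Algebra.norm (IntermediateField.fixedField H) x) = ∏ σ : H, (σ : Gal(L/K)) x := by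
  rw [Algebra.norm_eq_prod_automorphisms]
  exact (Fintype.prod_equiv (IntermediateField.subgroupEquivAlgEquiv H).toEquiv _ _
    fun σ => rfl).symm

lemma algebraMap_trace_fixedField [Fintype H] (x : L) :
    algebraMap (IntermediateField.fixedField H) L
      (Algebra.trace (IntermediateField.fixedField H) L x) = ∑ σ : H, (σ : Gal(L/K)) x := by
  rw [trace_eq_sum_automorphisms]
  exact (Fintype.sum_equiv (IntermediateField.subgroupEquivAlgEquiv H).toEquiv _ _
    fun σ => rfl).symm

/-- The norm of `1 + X y` after extension of scalars to polynomials. -/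
lemma map_norm_one_add_X_tmul {M L : Type*} [Field M] [Field L] [Algebra M L]
    [FiniteDimensional M L] [Infinite M] {κ : Type*} [Fintype κ] (s : κ → L →ₐ[M] L)
    (hs : ∀ x : L, algebraMap M L (Algebra.norm M x) = ∏ σ, s σ x) (y : L) :
    (Algebra.norm M[X] (1 + X ⊗ₜ y : M[X] ⊗[M] L)).map (algebraMap M L) =
      ∏ σ, (1 + X * C (s σ y)) := by
  classical
  let b := Module.finBasis M L
  have h₁ : Algebra.leftMulMatrix (b.baseChange M[X]) (1 + X ⊗ₜ y : M[X] ⊗[M] L) =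
      1 + (X : M[X]) • (Algebra.leftMulMatrix b y).map C := by
    rw [map_add, map_one]
    congr 1
    ext1 j l
    rw [Algebra.leftMulMatrix_eq_repr_mul, Module.Basis.baseChange_apply,
      Algebra.TensorProduct.tmul_mul_tmul, mul_one, Module.Basis.baseChange_repr_tmul,
      Matrix.smul_apply, Matrix.map_apply, Algebra.leftMulMatrix_eq_repr_mul, smul_eq_mul,
      Algebra.smul_def, mul_comm]
    rfl
  have h₂ : ∀ x : M, (Algebra.norm M[X] (1 + X ⊗ₜ y : M[X] ⊗[M] L)).eval x =
      Algebra.norm M (1 + x • y) := fun x => by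
    have h₃ : Algebra.leftMulMatrix b (1 + x • y) = 1 + x • Algebra.leftMulMatrix b y := by
      rw [map_add, map_one, map_smul]
    rw [Algebra.norm_eq_matrix_det (b.baseChange M[X]), h₁, Algebra.norm_eq_matrix_det b,
      ← coe_evalRingHom, RingHom.map_det]
    congr 1
    ext1 j l
    rw [h₃, RingHom.mapMatrix_apply, Matrix.map_apply, Matrix.add_apply,
      Matrix.add_apply, Matrix.smul_apply, Matrix.smul_apply, Matrix.map_apply, smul_eq_mul,
      smul_eq_mul, coe_evalRingHom, eval_add, eval_mul, eval_X, eval_C, Matrix.one_apply,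
      Matrix.one_apply, apply_ite (eval x), eval_one, eval_zero]
  refine eq_of_infinite_eval_eq _ _ ((Set.infinite_range_of_injective
    (FaithfulSMul.algebraMap_injective M L)).mono ?_)
  rintro _ ⟨x, rfl⟩
  rw [Set.mem_ofPred_eq, eval_map_algebraMap, aeval_algebraMap_apply, coe_aeval_eq_eval, h₂, hs,
    eval_prod]
  refine Finset.prod_congr rfl fun σ _ => ?_
  rw [map_add, map_one, map_smul, Algebra.smul_def, eval_add, eval_one, eval_mul, eval_X, eval_C]

end Galois

/-! ### The last ramification jump -/

section Jump

variable {D G : Type*} [CommRing D] [IsDomain D] [IsDiscreteValuationRing D] [Group G]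
  [MulSemiringAction G D] [Fintype G] {α : D}

lemma roots_prod_X_sub_C_apply {R κ : Type*} [CommRing R] [IsDomain R] (s : Finset κ)
    (x : κ → R) : (∏ l ∈ s, (X - C (x l))).roots = s.val.map x := by
  have := roots_multiset_prod_X_sub_C (s.val.map x)
  rw [Multiset.map_map] at this
  exact this

/-- The penultimate root in an enumeration of the conjugates of `α` by increasing distance. -/
lemma IsUniformizingGenerator.exists_penultimate (hα : IsUniformizingGenerator G α) {n : ℕ}
    {a : ℕ → D} (hf : ∏ σ : G, (X - C (σ • α)) = ∏ j ∈ Finset.Icc 1 n, (X - C (a j)))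
    (han : a n = α) (hmono : ∀ i j, 1 ≤ i → i ≤ j → j ≤ n →
      IsDiscreteValuationRing.addVal D (a i - a n) ≤ IsDiscreteValuationRing.addVal D (a j - a n))
    {σ₁ : G} (hσ₁ : σ₁ ≠ 1) :
    ∃ σ₀ : G, σ₀ ≠ 1 ∧ a (n - 1) = σ₀ • α ∧ ∀ σ : G, σ ≠ 1 → σ • α - α ∣ a (n - 1) - a n := by
  have hroots : (Finset.univ.val.map fun σ : G => σ • α) = (Finset.Icc 1 n).val.map a := by
    have := congrArg Polynomial.roots hf
    rwa [roots_prod_X_sub_C_apply, roots_prod_X_sub_C_apply] at this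
  have hnd : ((Finset.Icc 1 n).val.map a).Nodup :=
    hroots ▸ Multiset.Nodup.map hα.smul_injective Finset.univ.nodup
  have hinj : ∀ i ∈ Finset.Icc 1 n, ∀ j ∈ Finset.Icc 1 n, a i = a j → i = j :=
    fun i hi j hj h => Multiset.inj_on_of_nodup_map hnd i hi j hj h
  have h₁ : ∀ σ : G, ∃ j ∈ Finset.Icc 1 n, a j = σ • α := fun σ => by
    have : σ • α ∈ (Finset.Icc 1 n).val.map a :=
      hroots ▸ Multiset.mem_map_of_mem _ (Finset.mem_univ σ)
    simpa using this
  have h₂ : ∀ j ∈ Finset.Icc 1 n, ∃ σ : G, a j = σ • α := fun j hj => by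
    have : a j ∈ Finset.univ.val.map fun σ : G => σ • α :=
      hroots ▸ Multiset.mem_map_of_mem a hj
    obtain ⟨σ, -, h⟩ := Multiset.mem_map.1 this
    exact ⟨σ, h.symm⟩
  have h₃ : ∀ σ : G, σ ≠ 1 → ∃ j, 1 ≤ j ∧ j ≤ n - 1 ∧ a j = σ • α := fun σ hσ => by
    obtain ⟨j, hj, h⟩ := h₁ σ
    rw [Finset.mem_Icc] at hj
    refine ⟨j, hj.1, ?_, h⟩
    have : j ≠ n := by
      rintro rfl
      exact hσ (hα.eq_one σ (by rw [← h, han]))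
    omega
  obtain ⟨j, hj1, hjn, -⟩ := h₃ σ₁ hσ₁
  have hn1 : n - 1 ∈ Finset.Icc 1 n := Finset.mem_Icc.2 ⟨by omega, by omega⟩
  obtain ⟨σ₀, hσ₀⟩ := h₂ (n - 1) hn1
  refine ⟨σ₀, ?_, hσ₀, fun σ hσ => ?_⟩
  · rintro rfl
    rw [one_smul, ← han] at hσ₀
    have := hinj _ hn1 n (Finset.mem_Icc.2 ⟨by omega, le_rfl⟩) hσ₀
    omega
  · obtain ⟨l, hl1, hln, hl⟩ := h₃ σ hσ
    rw [← hl, ← han, ← IsDiscreteValuationRing.addVal_le_iff_dvd]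
    rw [han, ← han]
    exact hmono l (n - 1) hl1 hln (by omega)

end Jump

section RamificationGroups

variable (OK K OL L : Type*) [CommRing OK] [IsDomain OK] [IsDiscreteValuationRing OK]
    [Field K] [Algebra OK K] [IsFractionRing OK K]
    [Field L] [Algebra K L] [FiniteDimensional K L] [IsGalois K L]
    [CommRing OL] [IsDomain OL] [IsDiscreteValuationRing OL]
    [Algebra OK OL] [Algebra OL L] [IsFractionRing OL L] [Algebra OK L] [IsScalarTower OK K L]
    [IsScalarTower OK OL L] [IsIntegralClosure OL OK L]

variable {OL} in
/-- The last nontrivial ramification group in the lower numbering, in terms of the maximal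
order of `σ(α) - α`. -/
lemma lowerGroup_isLastBreak {α δ : OL}
    (hα : letI := galoisAction OK K OL L; IsUniformizingGenerator Gal(L/K) α)
    {σ₀ : Gal(L/K)} (hσ₀ : σ₀ ≠ 1) (hδ : δ = act OK OL σ₀ α - α)
    (hdvd : ∀ σ : Gal(L/K), σ ≠ 1 → act OK OL σ α - α ∣ δ)
    {i : ℕ} (hi : 0 < i) (hgr : IsGreatest {j : ℕ | lowerGroup OK K OL L j ≠ ⊥} i) :
    letI := galoisAction OK K OL L
    Associated δ (α ^ (i + 1)) ∧ IsLastBreak Gal(L/K) α δ (lowerGroup OK K OL L i) := by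
  let _ := galoisAction OK K OL L
  have hirr := hα.irreducible
  have hδ0 : δ ≠ 0 := fun h => hσ₀ (hα.eq_one σ₀ (sub_eq_zero.1 (hδ ▸ h)))
  have hdi : α ^ (i + 1) ∣ δ := by
    obtain ⟨σ, hσ, hσ1⟩ := (lowerGroup OK K OL L i).bot_or_exists_ne_one.resolve_left hgr.1
    exact ((mem_lowerGroup_iff OK hα).1 hσ).trans (hdvd _ hσ1)
  have hdi' : ¬ α ^ (i + 2) ∣ δ := fun h => by
    have hmem : σ₀ ∈ lowerGroup OK K OL L (i + 1) := (mem_lowerGroup_iff OK hα).2 (hδ ▸ h)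
    have hne : lowerGroup OK K OL L (i + 1) ≠ ⊥ := fun hbot => by
      rw [hbot, Subgroup.mem_bot] at hmem
      exact hσ₀ hmem
    exact absurd (hgr.2 hne) (by omega)
  have hass : Associated δ (α ^ (i + 1)) := by
    obtain ⟨e, he⟩ := IsDiscreteValuationRing.associated_pow_irreducible hδ0 hirr
    rw [he.dvd_iff_dvd_right, pow_dvd_pow_iff hirr.ne_zero hirr.not_isUnit] at hdi hdi'
    have : e = i + 1 := by omega
    exact this ▸ he
  refine ⟨hass, hδ0, (pow_dvd_pow α (by omega)).trans hdi, fun σ => ?_, hdvd⟩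
  rw [mem_lowerGroup_iff OK hα, hass.dvd_iff_dvd_left]
  rfl

lemma card_lowerGroup_pos (j : ℕ) : (0 : ℚ) < Nat.card (lowerGroup OK K OL L j) := by
  exact_mod_cast Nat.card_pos

lemma herbrand_natCast (j : ℕ) : herbrand OK K OL L j =
    (∑ l ∈ Finset.Icc 1 j, (Nat.card (lowerGroup OK K OL L l) : ℚ)) /
      Nat.card (lowerGroup OK K OL L 0) := by
  simp [herbrand]

lemma herbrand_strictMonoOn : StrictMonoOn (herbrand OK K OL L) (Set.Ici 0) := by
  intro u hu v hv huv
  have hu0 : (0 : ℚ) ≤ u := hu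
  have hv0 : (0 : ℚ) ≤ v := hv
  rw [herbrand, herbrand]
  refine div_lt_div_of_pos_right ?_ (card_lowerGroup_pos OK K OL L 0)
  have hg := card_lowerGroup_pos OK K OL L
  have hfl : ⌊u⌋₊ ≤ ⌊v⌋₊ := Nat.floor_le_floor huv.le
  rcases hfl.eq_or_lt with heq | hlt
  · rw [heq]
    have := mul_lt_mul_of_pos_right (sub_lt_sub_right huv (⌊v⌋₊ : ℚ)) (hg (⌊v⌋₊ + 1))
    linarith
  · have h₁ : u - ⌊u⌋₊ < 1 := by
      have := Nat.lt_floor_add_one u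
      linarith
    have h₂ := mul_lt_mul_of_pos_right h₁ (hg (⌊u⌋₊ + 1))
    have h₃ : ∑ j ∈ Finset.Icc 1 (⌊u⌋₊ + 1), (Nat.card (lowerGroup OK K OL L j) : ℚ) ≤
        ∑ j ∈ Finset.Icc 1 ⌊v⌋₊, (Nat.card (lowerGroup OK K OL L j) : ℚ) :=
      Finset.sum_le_sum_of_subset_of_nonneg (Finset.Icc_subset_Icc le_rfl hlt)
        fun j _ _ => (hg j).le
    rw [Finset.sum_Icc_succ_top (by omega)] at h₃
    have h₄ : 0 ≤ (v - ⌊v⌋₊) * Nat.card (lowerGroup OK K OL L (⌊v⌋₊ + 1)) :=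
      mul_nonneg (sub_nonneg.2 (Nat.floor_le hv0)) (hg _).le
    linarith

lemma upperGroupCl_herbrand {u : ℚ} (hu : 0 ≤ u) :
    upperGroupCl OK K OL L (herbrand OK K OL L u) = lowerGroup OK K OL L ⌈u⌉₊ := by
  refine le_antisymm (iSup₂_le fun u' hu' => ?_) (le_iSup₂_of_le u ⟨hu, rfl⟩ le_rfl)
  rw [(herbrand_strictMonoOn OK K OL L).injOn hu'.1 hu hu'.2]

lemma exists_of_upperGroupCl_ne_bot {v : ℚ} (h : upperGroupCl OK K OL L v ≠ ⊥) :
    ∃ u, 0 ≤ u ∧ herbrand OK K OL L u = v := by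
  by_contra hu
  push Not at hu
  exact h (eq_bot_iff.2 (iSup₂_le fun u' hu' => absurd hu'.2 (hu u' hu'.1)))

/-- The last upper ramification jump is the image by the Herbrand function of the last lower
ramification jump. -/
lemma exists_lower_of_isGreatest_upper {r : ℚ} (hr : 1 < r)
    (h : IsGreatest {s : ℚ | 1 < s ∧ upperGroup OK K OL L s ≠ ⊥} r) :
    ∃ i : ℕ, 0 < i ∧ IsGreatest {j : ℕ | lowerGroup OK K OL L j ≠ ⊥} i ∧
      upperGroup OK K OL L r = lowerGroup OK K OL L i ∧ r - 1 = herbrand OK K OL L i := by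
  have hmono := herbrand_strictMonoOn OK K OL L
  obtain ⟨u, hu0, hu⟩ := exists_of_upperGroupCl_ne_bot OK K OL L h.1.2
  have h0 : herbrand OK K OL L 0 = 0 := by simpa using herbrand_natCast OK K OL L 0
  have hu0' : 0 < u := by
    refine hu0.lt_of_ne ?_
    rintro rfl
    linarith
  have hup : ∀ j : ℕ, lowerGroup OK K OL L j ≠ ⊥ → (j : ℚ) ≤ u := fun j hj => by
    by_contra! hlt
    have hlt' := hmono hu0 (Nat.cast_nonneg j : (0 : ℚ) ≤ j) hlt
    have : 1 + herbrand OK K OL L j ≤ r := by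
      refine h.2 ⟨by linarith, ?_⟩
      rw [upperGroup, add_sub_cancel_left, upperGroupCl_herbrand _ _ _ _ (Nat.cast_nonneg j),
        Nat.ceil_natCast]
      exact hj
    linarith
  have hG : upperGroup OK K OL L r = lowerGroup OK K OL L ⌈u⌉₊ := by
    rw [upperGroup, ← hu, upperGroupCl_herbrand _ _ _ _ hu0]
  have hne : lowerGroup OK K OL L ⌈u⌉₊ ≠ ⊥ := hG ▸ h.1.2
  have hceil : (⌈u⌉₊ : ℚ) = u := le_antisymm (hup _ hne) (Nat.le_ceil u)
  refine ⟨⌈u⌉₊, Nat.ceil_pos.2 hu0', ⟨hne, fun j hj => ?_⟩, hG, by rw [hceil, hu]⟩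
  exact_mod_cast (hup j hj).trans hceil.ge

variable {OL} in
open Classical in
/-- The order of the different, in terms of the orders of the ramification groups. -/
lemma associated_prod_sub_mul {α δ : OL}
    (hα : letI := galoisAction OK K OL L; IsUniformizingGenerator Gal(L/K) α) {i : ℕ}
    (hδ : Associated δ (α ^ (i + 1)))
    (hdvd : ∀ σ : Gal(L/K), σ ≠ 1 → act OK OL σ α - α ∣ δ) :
    Associated ((∏ σ ∈ Finset.univ.erase (1 : Gal(L/K)), (α - act OK OL σ α)) * δ)
      (α ^ (Nat.card Gal(L/K) +
        ∑ j ∈ Finset.Icc 1 i, Nat.card (lowerGroup OK K OL L j))) := by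
  let _ := galoisAction OK K OL L
  have hirr := hα.irreducible
  have hv : ∀ σ : Gal(L/K), ∃ e : ℕ, σ ≠ 1 → Associated (act OK OL σ α - α) (α ^ e) := fun σ => by
    by_cases hσ : σ = 1
    · exact ⟨0, fun h => absurd hσ h⟩
    · obtain ⟨e, he⟩ := IsDiscreteValuationRing.associated_pow_irreducible (x := act OK OL σ α - α)
        (fun h => hσ (hα.eq_one σ (sub_eq_zero.1 h))) hirr
      exact ⟨e, fun _ => he⟩
  choose e he using hv
  have hle : ∀ σ, σ ≠ 1 → e σ ≤ i + 1 := fun σ hσ => by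
    have := hdvd σ hσ
    rwa [(he σ hσ).dvd_iff_dvd_left, hδ.dvd_iff_dvd_right,
      pow_dvd_pow_iff hirr.ne_zero hirr.not_isUnit] at this
  have hmem : ∀ σ, σ ≠ 1 → ∀ j, σ ∈ lowerGroup OK K OL L j ↔ j < e σ := fun σ hσ j => by
    rw [mem_lowerGroup_iff OK hα, (he σ hσ).dvd_iff_dvd_right,
      pow_dvd_pow_iff hirr.ne_zero hirr.not_isUnit]
    rfl
  have hcard : ∀ j, Nat.card (lowerGroup OK K OL L j) =
      (∑ σ ∈ Finset.univ.erase (1 : Gal(L/K)), if j < e σ then 1 else 0) + 1 := fun j => by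
    rw [Nat.card_eq_fintype_card, Fintype.card_subtype, Finset.card_filter,
      ← Finset.sum_erase_add _ _ (Finset.mem_univ (1 : Gal(L/K))), if_pos (one_mem _)]
    congr 1
    refine Finset.sum_congr rfl fun σ hσ => ?_
    simp only [hmem σ (Finset.ne_of_mem_erase hσ) j]
  have hsum : ∑ σ ∈ Finset.univ.erase (1 : Gal(L/K)), e σ + (i + 1) =
      Nat.card Gal(L/K) + ∑ j ∈ Finset.Icc 1 i, Nat.card (lowerGroup OK K OL L j) := by
    have h₁ : Nat.card Gal(L/K) + ∑ j ∈ Finset.Icc 1 i, Nat.card (lowerGroup OK K OL L j) =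
        ∑ j ∈ Finset.range (i + 1), Nat.card (lowerGroup OK K OL L j) := by
      have h₀ : Nat.card (lowerGroup OK K OL L 0) = Nat.card Gal(L/K) := by
        rw [lowerGroup_zero OK hα, Subgroup.card_top]
      rw [Finset.sum_range_succ', h₀, add_comm]
      congr 1
      rw [Finset.range_eq_Ico, Finset.sum_Ico_add' (fun j => Nat.card (lowerGroup OK K OL L j)) 0 i 1]
      rfl
    rw [h₁]
    simp only [hcard, Finset.sum_add_distrib, Finset.sum_const, Finset.card_range, smul_eq_mul,
      mul_one]
    rw [Finset.sum_comm]
    congr 1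
    refine Finset.sum_congr rfl fun σ hσ => ?_
    rw [← Finset.card_filter]
    have : (Finset.range (i + 1)).filter (fun j => j < e σ) = Finset.range (e σ) := by
      ext j
      have := hle σ (Finset.ne_of_mem_erase hσ)
      simp only [Finset.mem_filter, Finset.mem_range]
      omega
    rw [this, Finset.card_range]
  rw [← hsum, pow_add, ← Finset.prod_pow_eq_pow_sum]
  refine Associated.mul_mul (Associated.prod _ _ _ fun σ hσ => ?_) hδ
  rw [← neg_sub]
  exact (Associated.neg_left (he σ (Finset.ne_of_mem_erase hσ)))

end RamificationGroups

section Different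

variable {D : Type*} [CommRing D]

lemma eval_derivative_prod_X_sub_C {κ : Type*} [DecidableEq κ] (s : Finset κ) (x : κ → D) {j : κ}
    (hj : j ∈ s) : (∏ l ∈ s, (X - C (x l))).derivative.eval (x j) =
      ∏ l ∈ s.erase j, (x j - x l) := by
  rw [← Finset.mul_prod_erase s _ hj, derivative_mul, eval_add, eval_mul, eval_mul, derivative_sub,
    derivative_X, derivative_C, eval_sub, eval_sub, eval_X, eval_C, eval_prod]
  simp

end Different

/-! ### The graded pieces of the unit groups -/

section VectorPoint

variable {k V : Type*} [Field k] [AddCommGroup V] [Module k V]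

lemma vectorPoint_smul_X (l : k) (v : V) :
    vectorPoint (l • v) (X : k[X]) = (aeval (C l * X)).comp (vectorPoint v (X : k[X])) := by
  refine SymmetricAlgebra.algHom_ext (LinearMap.ext fun ℓ => ?_)
  change vectorPoint (l • v) X (coord ℓ) = aeval (C l * X) (vectorPoint v X (coord ℓ))
  rw [vectorPoint_coord, vectorPoint_coord, map_smul, map_smul, aeval_X, smul_eq_mul,
    smul_eq_C_mul, smul_eq_C_mul, C_mul]
  ring

lemma vectorPoint_smul_one (l : k) (v : V) :
    vectorPoint (l • v) (1 : k) = (aeval l).comp (vectorPoint v (X : k[X])) := by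
  ext ℓ
  simp [vectorPoint, mul_comm]

lemma vectorPoint_one (v : V) :
    vectorPoint v (1 : k) = (aeval (1 : k)).comp (vectorPoint v (X : k[X])) := by
  simpa using vectorPoint_smul_one (1 : k) v

/-- In a coordinate, an endomorphism of a line is given by any polynomial. -/
lemma exists_comp_eq_aeval_comp {v : V}
    (hv : Function.Bijective (vectorPoint (k := k) v (X : k[X])))
    (b : k[X]) : ∃ ν : Coord k V →ₐ[k] Coord k V,
      (vectorPoint v (X : k[X])).comp ν = (aeval b).comp (vectorPoint v (X : k[X])) := by
  let e := AlgEquiv.ofBijective _ hv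
  refine ⟨e.symm.toAlgHom.comp ((aeval b).comp (vectorPoint v X)), AlgHom.ext fun x => ?_⟩
  exact e.apply_symm_apply _

end VectorPoint

section UnitGroups

lemma infinite_of_isDiscreteValuationRing (O : Type*) [CommRing O] [IsDomain O]
    [IsDiscreteValuationRing O] : Infinite O := by
  by_contra h
  rw [not_infinite_iff_finite] at h
  exact IsDiscreteValuationRing.not_isField O (Finite.isField_of_domain O)

section Coefficients

variable {D G A : Type*} [CommRing D] [IsDomain D] [IsDiscreteValuationRing D] [Group G]
  [MulSemiringAction G D] [CommRing A] [Algebra A D] {i : ℕ} [Fintype G]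

lemma IsFixedRing.eq_sum_coeff (hA : IsFixedRing G A D) {x : D} {z : A}
    (hz : algebraMap A D z = ∏ σ : G, σ • x) (y : ↥(maximalIdeal D ^ i)) (hy : (y : D) = x - 1)
    {c : ℕ →₀ ↥(contractedIdeal A D ^ i)}
    (hc : ∀ j, algebraMap A D (c j) = (∏ σ : G, (1 + X * C (σ • (y : D))) - 1).coeff j) (w : ↥(contractedIdeal A D ^ i))
    (hw : (w : A) = z - 1) : w = ∑ j ∈ Finset.range (Fintype.card G + 1), c j := by
  apply Subtype.ext
  apply hA.injective
  have hev : ∏ σ : G, σ • x - 1 = (∏ σ : G, (1 + X * C (σ • (y : D))) - 1).eval 1 := by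
    simp [eval_prod, hy, smul_sub]
  rw [hw, map_sub, hz, map_one, hev, eval_eq_sum_range' (n := Fintype.card G + 1)]
  · rw [AddSubmonoidClass.coe_finsetSum, map_sum]
    exact Finset.sum_congr rfl fun j _ => by rw [hc, one_pow, mul_one]
  · have := natDegree_sub_le (∏ σ : G, (1 + X * C (σ • (y : D)))) 1
    rw [natDegree_one, Nat.max_zero] at this
    have := this.trans (natDegree_prod_one_add_le (G := G) (y : D))
    omega

lemma comp_eq_vectorPoint_sum {T : Gr (maximalIdeal D) i ≃+ Gr (contractedIdeal A D) i}
    {ν : Coord (ResidueField D) (Gr (maximalIdeal D) i) →ₐ[ResidueField D]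
      Coord (ResidueField D) (Gr (maximalIdeal D) i)} {y : ↥(maximalIdeal D ^ i)}
    {c : ℕ →₀ ↥(contractedIdeal A D ^ i)} {s : Finset ℕ} (hcs : c.support ⊆ s)
    (hν : ∀ ℓ : Module.Dual (ResidueField D) (Gr (maximalIdeal D) i),
      vectorPoint (Gr.mk y) X (ν (coord ℓ)) =
        c.sum fun j z => C (ℓ (T.symm (Gr.mk z))) * X ^ j) :
    (vectorPoint (Gr.mk y) (1 : ResidueField D)).comp ν =
      vectorPoint (T.symm (Gr.mk (∑ j ∈ s, c j))) (1 : ResidueField D) := by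
  refine SymmetricAlgebra.algHom_ext (LinearMap.ext fun ℓ => ?_)
  change vectorPoint (Gr.mk y) 1 (ν (coord ℓ)) = vectorPoint _ 1 (coord ℓ)
  rw [vectorPoint_one, AlgHom.comp_apply, hν ℓ, vectorPoint_coord,
    Finsupp.sum_of_support_subset _ hcs _ fun j _ => ?_, map_sum, Gr.mk_sum, map_sum, map_sum,
    smul_eq_mul, mul_one]
  · refine Finset.sum_congr rfl fun j _ => ?_
    simp
  · have : (Gr.mk 0 : Gr (contractedIdeal A D) i) = 0 := rfl
    rw [this]
    simp

end Coefficients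

variable (OK : Type*) {K OL L : Type*} [CommRing OK] [IsDomain OK] [IsDiscreteValuationRing OK]
    [Field K] [Algebra OK K] [IsFractionRing OK K]
    [Field L] [Algebra K L] [FiniteDimensional K L] [IsGalois K L]
    [CommRing OL] [IsDomain OL] [IsDiscreteValuationRing OL]
    [Algebra OK OL] [Algebra OL L] [IsFractionRing OL L] [Algebra OK L] [IsScalarTower OK K L]
    [IsScalarTower OK OL L] [IsIntegralClosure OL OK L]

/-- The exact sequence given by the norm on the graded pieces of the groups of units at the last
ramification jump. -/
theorem norm_exactSequence {α δ : OL} {H : Subgroup Gal(L/K)} {i : ℕ} (hi : 0 < i)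
    (hα : letI := galoisAction OK K OL L; IsUniformizingGenerator Gal(L/K) α)
    (h : letI := galoisAction OK K OL L; IsLastBreak Gal(L/K) α δ H)
    (hδ : Associated δ (α ^ (i + 1)))
    {β : Gal(L/K) → ResidueField OL}
    (hβ : β = fun σ => residueQuot (act OK OL σ α - α) δ) :
    letI M := IntermediateField.fixedField H
    Function.Bijective (unitsToGr (maximalIdeal OL) hi) ∧
    Function.Bijective (unitsToGr (integersIdeal OK OL M) hi) ∧
    ∃ (N : GrUnits (maximalIdeal OL) i →* GrUnits (integersIdeal OK OL M) i)
      (T : Gr (maximalIdeal OL) i ≃+ Gr (integersIdeal OK OL M) i)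
      (ν : Coord (ResidueField OL) (Gr (maximalIdeal OL) i) →ₐ[ResidueField OL]
        Coord (ResidueField OL) (Gr (maximalIdeal OL) i)),
      IsInducedByNorm OL M i N ∧ IsInducedByTrace OL M i T ∧
      IsNormTraceMorphism OL M i T ν ∧
      (∀ ξ : GrUnits (maximalIdeal OL) i,
        (vectorPoint (unitsToGr (maximalIdeal OL) hi ξ).toAdd (1 : ResidueField OL)).comp ν =
        vectorPoint (T.symm (unitsToGr (integersIdeal OK OL M) hi (N ξ)).toAdd)
          (1 : ResidueField OL)) ∧
      ∃ (u : H → ↥(higherUnits (maximalIdeal OL) i)) (u₀ : ↥(higherUnits (maximalIdeal OL) i)),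
        (∀ σ : H, ((u σ : OLˣ) : OL) * α = act OK OL (σ : Gal(L/K)) α) ∧
        ((u₀ : OLˣ) : OL) * α = α + δ ∧
        letI v : H → Gr (maximalIdeal OL) i := fun σ =>
          (unitsToGr (maximalIdeal OL) hi (GrUnits.mk (u σ))).toAdd
        letI v₀ : Gr (maximalIdeal OL) i :=
          (unitsToGr (maximalIdeal OL) hi (GrUnits.mk u₀)).toAdd
        IsExactSequence (lineGroup OL i) (lineGroup OL i)
          (fun σ : H => vectorPoint (v σ) (1 : ResidueField OL)) ν ∧
        IsExactSequence (additiveGroup (ResidueField OL)) (additiveGroup (ResidueField OL))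
          (fun σ : H => aeval (β σ)) (aeval (normalizedPoly H β)) ∧
        Function.Bijective (vectorPoint (k := ResidueField OL) v₀ (X : (ResidueField OL)[X])) ∧
        (∀ σ : H, v σ = β σ • v₀) ∧
        (vectorPoint v₀ (X : (ResidueField OL)[X])).comp ν =
          (aeval (normalizedPoly H β)).comp (vectorPoint v₀ (X : (ResidueField OL)[X])) := by
  classical
  let _ := galoisAction OK K OL L
  have hA := isFixedRing_integers (OL := OL) OK H
  have hαH := hα.subgroup H
  have hsb := h.hasSingleBreak hδ
  have hα0 := hα.irreducible.ne_zero
  have hinj : Set.InjOn β H := hβ ▸ h.residueQuot_injOn hα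
  have hadd : ∀ σ ∈ H, ∀ τ ∈ H, β (σ * τ) = β σ + β τ := fun σ hσ τ hτ => by
    subst hβ
    exact h.residueQuot_mul hα hσ hτ
  have hbot := additiveGroup_exact hinj hadd
  have hLbij := unitsToGr_bijective (I := maximalIdeal OL) hi fun x hx => isUnit_one_add_of_mem hx
  have hMbij := unitsToGr_bijective (I := contractedIdeal (integers OK OL (IntermediateField.fixedField H)) OL) hi
    fun x hx => hA.isUnit_one_add hx
  refine ⟨hLbij, hMbij, ?_⟩
  -- The units `σ(α) / α` and `α_{n-1} / α_n`.
  have hmul : ∀ x : OL, α ^ (i + 1) ∣ x * α → x ∈ maximalIdeal OL ^ i := fun x hx => by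
    rw [hα.mem_pow_iff]
    rwa [pow_succ, mul_dvd_mul_iff_right hα0] at hx
  have hu : ∀ x : OL, Associated α x → α ^ (i + 1) ∣ x - α →
      ∃ u : ↥(higherUnits (maximalIdeal OL) i), ((u : OLˣ) : OL) * α = x := fun x hx hxα => by
    obtain ⟨u, hu⟩ := hx
    refine ⟨⟨u, mem_higherUnits_iff.2 (hmul _ ?_)⟩, by rw [mul_comm, hu]⟩
    rwa [sub_mul, one_mul, mul_comm, hu]
  have hu₁ : ∀ σ : H, ∃ u : ↥(higherUnits (maximalIdeal OL) i),
      ((u : OLˣ) : OL) * α = act OK OL (σ : Gal(L/K)) α := fun σ =>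
    hu _ (associated_smul hα.irreducible (σ : Gal(L/K)) α).symm
      (hδ.symm.dvd.trans ((h.mem_iff _).1 σ.2))
  choose u hu₁ using hu₁
  obtain ⟨t, ht⟩ : α ^ (i + 1) ∣ δ := hδ.symm.dvd
  obtain ⟨u₀, hu₀⟩ := hu (α + δ) (by
    have hunit : IsUnit (1 + α ^ i * t) := isUnit_one_add_of_mem
      (hα.dvd_iff.1 ((dvd_pow_self α hi.ne').mul_right t))
    refine ⟨hunit.unit, ?_⟩
    rw [IsUnit.unit_spec, ht, pow_succ]
    ring) (by rw [add_sub_cancel_left]; exact ⟨t, ht⟩)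
  let d : ↥(maximalIdeal OL ^ i) := ⟨((u₀ : OLˣ) : OL) - 1, sub_one_mem u₀.2⟩
  have hd : (d : OL) * α = δ := by
    change (((u₀ : OLˣ) : OL) - 1) * α = δ
    rw [sub_mul, hu₀]
    ring
  have hd0 : Gr.mk d ≠ 0 := by
    rw [ne_eq, Gr.mk_eq_zero_iff, hα.mem_pow_iff]
    intro hdvd
    have := mul_dvd_mul_right hdvd α
    rw [hd, ← pow_succ, hδ.dvd_iff_dvd_right,
      pow_dvd_pow_iff hα0 hα.irreducible.not_isUnit] at this
    omega
  have hbij : Function.Bijective (vectorPoint (k := ResidueField OL) (Gr.mk d)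
      (X : (ResidueField OL)[X])) := vectorPoint_bijective hd0 (Gr.exists_eq_smul hd0)
  have hv : ∀ σ : H, (unitsToGr (maximalIdeal OL) hi (GrUnits.mk (u σ))).toAdd =
      β σ • Gr.mk d := fun σ => by
    obtain ⟨s, hs⟩ := (h.mem_iff (σ : Gal(L/K))).1 σ.2
    have hβs : β σ = residue OL s := by
      rw [hβ]
      exact residueQuot_mul_eq h.ne_zero hs
    rw [hβs, Gr.residue_smul, unitsToGr_mk, toAdd_ofAdd]
    congr 1
    apply Subtype.ext
    apply mul_right_cancel₀ hα0
    change (((u σ : OLˣ) : OL) - 1) * α = (s * d) * α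
    rw [mul_assoc, hd, mul_comm s, ← hs, sub_mul, hu₁, one_mul]
    rfl
  -- The norm and the trace.
  obtain ⟨N, hN⟩ := hA.exists_norm hsb hαH
  obtain ⟨T, hT'⟩ := hA.exists_trace hsb hαH
  have hT : ∀ x : ↥(maximalIdeal OL ^ i),
      ∃ y : ↥(contractedIdeal (integers OK OL (IntermediateField.fixedField H)) OL ^ i),
      algebraMap (integers OK OL (IntermediateField.fixedField H)) OL y =
        ∑ σ : H, σ • (x : OL) := fun x => by
    obtain ⟨y, hy⟩ := hA.exists_eq _ (smul_sum_smul (G := H) (x : OL))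
    refine ⟨⟨y, (hA.mem_pow_iff hsb hαH).2 ?_⟩, hy⟩
    rw [hy]
    exact hsb.dvd_sum_smul hαH (Nat.le_succ i) (hα.mem_pow_iff.1 x.2)
  obtain ⟨ν, hν⟩ := exists_comp_eq_aeval_comp hbij (normalizedPoly H β)
  have hcoord : ∀ (y : ↥(maximalIdeal OL ^ i))
      (c : ℕ →₀ ↥(contractedIdeal (integers OK OL (IntermediateField.fixedField H)) OL ^ i)),
      (∀ j, algebraMap (integers OK OL (IntermediateField.fixedField H)) OL (c j) =
        (∏ σ : H, (1 + X * C (σ • (y : OL))) - 1).coeff j) →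
      c.support ⊆ Finset.range (Fintype.card H + 1) →
      ∀ ℓ : Module.Dual (ResidueField OL) (Gr (maximalIdeal OL) i),
        vectorPoint (Gr.mk y) X (ν (coord ℓ)) =
          c.sum fun j z => C (ℓ (T.symm (Gr.mk z))) * X ^ j := by
    intro y c hc hcs ℓ
    obtain ⟨l, hl⟩ := Gr.exists_eq_smul hd0 (Gr.mk y)
    rw [h.sum_coeff_eq hα hδ hA hT hT' hd hl hc hcs ℓ, hl, vectorPoint_smul_X, AlgHom.comp_apply,
      ← AlgHom.comp_apply _ ν, hν, AlgHom.comp_apply, vectorPoint_coord, map_smul, map_smul,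
      aeval_X, smul_eq_C_mul, hβ]
    rfl
  have hM : Infinite (IntermediateField.fixedField H) := by
    have := infinite_of_isDiscreteValuationRing OK
    have : Infinite K := Infinite.of_injective _ (IsFractionRing.injective OK K)
    exact Infinite.of_injective _ (algebraMap K (IntermediateField.fixedField H)).injective
  have hξ : ∀ ξ : GrUnits (maximalIdeal OL) i,
      (vectorPoint (unitsToGr (maximalIdeal OL) hi ξ).toAdd (1 : ResidueField OL)).comp ν =
      vectorPoint (T.symm (unitsToGr
        (contractedIdeal (integers OK OL (IntermediateField.fixedField H)) OL) hi (N ξ)).toAdd)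
          (1 : ResidueField OL) := by
    intro ξ
    obtain ⟨x, rfl⟩ := GrUnits.mk_surjective ξ
    obtain ⟨z, hz, hNz⟩ := hN x
    obtain ⟨c, hc, hcs⟩ := hA.exists_coeff hsb hαH ⟨((x : OLˣ) : OL) - 1, sub_one_mem x.2⟩
    have hsum := hA.eq_sum_coeff hz _ rfl hc ⟨_, sub_one_mem z.2⟩ rfl
    rw [hNz, unitsToGr_mk, unitsToGr_mk, toAdd_ofAdd, toAdd_ofAdd, hsum]
    exact comp_eq_vectorPoint_sum hcs (hcoord _ c hc hcs)
  refine ⟨N, T, ν, fun x => ?_, fun x => ?_, fun y => ?_, hξ, u, u₀, hu₁, hu₀, ?_, hbot,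
    hbij, hv, hν⟩
  · obtain ⟨y, hy, hNy⟩ := hN x
    refine ⟨y, ?_, hNy⟩
    rw [algebraMap_norm_fixedField]
    refine (congrArg (algebraMap OL L) hy).trans ?_
    rw [map_prod]
    exact Finset.prod_congr rfl fun σ _ => algebraMap_act OK (σ : Gal(L/K)) _
  · obtain ⟨y, hy⟩ := hT x
    refine ⟨y, ?_, hT' x y hy⟩
    rw [algebraMap_trace_fixedField]
    refine (congrArg (algebraMap OL L) hy).trans ?_
    rw [map_sum]
    exact Finset.sum_congr rfl fun σ _ => algebraMap_act OK (σ : Gal(L/K)) _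
  · obtain ⟨c, hc, hcs⟩ := hA.exists_coeff hsb hαH y
    refine ⟨c, fun j => ?_, hcoord y c hc hcs⟩
    refine (congrArg (algebraMap OL L) (hc j)).trans ?_
    have hnorm := map_norm_one_add_X_tmul
      (fun σ : H => ((IntermediateField.subgroupEquivAlgEquiv H σ :
        Gal(L/IntermediateField.fixedField H)) : L →ₐ[IntermediateField.fixedField H] L))
      (fun x => algebraMap_norm_fixedField H x) (algebraMap OL L y)
    rw [← coeff_map, ← coeff_map, Polynomial.map_sub, Polynomial.map_sub, hnorm,
      Polynomial.map_prod, Polynomial.map_one, Polynomial.map_one]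
    congr 2
    refine Finset.prod_congr rfl fun σ _ => ?_
    rw [Polynomial.map_add, Polynomial.map_mul, Polynomial.map_one, map_X, map_C]
    congr 3
    exact algebraMap_act OK (σ : Gal(L/K)) _
  · let e := AlgEquiv.ofBijective _ hbij
    refine hbot.transport e (vectorPoint_isHom (Gr.mk d)) e (vectorPoint_isHom (Gr.mk d))
      (additiveGroup_counit_comp_vectorPoint (Gr.mk d)) (fun σ => ?_) hν
    exact (congrArg (fun v => vectorPoint v (1 : ResidueField OL)) (hv σ)).trans
      (vectorPoint_smul_one _ _)

end UnitGroups

/-! ### The component of the normalized dilatation -/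

section ComponentGroup

variable (OK : Type*) {K OL L : Type*} [CommRing OK] [IsDomain OK] [IsDiscreteValuationRing OK]
    [Field K] [Algebra OK K] [IsFractionRing OK K]
    [Field L] [Algebra K L] [FiniteDimensional K L] [IsGalois K L]
    [CommRing OL] [IsDomain OL] [IsDiscreteValuationRing OL]
    [Algebra OK OL] [Algebra OL L] [IsFractionRing OL L] [Algebra OK L] [IsScalarTower OK K L]
    [IsScalarTower OK OL L] [IsIntegralClosure OL OK L]

lemma eval_derivative_minpolyOL {α : OL} [DecidableEq Gal(L/K)]
    (hα : letI := galoisAction OK K OL L; IsUniformizingGenerator Gal(L/K) α) :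
    (minpolyOL OK α).derivative.eval α =
      ∏ σ ∈ Finset.univ.erase (1 : Gal(L/K)), (α - act OK OL σ α) := by
  have h1 : act OK OL (1 : Gal(L/K)) α = α := by simp [act]
  have := eval_derivative_prod_X_sub_C Finset.univ (fun σ : Gal(L/K) => act OK OL σ α)
    (Finset.mem_univ 1)
  rw [← minpolyOL_eq_prod OK hα, h1] at this
  exact this

lemma associated_eval_zero_minpolyOL {α : OL}
    (hα : letI := galoisAction OK K OL L; IsUniformizingGenerator Gal(L/K) α) :
    Associated ((minpolyOL OK α).eval 0) (α ^ Nat.card Gal(L/K)) := by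
  let _ := galoisAction OK K OL L
  rw [minpolyOL_eq_prod OK hα, eval_prod, Nat.card_eq_fintype_card, ← Finset.card_univ,
    ← Finset.prod_const]
  refine Associated.prod _ _ _ fun σ _ => ?_
  rw [eval_sub, eval_X, eval_C, zero_sub]
  exact (associated_smul hα.irreducible σ α).neg_left

/-- The component of the reduced closed fiber of the normalized dilatation is an extension of the
reduced closed fiber of the dilatation by the last ramification group. -/
theorem component_exactSequence {α δ : OL} {H : Subgroup Gal(L/K)} {k : ℕ}
    (hα : letI := galoisAction OK K OL L; IsUniformizingGenerator Gal(L/K) α)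
    (h : letI := galoisAction OK K OL L; IsLastBreak Gal(L/K) α δ H)
    {n : ℕ} (hn : n = Nat.card Gal(L/K))
    (hk : Associated ((minpolyOL OK α).derivative.eval α * δ) (α ^ (n + k)))
    {β : Gal(L/K) → ResidueField OL}
    (hβ : β = fun σ => residueQuot (act OK OL σ α - α) δ) :
    ∃ z w : ↥(maximalIdeal OL ^ k),
      (z : OL) * (minpolyOL OK α).eval 0 = α ^ (n + k) ∧
      (w : OL) * (minpolyOL OK α).eval 0 = (minpolyOL OK α).derivative.eval α * δ ∧
      Function.Bijective (fiberToLine OK L α (n + k) z) ∧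
      letI proj := (componentProj OK K L α (n + k)).comp (fiberToLine OK L α (n + k) z)
      (∀ σ : Gal(L/K), primeOfPoint (galoisPoint OK α (n + k) σ) ∈
        connectedComponent (primeOfPoint (galoisPoint OK α (n + k) (1 : Gal(L/K)))) ↔ σ ∈ H) ∧
      ∃ (law : GroupLaw (ResidueField OL) (ComponentAt OK K L α (n + k)))
        (ι : H → (ComponentAt OK K L α (n + k) →ₐ[ResidueField OL] ResidueField OL)),
        (∀ σ : H, (ι σ).comp (toComponentAt OK K L α (n + k)) =
          galoisPoint OK α (n + k) (σ : Gal(L/K))) ∧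
        law.counit = ι 1 ∧
        (∀ law' : GroupLaw (ResidueField OL) (ComponentAt OK K L α (n + k)),
          law'.counit = ι 1 → law'.IsHom (lineGroup OL k) proj → law'.comul = law.comul) ∧
        IsExactSequence law (lineGroup OL k) ι proj ∧
        IsExactSequence (additiveGroup (ResidueField OL)) (additiveGroup (ResidueField OL))
          (fun σ : H => aeval (β σ)) (aeval (normalizedPoly H β)) ∧
        Function.Bijective (vectorPoint (k := ResidueField OL) (Gr.mk w)
          (X : (ResidueField OL)[X])) ∧
        ∃ Φ : ComponentAt OK K L α (n + k) ≃ₐ[ResidueField OL] (ResidueField OL)[X],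
          (additiveGroup (ResidueField OL)).IsHom law Φ.toAlgHom ∧
          (∀ σ : H, (aeval (β σ) : (ResidueField OL)[X] →ₐ[ResidueField OL] _).comp
            Φ.toAlgHom = ι σ) ∧
          Φ.toAlgHom.comp proj = (aeval (normalizedPoly H β)).comp
            (vectorPoint (Gr.mk w) (X : (ResidueField OL)[X])) := by
  classical
  let _ := galoisAction OK K OL L
  have hα0 := hα.irreducible.ne_zero
  have hinj : Set.InjOn β H := hβ ▸ h.residueQuot_injOn hα
  have hadd : ∀ σ ∈ H, ∀ τ ∈ H, β (σ * τ) = β σ + β τ := fun σ hσ τ hτ => by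
    subst hβ
    exact h.residueQuot_mul hα hσ hτ
  have hbot := additiveGroup_exact hinj hadd
  have hf : minpolyOL OK α = ∏ σ : Gal(L/K), (X - C (σ • α)) := minpolyOL_eq_prod OK hα
  have hder : (minpolyOL OK α).derivative.eval α =
      ∏ σ ∈ Finset.univ.erase (1 : Gal(L/K)), (α - σ • α) := eval_derivative_minpolyOL OK hα
  have hm : Associated (∏ σ : Gal(L/K), gap α δ H σ) (α ^ (n + k)) :=
    h.associated_prod_gap.trans (hder ▸ hk)
  have hn0 : n + k ≠ 0 := by
    have : 0 < Nat.card Gal(L/K) := Nat.card_pos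
    omega
  -- The classes of `α ^ (n + k) / f(0)` and `f'(α) δ / f(0)`.
  obtain ⟨v, hv⟩ := associated_eval_zero_minpolyOL OK hα
  rw [← hn] at hv
  obtain ⟨c, hc⟩ := hk.symm
  have hc' : (∏ σ ∈ Finset.univ.erase (1 : Gal(L/K)), (α - σ • α)) * δ = (c : OL) * α ^ (n + k) := by
    rw [← hder, ← hc, mul_comm]
  let z : ↥(maximalIdeal OL ^ k) := ⟨v * α ^ k, hα.mem_pow_iff.2 (dvd_mul_left _ _)⟩
  have hz : (z : OL) * (minpolyOL OK α).eval 0 = α ^ (n + k) := by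
    rw [pow_add, ← hv]
    change (v * α ^ k) * _ = _
    ring
  have hz0 : Gr.mk z ≠ 0 := by
    rw [ne_eq, Gr.mk_eq_zero_iff, hα.mem_pow_iff]
    intro hdvd
    rw [v.isUnit.dvd_mul_left, pow_dvd_pow_iff hα0 hα.irreducible.not_isUnit] at hdvd
    omega
  have hw : Gr.mk ((c : OL) • z) = residue OL c • Gr.mk z := rfl
  have hc0 : residue OL (c : OL) ≠ 0 := (residue_ne_zero_iff_isUnit _).2 c.isUnit
  have hw0 : Gr.mk ((c : OL) • z) ≠ 0 := by
    rw [hw]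
    exact smul_ne_zero hc0 hz0
  have hzb : Function.Bijective (vectorPoint (k := ResidueField OL) (Gr.mk z)
      (X : (ResidueField OL)[X])) := vectorPoint_bijective hz0 (Gr.exists_eq_smul hz0)
  have hwb : Function.Bijective (vectorPoint (k := ResidueField OL) (Gr.mk ((c : OL) • z))
      (X : (ResidueField OL)[X])) := vectorPoint_bijective hw0 (Gr.exists_eq_smul hw0)
  have hS := aeval_dilatationCoord_bijective (L := L) h hα hf hm hn0
  have hfib : fiberToLine OK L α (n + k) z = (aeval (ReducedFiber.mk (O := OL)
      (dilatationCoord L (minpolyOL OK α) α (n + k)))).comp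
        (vectorPoint (Gr.mk z) (X : (ResidueField OL)[X])) := by
    refine SymmetricAlgebra.algHom_ext (LinearMap.ext fun ℓ => ?_)
    change vectorPoint _ _ (coord ℓ) = aeval _ (vectorPoint _ _ (coord ℓ))
    rw [vectorPoint_coord, vectorPoint_coord, map_smul, aeval_X]
  have hfb : Function.Bijective (fiberToLine OK L α (n + k) z) := by
    rw [hfib, AlgHom.coe_comp]
    exact hS.comp hzb
  obtain ⟨Φ, hΦ⟩ : ∃ Φ : ComponentAt OK K L α (n + k) ≃ₐ[ResidueField OL] (ResidueField OL)[X],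
      ∀ x, Φ (toComponentAt OK K L α (n + k) x) = gaussFiber h hα hf hm 1 x :=
    exists_component_equiv h hα hf hm (eval_act OK α 1)
  let d := AlgEquiv.ofBijective _ hwb
  have hproj : Φ.toAlgHom.comp ((componentProj OK K L α (n + k)).comp
      (fiberToLine OK L α (n + k) z)) = (aeval (normalizedPoly H β)).comp d.toAlgHom := by
    refine SymmetricAlgebra.algHom_ext (LinearMap.ext fun ℓ => ?_)
    change Φ (componentProj OK K L α (n + k) (fiberToLine OK L α (n + k) z (coord ℓ))) =
      aeval (normalizedPoly H β) (vectorPoint (Gr.mk ((c : OL) • z)) X (coord ℓ))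
    rw [fiberToLine, vectorPoint_coord, vectorPoint_coord, map_smul, map_smul, map_smul, aeval_X,
      hw, map_smul, smul_eq_mul, mul_comm, ← smul_eq_mul, smul_assoc]
    congr 1
    rw [componentProj, AlgHom.comp_apply, hΦ, ← ReducedFiber.mkHom_apply, ReducedFiber.map_mk,
      gaussFiber_mkHom, gaussRed_dilatationCoord h hα hf hm hc', smul_eq_C_mul, hβ]
    rfl
  refine ⟨z, (c : OL) • z, hz, ?_, hfb, fun σ =>
    primeOfPoint_mem_connectedComponent_iff h hα hf hm (eval_act OK α σ) (eval_act OK α 1),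
    (additiveGroup (ResidueField OL)).transport Φ, fun σ => (aeval (β σ)).comp Φ.toAlgHom,
    fun σ => ?_, ?_, fun law' h₁ h₂ => ?_, ?_, hbot, hwb, Φ, GroupLaw.transport_isHom _ Φ,
    fun σ => rfl, hproj⟩
  · change ((c : OL) * z) * _ = _
    rw [mul_assoc, hz, mul_comm, hc]
  · refine AlgHom.ext fun x => ?_
    have := AlgHom.congr_fun (point_rootSection_of_mem (L := L) h hα hf hm σ.2
      (eval_act OK α (σ : Gal(L/K)))) x
    refine Eq.trans ?_ this.symm
    change aeval (β σ) (Φ (toComponentAt OK K L α (n + k) x)) = _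
    rw [hΦ, hβ]
    rfl
  · change (aeval 0).comp Φ.toAlgHom = (aeval (β 1)).comp Φ.toAlgHom
    rw [map_one_of_additive hadd]
  · refine comul_eq_transport hinj hadd Φ d (vectorPoint_isHom _) hproj law' ?_ h₂
    rw [h₁]
    change (aeval (β 1)).comp Φ.toAlgHom = _
    rw [map_one_of_additive hadd]
  · exact hbot.transport Φ (GroupLaw.transport_isHom _ Φ) d (vectorPoint_isHom _)
      (additiveGroup_counit_comp_vectorPoint _) (fun σ => rfl) hproj

end ComponentGroup

end TotRam

end

theorem proposition1p2 {p : ℕ} [Fact p.Prime] {OK K OL L : Type*}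
    [CommRing OK] [IsDomain OK] [IsDiscreteValuationRing OK] [HenselianLocalRing OK]
    [CharP (ResidueField OK) p]
    [Field K] [Algebra OK K] [IsFractionRing OK K]
    [Field L] [Algebra K L] [FiniteDimensional K L] [IsGalois K L]
    [CommRing OL] [IsDomain OL] [IsDiscreteValuationRing OL]
    [Algebra OK OL] [Algebra OL L] [IsFractionRing OL L] [Algebra OK L] [IsScalarTower OK K L]
    [IsScalarTower OK OL L] [IsIntegralClosure OL OK L]
    -- `L` is totally ramified of degree `n = e` over `K`
    (n : ℕ) (hn : Module.finrank K L = n)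
    (hram : (maximalIdeal OK).map (algebraMap OK OL) = maximalIdeal OL ^ n)
    (hres : Function.Surjective (algebraMap OK (ResidueField OL)))
    -- `α = α_n` is a uniformizer, `f` is its minimal polynomial and `α_1, …, α_n` are the roots
    (α : OL) (hα : Irreducible α) (f : OL[X]) (hf : f = TotRam.minpolyOL OK α)
    (a : ℕ → OL) (hfa : f = ∏ j ∈ Finset.Icc 1 n, (X - C (a j))) (han : a n = α)
    (hmono : ∀ i j, 1 ≤ i → i ≤ j → j ≤ n →
      IsDiscreteValuationRing.addVal OL (a i - a n) ≤ IsDiscreteValuationRing.addVal OL (a j - a n))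
    -- `δ = α_{n-1} - α_n` and `β(σ) = (σ(α) - α) / δ mod 𝔪_L`
    (δ : OL) (hδ : δ = a (n - 1) - a n)
    (β : Gal(L/K) → ResidueField OL)
    (hβ : β = fun σ => TotRam.residueQuot (TotRam.act OK OL σ α - α) δ) :
    -- Part 1
    (∀ r : ℚ, 1 < r → IsGreatest {s : ℚ | 1 < s ∧ TotRam.upperGroup OK K OL L s ≠ ⊥} r →
      letI H := TotRam.upperGroup OK K OL L r
      letI b₁ := TotRam.normalizedPoly H β
      -- `k = e (r - 1)`, so that `e r = n + k`
      ∃ k : ℕ, (k : ℚ) = n * (r - 1) ∧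
        ((n + k : ℕ) : ℕ∞) = IsDiscreteValuationRing.addVal OL (f.derivative.eval α) +
          IsDiscreteValuationRing.addVal OL δ ∧
        -- `β` is well defined and injective on `H = G ^ r`
        (∀ σ ∈ H, δ ∣ TotRam.act OK OL σ α - α) ∧ Set.InjOn β H ∧
        -- the classes `z` of `α ^ (e r) / f(0)` and `w` of `f'(α) δ / f(0)`
        ∃ z w : ↥(maximalIdeal OL ^ k),
          (z : OL) * f.eval 0 = α ^ (n + k) ∧ (w : OL) * f.eval 0 = f.derivative.eval α * δ ∧
          -- the reduced closed fiber of the dilatation is identified with the line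
          Function.Bijective (TotRam.fiberToLine OK L α (n + k) z) ∧
          letI proj := (TotRam.componentProj OK K L α (n + k)).comp
            (TotRam.fiberToLine OK L α (n + k) z)
          -- the component meets exactly the sections given by the elements of `H`
          (∀ σ : Gal(L/K), TotRam.primeOfPoint (TotRam.galoisPoint OK α (n + k) σ) ∈
            connectedComponent (TotRam.primeOfPoint
              (TotRam.galoisPoint OK α (n + k) (1 : Gal(L/K)))) ↔ σ ∈ H) ∧
          ∃ (law : TotRam.GroupLaw (ResidueField OL) (TotRam.ComponentAt OK K L α (n + k)))
            (ι : H → (TotRam.ComponentAt OK K L α (n + k) →ₐ[ResidueField OL] ResidueField OL)),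
            (∀ σ : H, (ι σ).comp (TotRam.toComponentAt OK K L α (n + k)) =
              TotRam.galoisPoint OK α (n + k) (σ : Gal(L/K))) ∧
            -- the group structure on the component is the unique compatible one
            law.counit = ι 1 ∧
            (∀ law' : TotRam.GroupLaw (ResidueField OL) (TotRam.ComponentAt OK K L α (n + k)),
              law'.counit = ι 1 → law'.IsHom (TotRam.lineGroup OL k) proj →
                law'.comul = law.comul) ∧
            -- the two rows
            TotRam.IsExactSequence law (TotRam.lineGroup OL k) ι proj ∧
            TotRam.IsExactSequence (TotRam.additiveGroup (ResidueField OL))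
              (TotRam.additiveGroup (ResidueField OL))
              (fun σ : H => aeval (β σ)) (aeval b₁) ∧
            -- the vertical isomorphisms and the commutativity of the two squares
            Function.Bijective (TotRam.vectorPoint (k := ResidueField OL) (TotRam.Gr.mk w)
              (X : (ResidueField OL)[X])) ∧
            ∃ Φ : TotRam.ComponentAt OK K L α (n + k) ≃ₐ[ResidueField OL] (ResidueField OL)[X],
              (TotRam.additiveGroup (ResidueField OL)).IsHom law Φ.toAlgHom ∧
              (∀ σ : H, (aeval (β σ) : (ResidueField OL)[X] →ₐ[ResidueField OL] _).comp
                Φ.toAlgHom = ι σ) ∧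
              Φ.toAlgHom.comp proj = (aeval b₁).comp
                (TotRam.vectorPoint (TotRam.Gr.mk w) (X : (ResidueField OL)[X]))) ∧
    -- Part 2
    (∀ (i : ℕ) (hi : 0 < i), IsGreatest {j : ℕ | TotRam.lowerGroup OK K OL L j ≠ ⊥} i →
      letI H := TotRam.lowerGroup OK K OL L i
      letI b₁ := TotRam.normalizedPoly H β
      letI M := IntermediateField.fixedField H
      (i : ℕ∞) + 1 = IsDiscreteValuationRing.addVal OL δ ∧
      (∀ σ ∈ H, δ ∣ TotRam.act OK OL σ α - α) ∧ Set.InjOn β H ∧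
      -- the identification of graded pieces of unit groups and of ideals
      Function.Bijective (TotRam.unitsToGr (maximalIdeal OL) hi) ∧
      Function.Bijective (TotRam.unitsToGr (TotRam.integersIdeal OK OL M) hi) ∧
      -- the maps `N ^ i` and `T ^ i`, and `ν = (T ^ i)⁻¹ ∘ N ^ i`
      ∃ (N : TotRam.GrUnits (maximalIdeal OL) i →*
            TotRam.GrUnits (TotRam.integersIdeal OK OL M) i)
        (T : TotRam.Gr (maximalIdeal OL) i ≃+ TotRam.Gr (TotRam.integersIdeal OK OL M) i)
        (ν : TotRam.Coord (ResidueField OL) (TotRam.Gr (maximalIdeal OL) i) →ₐ[ResidueField OL]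
          TotRam.Coord (ResidueField OL) (TotRam.Gr (maximalIdeal OL) i)),
        TotRam.IsInducedByNorm OL M i N ∧ TotRam.IsInducedByTrace OL M i T ∧
        TotRam.IsNormTraceMorphism OL M i T ν ∧
        (∀ ξ : TotRam.GrUnits (maximalIdeal OL) i,
          (TotRam.vectorPoint (TotRam.unitsToGr (maximalIdeal OL) hi ξ).toAdd
            (1 : ResidueField OL)).comp ν =
          TotRam.vectorPoint (T.symm (TotRam.unitsToGr (TotRam.integersIdeal OK OL M) hi
            (N ξ)).toAdd) (1 : ResidueField OL)) ∧
        -- the units `σ(α) / α` and `α_{n-1} / α_n`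
        ∃ (u : H → ↥(TotRam.higherUnits (maximalIdeal OL) i))
          (u₀ : ↥(TotRam.higherUnits (maximalIdeal OL) i)),
          (∀ σ : H, ((u σ : OLˣ) : OL) * α = TotRam.act OK OL (σ : Gal(L/K)) α) ∧
          ((u₀ : OLˣ) : OL) * a n = a (n - 1) ∧
          letI v : H → TotRam.Gr (maximalIdeal OL) i := fun σ =>
            (TotRam.unitsToGr (maximalIdeal OL) hi (TotRam.GrUnits.mk (u σ))).toAdd
          letI v₀ : TotRam.Gr (maximalIdeal OL) i :=
            (TotRam.unitsToGr (maximalIdeal OL) hi (TotRam.GrUnits.mk u₀)).toAdd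
          -- the two rows
          TotRam.IsExactSequence (TotRam.lineGroup OL i) (TotRam.lineGroup OL i)
            (fun σ : H => TotRam.vectorPoint (v σ) (1 : ResidueField OL)) ν ∧
          TotRam.IsExactSequence (TotRam.additiveGroup (ResidueField OL))
            (TotRam.additiveGroup (ResidueField OL))
            (fun σ : H => aeval (β σ)) (aeval b₁) ∧
          -- the vertical isomorphisms and the commutativity of the two squares
          Function.Bijective (TotRam.vectorPoint (k := ResidueField OL) v₀
            (X : (ResidueField OL)[X])) ∧
          (∀ σ : H, v σ = β σ • v₀) ∧
          (TotRam.vectorPoint v₀ (X : (ResidueField OL)[X])).comp ν =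
            (aeval b₁).comp (TotRam.vectorPoint v₀ (X : (ResidueField OL)[X]))) ∧
    -- the groups in the two parts are the same
    (∀ (r : ℚ) (i : ℕ), 1 < r → 0 < i →
      IsGreatest {s : ℚ | 1 < s ∧ TotRam.upperGroup OK K OL L s ≠ ⊥} r →
      IsGreatest {j : ℕ | TotRam.lowerGroup OK K OL L j ≠ ⊥} i →
      TotRam.upperGroup OK K OL L r = TotRam.lowerGroup OK K OL L i) := by
  subst hf
  have hgen := TotRam.isUniformizingGenerator_galois (K := K) (L := L) OK hram hres hα
  have hcard : n = Nat.card Gal(L/K) := by rw [IsGalois.card_aut_eq_finrank, hn]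
  have hprod := (TotRam.minpolyOL_eq_prod OK hgen).symm.trans hfa
  -- A nontrivial element of the Galois group yields the data of the last ramification jump.
  have hbreak : ∀ i : ℕ, 0 < i → IsGreatest {j : ℕ | TotRam.lowerGroup OK K OL L j ≠ ⊥} i →
      (∀ σ : Gal(L/K), σ ≠ 1 → TotRam.act OK OL σ α - α ∣ δ) ∧ Associated δ (α ^ (i + 1)) ∧
      letI := TotRam.galoisAction OK K OL L
      TotRam.IsLastBreak Gal(L/K) α δ (TotRam.lowerGroup OK K OL L i) := by
    intro i hi hgr
    obtain ⟨σ₁, -, hσ₁⟩ := (TotRam.lowerGroup OK K OL L i).bot_or_exists_ne_one.resolve_left hgr.1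
    let _ := TotRam.galoisAction OK K OL L
    obtain ⟨σ₀, hσ₀, ha₀, hdvd⟩ := hgen.exists_penultimate hprod han hmono hσ₁
    rw [← hδ] at hdvd
    rw [ha₀, han] at hδ
    exact ⟨hdvd, TotRam.lowerGroup_isLastBreak OK K L hgen hσ₀ hδ hdvd hi hgr⟩
  have hβH : ∀ H : Subgroup Gal(L/K), (letI := TotRam.galoisAction OK K OL L
      TotRam.IsLastBreak Gal(L/K) α δ H) →
      (∀ σ ∈ H, δ ∣ TotRam.act OK OL σ α - α) ∧ Set.InjOn β H := by
    intro H h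
    let _ := TotRam.galoisAction OK K OL L
    exact ⟨fun σ hσ => (h.mem_iff σ).1 hσ, hβ ▸ h.residueQuot_injOn hgen⟩
  refine ⟨fun r hr hgr => ?_, fun i hi hgr => ?_, fun r i hr hi hgr hgr' => ?_⟩
  · obtain ⟨i, hi, hgri, hG, hri⟩ := TotRam.exists_lower_of_isGreatest_upper OK K OL L hr hgr
    obtain ⟨hdvd, hass, hlast⟩ := hbreak i hi hgri
    rw [← hG] at hlast
    have hk : Associated ((TotRam.minpolyOL OK α).derivative.eval α * δ)
        (α ^ (n + ∑ j ∈ Finset.Icc 1 i, Nat.card (TotRam.lowerGroup OK K OL L j))) := by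
      classical
      rw [TotRam.eval_derivative_minpolyOL OK hgen, hcard]
      convert TotRam.associated_prod_sub_mul OK K L hgen hass hdvd
    obtain ⟨h₁, h₂⟩ := hβH _ hlast
    refine ⟨∑ j ∈ Finset.Icc 1 i, Nat.card (TotRam.lowerGroup OK K OL L j), ?_, ?_, h₁, h₂,
      TotRam.component_exactSequence OK hgen hlast hcard hk hβ⟩
    · have hn0 : (n : ℚ) ≠ 0 := by
        rw [hcard]
        exact_mod_cast Nat.card_pos.ne'
      rw [hri, TotRam.herbrand_natCast, TotRam.lowerGroup_zero OK hgen, Subgroup.card_top, ← hcard,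
        mul_div_cancel₀ _ hn0, Nat.cast_sum]
    · rw [← IsDiscreteValuationRing.addVal_mul, ← hα.addVal_pow,
        IsDiscreteValuationRing.addVal_eq_iff_associated]
      exact hk.symm
  · obtain ⟨hdvd, hass, hlast⟩ := hbreak i hi hgr
    obtain ⟨h₁, h₂⟩ := hβH _ hlast
    refine ⟨?_, h₁, h₂, ?_⟩
    · rw [(IsDiscreteValuationRing.addVal_eq_iff_associated _ _).2 hass, hα.addVal_pow]
      rfl
    · have := TotRam.norm_exactSequence OK hi hgen hlast hass hβ
      have ha : a (n - 1) = α + δ := by rw [hδ, han, add_sub_cancel]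
      rw [han, ha]
      exact this
  · obtain ⟨i', hi', hgri, hG, -⟩ := TotRam.exists_lower_of_isGreatest_upper OK K OL L hr hgr
    rw [hG, hgri.unique hgr']
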